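/- Let $d_V,d_U\ge 0$ be integers, $V=L^2(\mathbb R^2,\mathbb R^{d_V})$ and $U=L^2(\mathbb R^2,\mathbb R^{d_U})$ (real-valued signals, Lebesgue measure). The group $\mathrm{SE}(2)=\mathbb R^2\rtimes\mathrm{SO}(2)$ acts on $\mathbb R^2$ by $\mathcal A_{(\gamma,\theta)}\mathbf x=\gamma+\theta\mathbf x$ and on $V$ and $U$ by $R_g\Phi(\mathbf x)=\Phi(\mathcal A_{g^{-1}}\mathbf x)$. **Charge-conserving convnets.** A multi-resolution charge-conserving convnet is given by a range $\Lambda\ge 0$, integers $T_{\mathrm{diff}}\ge 0$, $T_{\mathrm{mult}}\ge 1$, $d_{\mathrm{mult}}\ge 0$, and complex weights $w^{(t)}_{0,n}$, $w^{(t)}_{1,\mu,n,n_1}$, $w^{(t)}_{2,\mu_1,\mu_2,n,n_1,n_2}$ ($1\le t\le T_{\mathrm{mult}}$; charges $\mu,\mu_1,\mu_2\in\{-T_{\mathrm{diff}},\dots,T_{\mathrm{diff}}\}$), none of which depends on the grid spacing. For every grid spacing $\lambda>0$ it defines a map $\widehat f_\lambda:V\to U$ as follows. Put $Z_L=\{\mathbf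 k\in\mathbb Z^2:\|\mathbf k\|_\infty\le L\}$, let $Q_{\mathbf k}^{(\lambda)}$ be the square of side $\lambda$ centred at $\lambda\mathbf k$, and let $S=\lceil 4/\lambda^2\rceil$. 1. *Discretization.* With $\Lambda'=\Lambda+(T_{\mathrm{diff}}+S)\lambda$, replace $\Phi\in V$ by the grid signal $\lambda\mathbf k\mapsto\lambda^{-2}\int_{Q^{(\lambda)}_{\mathbf k}}\Phi$ for $\mathbf k\in Z_{\lfloor\Lambda'/\lambda\rfloor}$. 2. *Smoothing.* Apply $S$ times the operator $1+\frac{\lambda^2}{8}\Delta^{(\lambda)}$, where $$\Delta^{(\lambda)}\Phi(\lambda k_x,\lambda k_y)=\lambda^{-2}\big(\Phi(\lambda(k_x+1),\lambda k_y)+\Phi(\lambda(k_x-1),\lambda k_y)+\Phi(\lambda k_x,\lambda(k_y+1))+\Phi(\lambda k_x,\lambda(k_y-1))-4\Phi(\lambda k_x,\lambda k_y)\big).$$ Each application shrinks the domain $Z_{L+1}$ to $Z_L$. 3. *Differentiation.* Let $$\partial_z^{(\lambda)}\Phi(\lambda k_x,\lambda k_y)=\tfrac1{4\lambda}\big(\Phi(\lambda(k_x+1),\lambda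 k_y)-\Phi(\lambda(k_x-1),\lambda k_y)-i(\Phi(\lambda k_x,\lambda(k_y+1))-\Phi(\lambda k_x,\lambda(k_y-1)))\big),$$ and let $\partial_{\overline z}^{(\lambda)}$ be the same with $+i$ in place of $-i$. Start with the smoothed signal placed in the component of degree $s=0$ and charge $\mu=0$. Apply $T_{\mathrm{diff}}$ layers, each of which is the block operator on components $(s,\mu)$ with block $\partial_z^{(\lambda)}$ from $(s,\mu)$ to $(s+1,\mu+1)$, $\partial_{\overline z}^{(\lambda)}$ from $(s,\mu)$ to $(s+1,\mu-1)$, the identity from $(s,\mu)$ to itself, and $0$ otherwise. Each layer shrinks the domain $Z_{L+1}$ to $Z_L$, so that the resulting $\mathbb C^{d_V}$-valued components, with $0\le s\le T_{\mathrm{diff}}$ and $|\mu|\le s$, live on $Z_{\lfloor\Lambda/\lambda\rfloor}$. 4. *Multiplication.* At every grid point separately and identically, regard these values as features $\Phi_{\mu,n}$ of charge $\mu$, where $n$ runs over the pairs (degree $s$, component of $\mathbb R^{d_V}$). For $t=1,\dots,T_{\mathrm{mult}}-1$ replace the features $\Phi$ by $$\Psi_{\mu,n}=w^{(t)}_{0,n}\mathbf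 1_{\mu=0}+\sum_{n_1}w^{(t)}_{1,\mu,n,n_1}\Phi_{\mu,n_1}+\sum_{\mu_1+\mu_2=\mu}\sum_{n_1,n_2}w^{(t)}_{2,\mu_1,\mu_2,n,n_1,n_2}\Phi_{\mu_1,n_1}\Phi_{\mu_2,n_2},\qquad |\mu|\le T_{\mathrm{diff}},\ 1\le n\le d_{\mathrm{mult}},$$ the sum being over $|\mu_1|,|\mu_2|\le T_{\mathrm{diff}}$. The last layer $t=T_{\mathrm{mult}}$ outputs the real parts of the same expressions for $\mu=0$ and $1\le n\le d_U$. The value $\widehat f_\lambda(\Phi)\in U$ is the function equal to the resulting vector of $\mathbb R^{d_U}$ on each square $Q^{(\lambda)}_{\mathbf k}$ with $\mathbf k\in Z_{\lfloor\Lambda/\lambda\rfloor}$, and to $0$ elsewhere. **Limit points.** A map $f:V\to U$ is a *limit point of charge-conserving convnets* if for every compact $K\subset V$, every $\epsilon>0$ and every $\Lambda_0>0$ there is a multi-resolution charge-conserving convnet with $\Lambda>\Lambda_0$ such that $\sup_{\Phi\in K}\|\widehat f_\lambda(\Phi)-f(\Phi)\|\le\epsilon$ for all sufficiently small $\lambda>0$.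 **Theorem.** A map $f:V\to U$ is a limit point of charge-conserving convnets if and only if $f$ is continuous in the norm topology and $\mathrm{SE}(2)$-equivariant, i.e. $f(R_g\Phi)=R_gf(\Phi)$ for all $g\in\mathrm{SE}(2)$ and $\Phi\in V$. -/

import Mathlib

open MeasureTheory Filter Topology

noncomputable section

namespace CCNet

/-- The plane `ℝ²` with its Euclidean structure and Lebesgue measure. -/
abbrev Plane : Type := EuclideanSpace ℝ (Fin 2)

/-- The signal space `L²(ℝ², ℝᵈ)`. -/
abbrev Signal (d : ℕ) : Type := Lp (EuclideanSpace ℝ (Fin d)) 2 (volume : Measure Plane)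

/-! ### Rigid motions of the plane -/

/-- The rotation group `SO(2)`. -/
abbrev SO2 : Type := Matrix.specialOrthogonalGroup (Fin 2) ℝ

/-- The rotation `x ↦ θ x` of the plane. -/
def rotate (θ : SO2) : Plane →L[ℝ] Plane :=
  Matrix.toEuclideanCLM (n := Fin 2) (𝕜 := ℝ) (θ : Matrix (Fin 2) (Fin 2) ℝ)

theorem rotate_one : rotate 1 = 1 := by
  simp [rotate]

theorem rotate_mul (θ₁ θ₂ : SO2) : rotate (θ₁ * θ₂) = rotate θ₁ * rotate θ₂ := by
  simp [rotate]

theorem rotate_mem_unitary (θ : SO2) : rotate θ ∈ unitary (Plane →L[ℝ] Plane) :=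
  Unitary.map_mem (Matrix.toEuclideanCLM (n := Fin 2) (𝕜 := ℝ))
    (Matrix.mem_specialOrthogonalGroup_iff.1 θ.2).1

/-- The group `SE(2) = ℝ² ⋊ SO(2)` of rigid motions: pairs `(γ, θ)` of a translation and a
rotation. -/
@[ext]
structure SE2 where
  trans : Plane
  rot : SO2

namespace SE2

instance : Mul SE2 := ⟨fun g₁ g₂ => ⟨g₁.trans + rotate g₁.rot g₂.trans, g₁.rot * g₂.rot⟩⟩
instance : One SE2 := ⟨⟨0, 1⟩⟩
instance : Inv SE2 := ⟨fun g => ⟨-rotate g.rot⁻¹ g.trans, g.rot⁻¹⟩⟩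

theorem mul_trans (g₁ g₂ : SE2) : (g₁ * g₂).trans = g₁.trans + rotate g₁.rot g₂.trans := rfl
theorem mul_rot (g₁ g₂ : SE2) : (g₁ * g₂).rot = g₁.rot * g₂.rot := rfl
theorem one_trans : (1 : SE2).trans = 0 := rfl
theorem one_rot : (1 : SE2).rot = 1 := rfl
theorem inv_trans (g : SE2) : (g⁻¹).trans = -rotate g.rot⁻¹ g.trans := rfl
theorem inv_rot (g : SE2) : (g⁻¹).rot = g.rot⁻¹ := rfl

instance : Group SE2 :=
  Group.ofLeftAxioms
    (fun a b c => SE2.ext (by simp [mul_trans, mul_rot, rotate_mul, add_assoc])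
      (by simp [mul_rot, mul_assoc]))
    (fun a => SE2.ext (by simp [mul_trans, one_trans, one_rot, rotate_one])
      (by simp [mul_rot, one_rot]))
    (fun a => SE2.ext (by simp [mul_trans, one_trans, inv_trans, inv_rot])
      (by simp [mul_rot, one_rot, inv_rot]))

/-- The action `A_{(γ, θ)} x = γ + θ x` of `SE(2)` on the plane. -/
instance : MulAction SE2 Plane where
  smul g x := g.trans + rotate g.rot x
  one_smul x := show (0 : Plane) + rotate 1 x = x by simp [rotate_one]
  mul_smul g₁ g₂ x :=
    show (g₁.trans + rotate g₁.rot g₂.trans) + rotate (g₁.rot * g₂.rot) x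
      = g₁.trans + rotate g₁.rot (g₂.trans + rotate g₂.rot x) by
    simp [rotate_mul, add_assoc]

theorem smul_def (g : SE2) (x : Plane) : g • x = g.trans + rotate g.rot x := rfl

theorem measurePreserving_smul (g : SE2) :
    MeasurePreserving (fun x : Plane => g • x) volume volume := by
  have h : MeasurePreserving (rotate g.rot) (volume : Measure Plane) volume :=
    (Unitary.linearIsometryEquiv ⟨rotate g.rot, rotate_mem_unitary g.rot⟩).measurePreserving
  exact (measurePreserving_add_left volume g.trans).comp h

end SE2

/-- The representation `(R_g Φ)(x) = Φ(A_{g⁻¹} x)` of `SE(2)` on `L²(ℝ², ℝᵈ)`. -/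
def rep {d : ℕ} (g : SE2) (Φ : Signal d) : Signal d :=
  Lp.compMeasurePreserving (fun x : Plane => g⁻¹ • x) (SE2.measurePreserving_smul g⁻¹) Φ

/-- `SE(2)`-equivariance of a (not necessarily linear) map between signal spaces. -/
def SE2Equivariant {dV dU : ℕ} (f : Signal dV → Signal dU) : Prop :=
  ∀ (g : SE2) (Φ : Signal dV), f (rep g Φ) = rep g (f Φ)

/-! ### Grids and discretization

A signal on the grid `(lam ℤ)²` is a function of the integer index `k ∈ ℤ²` of the grid point
`lam k`. A signal living on a bounded part of the grid is extended by zero. -/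

/-- Integer indices of the grid points. -/
abbrev Grid : Type := ℤ × ℤ

/-- The square `Z_L = {k ∈ ℤ² : ‖k‖_∞ ≤ L}`. -/
def box (L : ℕ) : Finset Grid :=
  Finset.Icc (-(L : ℤ)) L ×ˢ Finset.Icc (-(L : ℤ)) L

/-- Restriction of a grid signal to `Z_L` (zero outside). -/
def cutoff {X : Type} [Zero X] (L : ℕ) (Φ : Grid → X) : Grid → X :=
  fun k => if k ∈ box L then Φ k else 0

/-- The cell of side `lam` centred at `lam k`. (Half-open, so that the cells tile the plane.) -/
def cell (lam : ℝ) (k : Grid) : Set Plane :=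
  {x | (((k.1 : ℝ) - 1 / 2) * lam ≤ x 0 ∧ x 0 < ((k.1 : ℝ) + 1 / 2) * lam) ∧
    (((k.2 : ℝ) - 1 / 2) * lam ≤ x 1 ∧ x 1 < ((k.2 : ℝ) + 1 / 2) * lam)}

theorem measurableSet_cell (lam : ℝ) (k : Grid) : MeasurableSet (cell lam k) := by
  have h0 : Measurable fun x : Plane => x 0 := by fun_prop
  have h1 : Measurable fun x : Plane => x 1 := by fun_prop
  exact ((measurableSet_le measurable_const h0).inter (measurableSet_lt h0 measurable_const)).inter
    ((measurableSet_le measurable_const h1).inter (measurableSet_lt h1 measurable_const))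

theorem volume_cell_ne_top (lam : ℝ) (k : Grid) : volume (cell lam k) ≠ ⊤ := by
  have hpre : cell lam k = WithLp.ofLp ⁻¹'
      (Set.pi Set.univ (![Set.Ico (((k.1 : ℝ) - 1 / 2) * lam) (((k.1 : ℝ) + 1 / 2) * lam),
        Set.Ico (((k.2 : ℝ) - 1 / 2) * lam) (((k.2 : ℝ) + 1 / 2) * lam)] : Fin 2 → Set ℝ)) := by
    ext x
    simp [cell, Set.mem_pi, Fin.forall_fin_two]
  have hm : MeasurableSet
      (Set.pi Set.univ (![Set.Ico (((k.1 : ℝ) - 1 / 2) * lam) (((k.1 : ℝ) + 1 / 2) * lam),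
        Set.Ico (((k.2 : ℝ) - 1 / 2) * lam) (((k.2 : ℝ) + 1 / 2) * lam)] : Fin 2 → Set ℝ)) := by
    refine MeasurableSet.univ_pi fun i => ?_
    fin_cases i <;> simp
  rw [hpre, (PiLp.volume_preserving_ofLp (Fin 2)).measure_preimage hm.nullMeasurableSet,
    volume_pi, Measure.pi_pi]
  simp [Fin.prod_univ_two, ENNReal.mul_ne_top]

/-- The projection `P_{lam, Lam}`, as a map to grid signals: averages of the signal over the cells
with index in `Z_L`, `L = ⌊Lam / lam⌋`, and zero on the other cells. -/
def discretize {d : ℕ} (lam Lam : ℝ) (Φ : Signal d) : Grid → EuclideanSpace ℝ (Fin d) :=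
  cutoff ⌊Lam / lam⌋₊ fun k => (1 / lam ^ 2) • ∫ x in cell lam k, Φ x

/-- The element of `L²(ℝ², ℝᵈ)` that is constant, equal to `Ψ k`, on each cell with index
`k ∈ Z_L`, and zero outside these cells. -/
def toSignal {d : ℕ} (lam : ℝ) (L : ℕ) (Ψ : Grid → EuclideanSpace ℝ (Fin d)) : Signal d :=
  ∑ k ∈ box L, indicatorConstLp 2 (measurableSet_cell lam k) (volume_cell_ne_top lam k) (Ψ k)

/-! ### Discrete differential operators on grid signals -/

section Operators

variable {X : Type} [AddCommGroup X]

/-- The discrete Laplacian `Δ^(lam)`. -/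
def laplacian [Module ℝ X] (lam : ℝ) (Φ : Grid → X) : Grid → X := fun k =>
  (1 / lam ^ 2) • (Φ (k.1 + 1, k.2) + Φ (k.1 - 1, k.2) + Φ (k.1, k.2 + 1) + Φ (k.1, k.2 - 1)
    - (4 : ℝ) • Φ k)

/-- The elementary smoothing operation `1 + (lam² / 8) Δ^(lam)`. -/
def smoothStep [Module ℝ X] (lam : ℝ) (Φ : Grid → X) : Grid → X :=
  Φ + (lam ^ 2 / 8) • laplacian lam Φ

/-- `n` smoothing layers. A signal on `Z_{L+n}` is transformed to a signal on `Z_L`, the radius of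
the domain decreasing by one in every layer. -/
def smoothLayers [Module ℝ X] (lam : ℝ) (L : ℕ) : ℕ → (Grid → X) → Grid → X
  | 0, Φ => Φ
  | n + 1, Φ => smoothLayers lam L n (cutoff (L + n) (smoothStep lam Φ))

/-- The discrete derivative `∂_z^(lam)`. -/
def dz [Module ℂ X] (lam : ℝ) (Φ : Grid → X) : Grid → X := fun k =>
  (1 / (4 * (lam : ℂ))) • (Φ (k.1 + 1, k.2) - Φ (k.1 - 1, k.2)
    - Complex.I • (Φ (k.1, k.2 + 1) - Φ (k.1, k.2 - 1)))

/-- The discrete derivative `∂_z̄^(lam)`. -/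
def dzbar [Module ℂ X] (lam : ℝ) (Φ : Grid → X) : Grid → X := fun k =>
  (1 / (4 * (lam : ℂ))) • (Φ (k.1 + 1, k.2) - Φ (k.1 - 1, k.2)
    + Complex.I • (Φ (k.1, k.2 + 1) - Φ (k.1, k.2 - 1)))

end Operators

/-! ### Differentiation layers

A state of the differentiation layers is a family `Φ s μ` of `ℂᵈ`-valued grid signals, indexed by
the degree `s` of the derivative and the charge `μ`. Only the components with `|μ| ≤ s ≤ t` can be
nonzero after `t` layers. -/

/-- The state before the first differentiation layer: the given real signal, in degree `0` and with
charge `0`. -/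
def diffInput {d : ℕ} (Φ : Grid → EuclideanSpace ℝ (Fin d)) : ℕ → ℤ → Grid → Fin d → ℂ :=
  fun s μ k n => if s = 0 ∧ μ = 0 then ((Φ k n : ℝ) : ℂ) else 0

/-- One differentiation layer: the block `(s', μ') → (s, μ)` is `∂_z` if `(s, μ) = (s'+1, μ'+1)`,
`∂_z̄` if `(s, μ) = (s'+1, μ'-1)`, the identity if `(s, μ) = (s', μ')`, and zero otherwise. -/
def diffStep {d : ℕ} (lam : ℝ) (Φ : ℕ → ℤ → Grid → Fin d → ℂ) : ℕ → ℤ → Grid → Fin d → ℂ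
  | 0, μ => Φ 0 μ
  | s + 1, μ => Φ (s + 1) μ + dz lam (Φ s (μ - 1)) + dzbar lam (Φ s (μ + 1))

/-- `n` differentiation layers, transforming signals on `Z_{L+n}` to signals on `Z_L`. -/
def diffLayers {d : ℕ} (lam : ℝ) (L : ℕ) :
    ℕ → (ℕ → ℤ → Grid → Fin d → ℂ) → ℕ → ℤ → Grid → Fin d → ℂ
  | 0, Φ => Φ
  | n + 1, Φ => diffLayers lam L n fun s μ => cutoff (L + n) (diffStep lam Φ s μ)

/-! ### Multiplication layers -/

/-- The charges `-T, …, T`. -/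
abbrev Charge (T : ℕ) : Type := {μ : ℤ // μ ∈ Finset.Icc (-(T : ℤ)) T}

/-- The charge `0`. -/
def Charge.zero (T : ℕ) : Charge T := ⟨0, by simp⟩

/-- The weights `w_{0,n}`, `w_{1,μ,n,n₁}`, `w_{2,μ₁,μ₂,n,n₁,n₂}` of a multiplication layer with
charges `-T, …, T`, whose input features are indexed by `ι` and output features by `κ`. -/
structure MultWeights (T : ℕ) (ι κ : Type) where
  w0 : κ → ℂ
  w1 : Charge T → κ → ι → ℂ
  w2 : Charge T → Charge T → κ → ι → ι → ℂ

/-- The charge-conserving quadratic map of a multiplication layer, acting at one grid point. -/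
def multStep {T : ℕ} {ι κ : Type} [Fintype ι] (w : MultWeights T ι κ)
    (Φ : Charge T → ι → ℂ) : Charge T → κ → ℂ := fun μ n =>
  (if (μ : ℤ) = 0 then w.w0 n else 0)
    + ∑ n₁, w.w1 μ n n₁ * Φ μ n₁
    + ∑ p : Charge T × Charge T with (p.1 : ℤ) + (p.2 : ℤ) = (μ : ℤ),
        ∑ n₁, ∑ n₂, w.w2 p.1 p.2 n n₁ n₂ * Φ p.1 n₁ * Φ p.2 n₂

/-- Index set of the features, of a given charge at a given grid point, after `t` multiplication
layers. For `t = 0` a feature is a degree `s ≤ T` and a component of the input signal. (For charge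
`μ` only degrees `s ≥ |μ|` carry information; the components with `s < |μ|` are zero.) -/
def Feature (dV T dMult : ℕ) : ℕ → Type
  | 0 => Fin (T + 1) × Fin dV
  | _ + 1 => Fin dMult

instance (dV T dMult : ℕ) : (t : ℕ) → Fintype (Feature dV T dMult t)
  | 0 => inferInstanceAs (Fintype (Fin (T + 1) × Fin dV))
  | _ + 1 => inferInstanceAs (Fintype (Fin dMult))

/-! ### Charge-conserving convnets -/

/-- The parameters of a charge-conserving convnet other than the grid spacing: the range `Lam` of
the output, the numbers `Tdiff` of differentiation layers and `Tmult ≥ 1` of multiplication layers,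
the dimension `dMult` of the auxiliary spaces, and the weights. The layers `1, …, Tmult - 1` have
weights `hidden 0, …, hidden (Tmult - 2)` (other values of `hidden` are not used), and the last
layer has weights `final`. Since the grid spacing is left free, this is also the data of a
multi-resolution charge-conserving convnet. -/
structure ChargeConvnet (dV dU : ℕ) where
  Lam : ℝ
  Lam_nonneg : 0 ≤ Lam
  Tdiff : ℕ
  Tmult : ℕ
  Tmult_pos : 1 ≤ Tmult
  dMult : ℕ
  hidden : (t : ℕ) → MultWeights Tdiff (Feature dV Tdiff dMult t) (Fin dMult)
  final : MultWeights Tdiff (Feature dV Tdiff dMult (Tmult - 1)) (Fin dU)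

namespace ChargeConvnet

variable {dV dU : ℕ} (N : ChargeConvnet dV dU)

/-- The number `⌈4 / lam²⌉` of smoothing layers. -/
def numSmooth (lam : ℝ) : ℕ := ⌈4 / lam ^ 2⌉₊

/-- The input range `Lam' = Lam + (Tdiff + ⌈4 / lam²⌉) lam`. -/
def inputRange (lam : ℝ) : ℝ := N.Lam + ((N.Tdiff : ℝ) + (numSmooth lam : ℝ)) * lam

/-- The radius `⌊Lam / lam⌋` of the output grid. -/
def radius (lam : ℝ) : ℕ := ⌊N.Lam / lam⌋₊

/-- Discretization, smoothing and differentiation. -/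
def linearPart (lam : ℝ) (Φ : Signal dV) : ℕ → ℤ → Grid → Fin dV → ℂ :=
  diffLayers lam (N.radius lam) N.Tdiff <| diffInput <|
    smoothLayers lam (N.radius lam + N.Tdiff) (numSmooth lam) <|
      discretize lam (N.inputRange lam) Φ

/-- The output of the first `t` multiplication layers at one grid point. -/
def hiddenOutput (Φ : Charge N.Tdiff → Fin (N.Tdiff + 1) × Fin dV → ℂ) :
    (t : ℕ) → Charge N.Tdiff → Feature dV N.Tdiff N.dMult t → ℂ
  | 0 => Φ
  | t + 1 => multStep (N.hidden t) (hiddenOutput Φ t)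

/-- The multiplication layers at one grid point; the last one takes the real part of the charge `0`
component. -/
def multPart (Φ : Charge N.Tdiff → Fin (N.Tdiff + 1) × Fin dV → ℂ) : EuclideanSpace ℝ (Fin dU) :=
  WithLp.toLp 2 fun n =>
    (multStep N.final (N.hiddenOutput Φ (N.Tmult - 1)) (Charge.zero N.Tdiff) n).re

/-- The convnet with grid spacing `lam`, as a map `L²(ℝ², ℝ^dV) → L²(ℝ², ℝ^dU)`. -/
def toMap (lam : ℝ) (Φ : Signal dV) : Signal dU :=
  toSignal lam (N.radius lam) fun k =>
    N.multPart fun μ sn => N.linearPart lam Φ sn.1 μ k sn.2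

end ChargeConvnet

/-- `f` is a limit point of charge-conserving convnets: for all compact `K`, `ε > 0` and
`Lam₀ > 0` there is a multi-resolution convnet with range larger than `Lam₀` that, for all
sufficiently small grid spacings, is uniformly `ε`-close to `f` on `K`. -/
def IsLimitPoint {dV dU : ℕ} (f : Signal dV → Signal dU) : Prop :=
  ∀ K : Set (Signal dV), IsCompact K → ∀ ε : ℝ, 0 < ε → ∀ Lam₀ : ℝ, 0 < Lam₀ →
    ∃ N : ChargeConvnet dV dU, Lam₀ < N.Lam ∧
      ∃ lam₀ : ℝ, 0 < lam₀ ∧ ∀ lam : ℝ, 0 < lam → lam ≤ lam₀ →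
        ∀ Φ ∈ K, ‖N.toMap lam Φ - f Φ‖ ≤ ε

end CCNet

end

/-!
The proof compares a convnet with its continuum limit, in which the grid spacing tends to zero.

*The continuum limit.* Discretization, smoothing and differentiation together are a finite linear
combination of averages of the signal over grid cells, that is, an element of the group algebra of
`ℤ²` (a stencil) applied to these averages; the cutoffs of the layers do not affect the output grid
(`ChargeConvnet.linearPart_eq_discFun`). On the Fourier side a stencil is multiplication by its
symbol. Since there are about `4 / lam²` smoothing layers, the symbols converge, in rescaled
frequencies, to a Gaussian times a monomial in the symbols of `∂_z` and `∂_z̄`. Bessel's inequality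
for the cells and Parseval's identity for the symbols bound the functionals on `L²` uniformly in the
grid spacing (`norm_discFun_linStencil_le`), so convergence on Schwartz functions extends to all
signals and is joint in the spacing and the signal (`tendsto_discFun`). The limits are the Gaussian
derivatives `gaussDeriv a b`, i.e. `∂_z ^ a ∂_z̄ ^ b` of the smoothed signal at the origin. Hence the
output of a convnet at `x` is, for small spacings, uniformly close on compact sets to
`limValue (recenter x Φ)`, a fixed continuous function of the signal translated by `-x`
(`ChargeConvnet.exists_toMap_close`).

*Limit points are continuous and equivariant.* A convnet with fixed grid spacing is a continuous
map, and uniform limits on compact sets of continuous maps are sequentially continuous. Rotating the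
signal multiplies a feature of charge `μ` by the `μ`-th power of a phase, and charge conservation
leaves an output of charge `0` unchanged (`ChargeConvnet.limValue_rotation`). So the continuum limit
is equivariant, up to the bounded output range, which can be chosen arbitrarily large.

*Continuous equivariant maps are limit points.* Replacing `f Φ` by its averages over small discs
changes it little in norm, uniformly on a compact set (`eLpNorm_ballMean_recenter_sub_le`). By
equivariance the averaged map has value `h (recenter x Φ)` at `x`, where `h` is continuous with
values in a finite-dimensional space and rotation invariant. The Gaussian derivatives separate
signals, because polynomials times a Gaussian are total in `L²` (`eq_zero_of_gaussDeriv_eq_zero`),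
and the algebra they generate is closed under conjugation. By the Stone–Weierstrass theorem `h` is
uniformly close on compact sets to a polynomial in them. Averaging over the rotations by multiples
of `2π / n`, with `n` large, removes all monomials of nonzero charge and keeps the approximation
(`exists_neutral_wordSum_close`). A polynomial all of whose monomials have charge `0` is exactly the
continuum limit of a convnet that multiplies the letters of every monomial one after another
(`exists_limValue_eq`).
-/

noncomputable section

namespace CCNet

/-! ### Stencils: translation invariant operators on grid signals -/

/-- The group algebra of `ℤ²`. Its elements are the finitely supported stencils; they act on
grid signals, and their value at a character of `ℤ²` is the Fourier symbol of this action. -/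
abbrev Stencil : Type := AddMonoidAlgebra ℂ Grid

/-- The translations of grid signals, as a representation of `ℤ²`. -/
def gridShift : Multiplicative Grid →* Module.End ℂ (Grid → ℂ) where
  toFun j := LinearMap.funLeft ℂ ℂ fun k => k + j.toAdd
  map_one' := by ext u k; simp [LinearMap.funLeft]
  map_mul' i j := by
    refine LinearMap.ext fun u => funext fun k => ?_
    simp [LinearMap.funLeft, add_assoc]

/-- The action of stencils on grid signals. -/
def act : Stencil →ₐ[ℂ] Module.End ℂ (Grid → ℂ) := AddMonoidAlgebra.lift ℂ _ _ gridShift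

theorem act_single (j : Grid) (c : ℂ) (u : Grid → ℂ) (k : Grid) :
    act (AddMonoidAlgebra.single j c) u k = c * u (k + j) := by
  simp [act, gridShift, LinearMap.funLeft]

theorem act_apply (p : Stencil) (u : Grid → ℂ) (k : Grid) :
    act p u k = p.coeff.sum fun j c => c * u (k + j) := by
  rw [act, AddMonoidAlgebra.lift_apply, Finsupp.sum, Finsupp.sum, LinearMap.sum_apply,
    Finset.sum_apply]
  simp [gridShift, LinearMap.funLeft]

theorem act_mul (p q : Stencil) (u : Grid → ℂ) : act (p * q) u = act p (act q u) := by
  rw [map_mul, Module.End.mul_apply]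

/-- The stencil of the smoothing step `1 + (lam² / 8) Δ`; it does not depend on `lam`. -/
def smoothStencil : Stencil :=
  AddMonoidAlgebra.single 0 (1 / 2) + AddMonoidAlgebra.single (1, 0) (1 / 8)
    + AddMonoidAlgebra.single (-1, 0) (1 / 8) + AddMonoidAlgebra.single (0, 1) (1 / 8)
    + AddMonoidAlgebra.single (0, -1) (1 / 8)

/-- The stencil of the discrete derivative `∂_z`. -/
def dzStencil (lam : ℝ) : Stencil :=
  AddMonoidAlgebra.single (1, 0) (1 / (4 * (lam : ℂ)))
    + AddMonoidAlgebra.single (-1, 0) (-(1 / (4 * (lam : ℂ))))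
    + AddMonoidAlgebra.single (0, 1) (-(Complex.I / (4 * (lam : ℂ))))
    + AddMonoidAlgebra.single (0, -1) (Complex.I / (4 * (lam : ℂ)))

/-- The stencil of the discrete derivative `∂_z̄`. -/
def dzbarStencil (lam : ℝ) : Stencil :=
  AddMonoidAlgebra.single (1, 0) (1 / (4 * (lam : ℂ)))
    + AddMonoidAlgebra.single (-1, 0) (-(1 / (4 * (lam : ℂ))))
    + AddMonoidAlgebra.single (0, 1) (Complex.I / (4 * (lam : ℂ)))
    + AddMonoidAlgebra.single (0, -1) (-(Complex.I / (4 * (lam : ℂ))))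

theorem dz_eq_act (lam : ℝ) (u : Grid → ℂ) : dz lam u = act (dzStencil lam) u := by
  funext k
  simp only [dz, dzStencil, map_add, LinearMap.add_apply, Pi.add_apply, act_single, smul_eq_mul]
  rw [show k + (1, 0) = (k.1 + 1, k.2) by ext <;> simp,
    show k + (-1, 0) = (k.1 - 1, k.2) by ext <;> simp [sub_eq_add_neg],
    show k + (0, 1) = (k.1, k.2 + 1) by ext <;> simp,
    show k + (0, -1) = (k.1, k.2 - 1) by ext <;> simp [sub_eq_add_neg]]
  ring

theorem dzbar_eq_act (lam : ℝ) (u : Grid → ℂ) : dzbar lam u = act (dzbarStencil lam) u := by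
  funext k
  simp only [dzbar, dzbarStencil, map_add, LinearMap.add_apply, Pi.add_apply, act_single,
    smul_eq_mul]
  rw [show k + (1, 0) = (k.1 + 1, k.2) by ext <;> simp,
    show k + (-1, 0) = (k.1 - 1, k.2) by ext <;> simp [sub_eq_add_neg],
    show k + (0, 1) = (k.1, k.2 + 1) by ext <;> simp,
    show k + (0, -1) = (k.1, k.2 - 1) by ext <;> simp [sub_eq_add_neg]]
  ring

/-- The complex grid signal given by one component of a real vector-valued grid signal. -/
def gridComp {d : ℕ} (c : Fin d) (u : Grid → EuclideanSpace ℝ (Fin d)) : Grid → ℂ :=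
  fun k => ((u k c : ℝ) : ℂ)

theorem gridComp_smoothStep {d : ℕ} {lam : ℝ} (hl : lam ≠ 0) (c : Fin d)
    (u : Grid → EuclideanSpace ℝ (Fin d)) :
    gridComp c (smoothStep lam u) = act smoothStencil (gridComp c u) := by
  funext k
  simp only [smoothStencil, map_add, LinearMap.add_apply, Pi.add_apply, act_single]
  rw [show k + (1, 0) = (k.1 + 1, k.2) by ext <;> simp,
    show k + (-1, 0) = (k.1 - 1, k.2) by ext <;> simp [sub_eq_add_neg],
    show k + (0, 1) = (k.1, k.2 + 1) by ext <;> simp,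
    show k + (0, -1) = (k.1, k.2 - 1) by ext <;> simp [sub_eq_add_neg], add_zero]
  simp only [gridComp, smoothStep, laplacian, Pi.add_apply, Pi.smul_apply, PiLp.add_apply,
    PiLp.smul_apply, PiLp.sub_apply, smul_eq_mul]
  have : (lam : ℂ) ≠ 0 := by exact_mod_cast hl
  push_cast
  field_simp
  ring

theorem gridComp_smoothStep_iterate {d : ℕ} {lam : ℝ} (hl : lam ≠ 0) (c : Fin d) (n : ℕ)
    (u : Grid → EuclideanSpace ℝ (Fin d)) :
    gridComp c ((smoothStep lam)^[n] u) = act (smoothStencil ^ n) (gridComp c u) := by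
  induction n with
  | zero => simp
  | succ n ih => rw [Function.iterate_succ_apply', gridComp_smoothStep hl, ih, pow_succ', act_mul]

/-! ### The coefficients produced by the differentiation layers -/

/-- The coefficient of the component of degree `s` and charge `μ` after `n` differentiation layers,
in a ring in which `∂_z` and `∂_z̄` are represented by `x` and `y`. -/
def diffCoeff {R : Type*} [CommRing R] (x y : R) : ℕ → ℕ → ℤ → R
  | 0, s, μ => if s = 0 ∧ μ = 0 then 1 else 0
  | n + 1, 0, μ => diffCoeff x y n 0 μ
  | n + 1, s + 1, μ =>
    diffCoeff x y n (s + 1) μ + x * diffCoeff x y n s (μ - 1) + y * diffCoeff x y n s (μ + 1)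

theorem map_diffCoeff {R S : Type*} [CommRing R] [CommRing S] (φ : R →+* S) (x y : R) (n s : ℕ)
    (μ : ℤ) : φ (diffCoeff x y n s μ) = diffCoeff (φ x) (φ y) n s μ := by
  induction n generalizing s μ with
  | zero => simp only [diffCoeff]; split_ifs <;> simp
  | succ n ih => cases s <;> simp [diffCoeff, ih]

theorem diffCoeff_swap {R : Type*} [CommRing R] (x y : R) (n s : ℕ) (μ : ℤ) :
    diffCoeff y x n s μ = diffCoeff x y n s (-μ) := by
  induction n generalizing s μ with
  | zero => simp [diffCoeff]
  | succ n ih =>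
    cases s with
    | zero => simp [diffCoeff, ih]
    | succ s =>
      simp only [diffCoeff, ih]
      rw [show -(μ - 1) = -μ + 1 by ring, show -(μ + 1) = -μ - 1 by ring]
      ring

/-- Rotating `∂_z` and `∂_z̄` by opposite phases multiplies a component of charge `μ` by the
`μ`-th power of the phase. -/
theorem diffCoeff_phase {c : ℂ} (hc : c ≠ 0) (x y : ℂ) (n s : ℕ) (μ : ℤ) :
    diffCoeff (c * x) (c⁻¹ * y) n s μ = c ^ μ * diffCoeff x y n s μ := by
  induction n generalizing s μ with
  | zero =>
    simp only [diffCoeff]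
    split_ifs with h
    · simp [h.2]
    · simp
  | succ n ih =>
    cases s with
    | zero => simp [diffCoeff, ih]
    | succ s =>
      simp only [diffCoeff, ih, zpow_sub_one₀ hc, zpow_add_one₀ hc]
      field_simp

theorem norm_diffCoeff_le (x y : ℂ) (n s : ℕ) (μ : ℤ) :
    ‖diffCoeff x y n s μ‖ ≤ (1 + ‖x‖ + ‖y‖) ^ n := by
  induction n generalizing s μ with
  | zero => simp only [diffCoeff]; split_ifs <;> simp
  | succ n ih =>
    have h0 : (0 : ℝ) ≤ (1 + ‖x‖ + ‖y‖) ^ n := by positivity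
    cases s with
    | zero =>
      refine (ih 0 μ).trans ?_
      rw [pow_succ]
      nlinarith [mul_nonneg h0 (norm_nonneg x), mul_nonneg h0 (norm_nonneg y)]
    | succ s =>
      simp only [diffCoeff]
      calc _ ≤ ‖diffCoeff x y n (s + 1) μ‖ + ‖x * diffCoeff x y n s (μ - 1)‖
            + ‖y * diffCoeff x y n s (μ + 1)‖ := norm_add₃_le
        _ ≤ (1 + ‖x‖ + ‖y‖) ^ n + ‖x‖ * (1 + ‖x‖ + ‖y‖) ^ n + ‖y‖ * (1 + ‖x‖ + ‖y‖) ^ n := by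
          rw [norm_mul, norm_mul]
          gcongr <;> exact ih _ _
        _ = _ := by ring

theorem continuous_diffCoeff {Z : Type*} [TopologicalSpace Z] {x y : Z → ℂ} (hx : Continuous x)
    (hy : Continuous y) (n s : ℕ) (μ : ℤ) : Continuous fun z => diffCoeff (x z) (y z) n s μ := by
  induction n generalizing s μ with
  | zero => simp only [diffCoeff]; exact continuous_const
  | succ n ih =>
    cases s with
    | zero => exact ih 0 μ
    | succ s =>
      exact ((ih _ _).add (hx.mul (ih _ _))).add (hy.mul (ih _ _))

theorem diffCoeff_eq_zero_of_lt_natAbs {R : Type*} [CommRing R] (x y : R) (n s : ℕ) (μ : ℤ)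
    (h : s < μ.natAbs) : diffCoeff x y n s μ = 0 := by
  induction n generalizing s μ with
  | zero => simp only [diffCoeff]; rw [if_neg]; rintro ⟨rfl, rfl⟩; simp at h
  | succ n ih =>
    cases s with
    | zero => exact ih 0 μ h
    | succ s =>
      simp only [diffCoeff]
      rw [ih _ _ h, ih s (μ - 1) (by omega), ih s (μ + 1) (by omega)]
      simp

/-- After `n ≥ a + b` layers the component of degree `a + b` and charge `a - b` is a positive
multiple of `∂_z ^ a ∂_z̄ ^ b`. -/
theorem exists_diffCoeff_eq (n a b : ℕ) (h : a + b ≤ n) :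
    ∃ c : ℕ, 0 < c ∧ ∀ x y : ℂ,
      diffCoeff x y n (a + b) ((a : ℤ) - b) = c * (x ^ a * y ^ b) := by
  have key : ∀ n a b : ℕ, ∃ c : ℕ, (a + b ≤ n → 0 < c) ∧ ∀ x y : ℂ,
      diffCoeff x y n (a + b) ((a : ℤ) - b) = c * (x ^ a * y ^ b) := by
    intro n
    induction n with
    | zero =>
      intro a b
      by_cases h : a = 0 ∧ b = 0
      · obtain ⟨rfl, rfl⟩ := h
        exact ⟨1, by simp, by simp [diffCoeff]⟩
      · refine ⟨0, by omega, fun x y => ?_⟩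
        simp only [diffCoeff]
        rw [if_neg (by omega)]
        simp
    | succ n ih =>
      intro a b
      obtain ⟨c, hc, hc'⟩ := ih a b
      match a, b with
      | 0, 0 =>
        exact ⟨c, fun _ => hc (by omega), fun x y => by rw [← hc' x y]; rfl⟩
      | a + 1, 0 =>
        obtain ⟨c₁, h₁, h₁'⟩ := ih a 0
        refine ⟨c + c₁, fun h => by have := h₁ (by omega); omega, fun x y => ?_⟩
        have e := hc' x y
        have e₁ := h₁' x y
        simp only [add_zero, Nat.cast_zero, sub_zero, pow_zero, mul_one] at e e₁ ⊢
        simp only [diffCoeff]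
        rw [e, show (((a + 1 : ℕ) : ℤ) - 1) = a by push_cast; ring, e₁,
          diffCoeff_eq_zero_of_lt_natAbs x y n a (((a + 1 : ℕ) : ℤ) + 1) (by omega)]
        push_cast
        ring
      | 0, b + 1 =>
        obtain ⟨c₁, h₁, h₁'⟩ := ih 0 b
        refine ⟨c + c₁, fun h => by have := h₁ (by omega); omega, fun x y => ?_⟩
        have e := hc' x y
        have e₁ := h₁' x y
        simp only [zero_add, Nat.cast_zero, pow_zero, one_mul] at e e₁ ⊢
        simp only [diffCoeff]
        rw [e, show (0 - ((b + 1 : ℕ) : ℤ) + 1) = 0 - (b : ℤ) by push_cast; ring, e₁,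
          diffCoeff_eq_zero_of_lt_natAbs x y n b (0 - ((b + 1 : ℕ) : ℤ) - 1) (by omega)]
        push_cast
        ring
      | a + 1, b + 1 =>
        obtain ⟨c₁, h₁, h₁'⟩ := ih a (b + 1)
        obtain ⟨c₂, h₂, h₂'⟩ := ih (a + 1) b
        refine ⟨c + c₁ + c₂, fun h => by have := h₁ (by omega); omega, fun x y => ?_⟩
        have e := hc' x y
        have e₁ := h₁' x y
        have e₂ := h₂' x y
        rw [show a + 1 + (b + 1) = (a + b + 1) + 1 by ring] at e ⊢
        rw [show a + (b + 1) = a + b + 1 by ring,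
          show ((a : ℤ) - ((b + 1 : ℕ) : ℤ)) = a - b - 1 by push_cast; ring] at e₁
        rw [show a + 1 + b = a + b + 1 by ring,
          show (((a + 1 : ℕ) : ℤ) - (b : ℤ)) = a - b + 1 by push_cast; ring] at e₂
        rw [show (((a + 1 : ℕ) : ℤ) - ((b + 1 : ℕ) : ℤ)) = a - b by push_cast; ring] at e ⊢
        simp only [diffCoeff]
        rw [e, e₁, e₂]
        push_cast
        ring
  obtain ⟨c, hc, hc'⟩ := key n a b
  exact ⟨c, hc h, hc'⟩

/-- The state of the differentiation layers, as an action of stencils. -/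
theorem diffStep_iterate_apply {d : ℕ} (lam : ℝ) (n : ℕ) (u : Grid → EuclideanSpace ℝ (Fin d))
    (s : ℕ) (μ : ℤ) (k : Grid) (c : Fin d) :
    (diffStep lam)^[n] (diffInput u) s μ k c
      = act (diffCoeff (dzStencil lam) (dzbarStencil lam) n s μ) (gridComp c u) k := by
  induction n generalizing s μ k with
  | zero =>
    simp only [Function.iterate_zero, id, diffCoeff, diffInput]
    split_ifs <;> simp [gridComp]
  | succ n ih =>
    rw [Function.iterate_succ_apply']
    cases s with
    | zero => exact ih 0 μ k
    | succ s =>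
      have hz : ∀ v : Grid → Fin d → ℂ, dz lam v k c = dz lam (fun k => v k c) k := fun v => by
        simp [dz]
      have hzb : ∀ v : Grid → Fin d → ℂ, dzbar lam v k c = dzbar lam (fun k => v k c) k :=
        fun v => by simp [dzbar]
      simp only [diffStep, diffCoeff, Pi.add_apply, map_add, LinearMap.add_apply, act_mul]
      rw [hz, hzb, dz_eq_act, dzbar_eq_act, ih, funext fun k => ih s (μ - 1) k,
        funext fun k => ih s (μ + 1) k]

/-! ### Removal of the cutoffs -/

theorem mem_box {L : ℕ} {k : Grid} :
    k ∈ box L ↔ (-(L : ℤ) ≤ k.1 ∧ k.1 ≤ L) ∧ (-(L : ℤ) ≤ k.2 ∧ k.2 ≤ L) := by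
  simp [box, Finset.mem_product]

theorem smoothStep_congr {X : Type} [AddCommGroup X] [Module ℝ X] {lam : ℝ} {L : ℕ}
    {u v : Grid → X} (h : ∀ k ∈ box (L + 1), u k = v k) :
    ∀ k ∈ box L, smoothStep lam u k = smoothStep lam v k := by
  intro k hk
  rw [mem_box] at hk
  simp only [smoothStep, laplacian, Pi.add_apply, Pi.smul_apply]
  rw [h k, h (k.1 + 1, k.2), h (k.1 - 1, k.2), h (k.1, k.2 + 1), h (k.1, k.2 - 1)] <;>
  · rw [mem_box]; push_cast; omega

/-- On the final domain the smoothing layers, with their cutoffs, agree with the iterates of the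
smoothing step on the whole grid. -/
theorem smoothLayers_eq {X : Type} [AddCommGroup X] [Module ℝ X] {lam : ℝ} {L n : ℕ}
    {u v : Grid → X} (h : ∀ k ∈ box (L + n), u k = v k) :
    ∀ k ∈ box L, smoothLayers lam L n u k = (smoothStep lam)^[n] v k := by
  induction n generalizing u v with
  | zero => exact h
  | succ n ih =>
    intro k hk
    rw [smoothLayers, Function.iterate_succ_apply]
    refine ih (fun j hj => ?_) k hk
    rw [cutoff, if_pos hj]
    exact smoothStep_congr h j hj

theorem diffStep_congr {d : ℕ} {lam : ℝ} {L : ℕ} {u v : ℕ → ℤ → Grid → Fin d → ℂ}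
    (h : ∀ s μ, ∀ k ∈ box (L + 1), u s μ k = v s μ k) (s : ℕ) (μ : ℤ) :
    ∀ k ∈ box L, diffStep lam u s μ k = diffStep lam v s μ k := by
  intro k hk
  rw [mem_box] at hk
  have h0 : k ∈ box (L + 1) := by rw [mem_box]; push_cast; omega
  cases s with
  | zero => exact h 0 μ k h0
  | succ s =>
    simp only [diffStep, Pi.add_apply, dz, dzbar]
    have h1 : (k.1 + 1, k.2) ∈ box (L + 1) := by rw [mem_box]; push_cast; omega
    have h2 : (k.1 - 1, k.2) ∈ box (L + 1) := by rw [mem_box]; push_cast; omega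
    have h3 : (k.1, k.2 + 1) ∈ box (L + 1) := by rw [mem_box]; push_cast; omega
    have h4 : (k.1, k.2 - 1) ∈ box (L + 1) := by rw [mem_box]; push_cast; omega
    rw [h _ _ _ h0, h _ _ _ h1, h _ _ _ h2, h _ _ _ h3, h _ _ _ h4, h _ _ _ h1, h _ _ _ h2,
      h _ _ _ h3, h _ _ _ h4]

/-- On the final domain the differentiation layers, with their cutoffs, agree with the iterates of
the differentiation step on the whole grid. -/
theorem diffLayers_eq {d : ℕ} {lam : ℝ} {L n : ℕ} {u v : ℕ → ℤ → Grid → Fin d → ℂ}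
    (h : ∀ s μ, ∀ k ∈ box (L + n), u s μ k = v s μ k) (s : ℕ) (μ : ℤ) :
    ∀ k ∈ box L, diffLayers lam L n u s μ k = (diffStep lam)^[n] v s μ k := by
  induction n generalizing u v with
  | zero => exact h s μ
  | succ n ih =>
    intro k hk
    rw [diffLayers, Function.iterate_succ_apply]
    refine ih (fun s μ j hj => ?_) k hk
    rw [cutoff, if_pos hj]
    exact diffStep_congr h s μ j hj

/-- The stencil of the whole linear part of a convnet, in degree `s` and charge `μ`. -/
def linStencil (T s : ℕ) (μ : ℤ) (lam : ℝ) : Stencil :=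
  smoothStencil ^ ChargeConvnet.numSmooth lam
    * diffCoeff (dzStencil lam) (dzbarStencil lam) T s μ

/-! ### Scalar signals and cell averages -/

/-- Complex scalar signals on the plane. -/
abbrev CSignal : Type := Lp ℂ 2 (volume : Measure Plane)

/-- The action of rigid motions on complex scalar signals. -/
def crep (g : SE2) (h : CSignal) : CSignal :=
  Lp.compMeasurePreserving (fun x : Plane => g⁻¹ • x) (SE2.measurePreserving_smul g⁻¹) h

/-- A component of a real vector-valued signal, as a complex scalar signal. -/
def comp {d : ℕ} (c : Fin d) : Signal d →L[ℝ] CSignal :=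
  ContinuousLinearMap.compLpL 2 volume
    (Complex.ofRealCLM.comp (EuclideanSpace.proj c : EuclideanSpace ℝ (Fin d) →L[ℝ] ℝ))

theorem coeFn_comp {d : ℕ} (c : Fin d) (Φ : Signal d) :
    comp c Φ =ᵐ[volume] fun x => ((Φ x c : ℝ) : ℂ) :=
  ContinuousLinearMap.coeFn_compLpL _ Φ

theorem coeFn_rep {d : ℕ} (g : SE2) (Φ : Signal d) :
    rep g Φ =ᵐ[volume] fun x => Φ (g⁻¹ • x) :=
  Lp.coeFn_compMeasurePreserving _ _

theorem coeFn_crep (g : SE2) (h : CSignal) : crep g h =ᵐ[volume] fun x => h (g⁻¹ • x) :=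
  Lp.coeFn_compMeasurePreserving _ _

theorem comp_rep {d : ℕ} (c : Fin d) (g : SE2) (Φ : Signal d) :
    comp c (rep g Φ) = crep g (comp c Φ) := by
  refine Lp.ext ?_
  filter_upwards [coeFn_comp c (rep g Φ), coeFn_rep g Φ, coeFn_crep g (comp c Φ),
    (SE2.measurePreserving_smul g⁻¹).quasiMeasurePreserving.ae (coeFn_comp c Φ)] with x h1 h2 h3 h4
  rw [h1, h2, h3, h4]

namespace SE2

/-- The translation by `x`. -/
def translation (x : Plane) : SE2 := ⟨x, 1⟩

/-- The rotation by `θ` about the origin. -/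
def rotation (θ : SO2) : SE2 := ⟨0, θ⟩

theorem translation_smul (x y : Plane) : translation x • y = x + y := by
  simp [smul_def, translation, rotate_one]

theorem rotation_smul (θ : SO2) (y : Plane) : rotation θ • y = rotate θ y := by
  simp [smul_def, rotation]

theorem rotation_inv (θ : SO2) : (rotation θ)⁻¹ = rotation θ⁻¹ := by
  ext1 <;> simp [rotation, inv_trans, inv_rot]

end SE2

/-- The grid point `lam k` of the plane. -/
def gridPoint (lam : ℝ) (k : Grid) : Plane := !₂[lam * k.1, lam * k.2]

theorem gridPoint_apply_zero (lam : ℝ) (k : Grid) : gridPoint lam k 0 = lam * k.1 := rfl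
theorem gridPoint_apply_one (lam : ℝ) (k : Grid) : gridPoint lam k 1 = lam * k.2 := rfl

theorem volume_cell {lam : ℝ} (hl : 0 < lam) (k : Grid) :
    volume (cell lam k) = ENNReal.ofReal (lam ^ 2) := by
  have hpre : cell lam k = WithLp.ofLp ⁻¹'
      (Set.pi Set.univ (![Set.Ico (((k.1 : ℝ) - 1 / 2) * lam) (((k.1 : ℝ) + 1 / 2) * lam),
        Set.Ico (((k.2 : ℝ) - 1 / 2) * lam) (((k.2 : ℝ) + 1 / 2) * lam)] : Fin 2 → Set ℝ)) := by
    ext x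
    simp [cell, Set.mem_pi, Fin.forall_fin_two]
  have hm : MeasurableSet
      (Set.pi Set.univ (![Set.Ico (((k.1 : ℝ) - 1 / 2) * lam) (((k.1 : ℝ) + 1 / 2) * lam),
        Set.Ico (((k.2 : ℝ) - 1 / 2) * lam) (((k.2 : ℝ) + 1 / 2) * lam)] : Fin 2 → Set ℝ)) := by
    refine MeasurableSet.univ_pi fun i => ?_
    fin_cases i <;> simp
  rw [hpre, (PiLp.volume_preserving_ofLp (Fin 2)).measure_preimage hm.nullMeasurableSet,
    volume_pi, Measure.pi_pi]
  simp only [Fin.prod_univ_two, Matrix.cons_val_zero, Matrix.cons_val_one, Real.volume_Ico]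
  rw [← ENNReal.ofReal_mul (by nlinarith)]
  congr 1
  ring

/-- The index of the cell containing a point. -/
def cellIndex (lam : ℝ) (x : Plane) : Grid := (⌊x 0 / lam + 1 / 2⌋, ⌊x 1 / lam + 1 / 2⌋)

theorem mem_cell_iff {lam : ℝ} (hl : 0 < lam) (k : Grid) (x : Plane) :
    x ∈ cell lam k ↔ cellIndex lam x = k := by
  have key : ∀ (n : ℤ) (t : ℝ), (((n : ℝ) - 1 / 2) * lam ≤ t ∧ t < ((n : ℝ) + 1 / 2) * lam) ↔
      ⌊t / lam + 1 / 2⌋ = n := by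
    intro n t
    rw [Int.floor_eq_iff, ← le_div_iff₀ hl, ← div_lt_iff₀ hl]
    constructor <;> rintro ⟨h1, h2⟩ <;> constructor <;> linarith
  rw [Prod.ext_iff]
  simp only [cell, Set.mem_ofPred_eq, key, cellIndex]

theorem disjoint_cell {lam : ℝ} (hl : 0 < lam) {j k : Grid} (h : j ≠ k) :
    Disjoint (cell lam j) (cell lam k) := by
  rw [Set.disjoint_left]
  intro x hj hk
  rw [mem_cell_iff hl] at hj hk
  exact h (hj.symm.trans hk)

theorem add_gridPoint_mem_cell {lam : ℝ} (j k : Grid) (x : Plane) :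
    gridPoint lam j + x ∈ cell lam (k + j) ↔ x ∈ cell lam k := by
  simp only [cell, Set.mem_ofPred_eq, PiLp.add_apply, gridPoint_apply_zero, gridPoint_apply_one,
    Prod.fst_add, Prod.snd_add]
  push_cast
  constructor <;> rintro ⟨⟨h1, h2⟩, h3, h4⟩ <;> refine ⟨⟨?_, ?_⟩, ?_, ?_⟩ <;> linarith

/-- The average of a complex signal over a cell. -/
def cellAvg (lam : ℝ) (k : Grid) : CSignal →L[ℂ] ℂ :=
  (1 / (lam : ℂ) ^ 2) • innerSL ℂ
    (indicatorConstLp 2 (measurableSet_cell lam k) (volume_cell_ne_top lam k) (1 : ℂ))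

theorem cellAvg_apply (lam : ℝ) (k : Grid) (h : CSignal) :
    cellAvg lam k h = (1 / (lam : ℂ) ^ 2) * ∫ x in cell lam k, h x := by
  simp only [cellAvg, _root_.smul_apply, innerSL_apply_apply, smul_eq_mul,
    L2.inner_indicatorConstLp_one]

theorem cellAvg_crep_translation (lam : ℝ) (j k : Grid) (h : CSignal) :
    cellAvg lam k (crep (SE2.translation (gridPoint lam j))⁻¹ h) = cellAvg lam (k + j) h := by
  rw [cellAvg_apply, cellAvg_apply]
  congr 1
  have hmp : MeasurePreserving (fun x : Plane => gridPoint lam j + x) volume volume :=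
    measurePreserving_add_left volume _
  have hpre : (fun x : Plane => gridPoint lam j + x) ⁻¹' cell lam (k + j) = cell lam k := by
    ext x
    exact add_gridPoint_mem_cell j k x
  rw [← hmp.setIntegral_preimage_emb
    (MeasurableEquiv.addLeft (gridPoint lam j)).measurableEmbedding h (cell lam (k + j)), hpre]
  refine setIntegral_congr_ae (measurableSet_cell lam k) ?_
  filter_upwards [coeFn_crep (SE2.translation (gridPoint lam j))⁻¹ h] with x hx _
  rw [hx, inv_inv, SE2.translation_smul]

/-- The linear functional that applies a stencil to the cell averages, at the origin. -/
def discFun (lam : ℝ) (p : Stencil) : CSignal →L[ℂ] ℂ := p.coeff.sum fun j c => c • cellAvg lam j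

theorem discFun_apply (lam : ℝ) (p : Stencil) (h : CSignal) :
    discFun lam p h = p.coeff.sum fun j c => c * cellAvg lam j h := by
  simp [discFun, Finsupp.sum]

theorem act_cellAvg (lam : ℝ) (p : Stencil) (h : CSignal) (k : Grid) :
    act p (fun j => cellAvg lam j h) k
      = discFun lam p (crep (SE2.translation (gridPoint lam k))⁻¹ h) := by
  rw [act_apply, discFun_apply]
  simp only [cellAvg_crep_translation, add_comm]

theorem gridComp_average {d : ℕ} (lam : ℝ) (Φ : Signal d) (c : Fin d) :
    gridComp c (fun k => (1 / lam ^ 2) • ∫ x in cell lam k, Φ x)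
      = fun k => cellAvg lam k (comp c Φ) := by
  funext k
  rw [gridComp, cellAvg_apply]
  have hint : IntegrableOn Φ (cell lam k) volume :=
    integrableOn_Lp_of_measure_ne_top Φ (by norm_num) (volume_cell_ne_top lam k)
  have h1 := ((Complex.ofRealCLM.comp
    (EuclideanSpace.proj c : EuclideanSpace ℝ (Fin d) →L[ℝ] ℝ))).integral_comp_comm hint
  have h2 : ∫ x in cell lam k, comp c Φ x = ∫ x in cell lam k, ((Φ x c : ℝ) : ℂ) :=
    setIntegral_congr_ae (measurableSet_cell lam k)
      ((coeFn_comp c Φ).mono fun x hx _ => hx)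
  rw [h2]
  simp only [PiLp.smul_apply, smul_eq_mul]
  push_cast
  congr 1
  exact h1.symm

theorem ChargeConvnet.floor_inputRange {dV dU : ℕ} (N : ChargeConvnet dV dU) {lam : ℝ}
    (hl : 0 < lam) :
    ⌊N.inputRange lam / lam⌋₊ = N.radius lam + N.Tdiff + ChargeConvnet.numSmooth lam := by
  have : N.inputRange lam / lam
      = N.Lam / lam + ((N.Tdiff + ChargeConvnet.numSmooth lam : ℕ) : ℝ) := by
    rw [ChargeConvnet.inputRange]
    push_cast
    field_simp
  rw [this, Nat.floor_add_natCast (div_nonneg N.Lam_nonneg hl.le), ChargeConvnet.radius, add_assoc]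

/-- On the output grid the linear part of a convnet is the same functional applied to the
translates of the signal: the cutoffs of the layers have no effect there. -/
theorem ChargeConvnet.linearPart_eq_discFun {dV dU : ℕ} (N : ChargeConvnet dV dU) {lam : ℝ}
    (hl : 0 < lam) (Φ : Signal dV) (s : ℕ) (μ : ℤ) (c : Fin dV) {k : Grid}
    (hk : k ∈ box (N.radius lam)) :
    N.linearPart lam Φ s μ k c = discFun lam (linStencil N.Tdiff s μ lam)
      (comp c (rep (SE2.translation (gridPoint lam k))⁻¹ Φ)) := by
  rw [comp_rep, ← act_cellAvg, ← gridComp_average, linStencil, mul_comm, act_mul,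
    ← gridComp_smoothStep_iterate hl.ne', ← diffStep_iterate_apply, ChargeConvnet.linearPart]
  refine congrFun (diffLayers_eq (fun s μ j hj => ?_) s μ k hk) c
  funext c'
  simp only [diffInput]
  rw [smoothLayers_eq (fun i hi => ?_) j hj]
  rw [discretize, N.floor_inputRange hl, cutoff, if_pos hi]

/-! ### Symbols of stencils -/

/-- The Fourier symbol of a stencil at the frequency `(a, b)`. -/
def symbol (a b : ℝ) : Stencil →ₐ[ℂ] ℂ :=
  AddMonoidAlgebra.lift ℂ _ _
    { toFun := fun j => Complex.exp (Complex.I * (j.toAdd.1 * a + j.toAdd.2 * b))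
      map_one' := by simp
      map_mul' := fun i j => by
        rw [← Complex.exp_add, toAdd_mul, Prod.fst_add, Prod.snd_add]
        push_cast
        ring_nf }

theorem symbol_single (a b : ℝ) (j : Grid) (c : ℂ) :
    symbol a b (AddMonoidAlgebra.single j c)
      = c * Complex.exp (Complex.I * (j.1 * a + j.2 * b)) := by
  simp [symbol]

theorem symbol_apply (a b : ℝ) (p : Stencil) :
    symbol a b p
      = p.coeff.sum fun j c => c * Complex.exp (Complex.I * (j.1 * a + j.2 * b)) := by
  rw [symbol, AddMonoidAlgebra.lift_apply]
  simp

theorem exp_I_eq (a : ℝ) :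
    Complex.exp (Complex.I * a) = Complex.cos a + Complex.sin a * Complex.I := by
  rw [mul_comm, Complex.exp_mul_I]

theorem exp_neg_I_eq (a : ℝ) :
    Complex.exp (-(Complex.I * a)) = Complex.cos a - Complex.sin a * Complex.I := by
  rw [show -(Complex.I * (a : ℂ)) = (-(a : ℂ)) * Complex.I by ring, Complex.exp_mul_I,
    Complex.cos_neg, Complex.sin_neg]
  ring

theorem symbol_smoothStencil (a b : ℝ) :
    symbol a b smoothStencil = ((1 / 2 + (Real.cos a + Real.cos b) / 4 : ℝ) : ℂ) := by
  simp only [smoothStencil, map_add, symbol_single]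
  simp [exp_I_eq, exp_neg_I_eq]
  ring

theorem symbol_dzStencil (lam a b : ℝ) :
    symbol a b (dzStencil lam)
      = 1 / (2 * (lam : ℂ)) * (Complex.I * Real.sin a + Real.sin b) := by
  simp only [dzStencil, map_add, symbol_single]
  simp [exp_I_eq, exp_neg_I_eq]
  ring_nf
  simp
  ring

theorem symbol_dzbarStencil (lam a b : ℝ) :
    symbol a b (dzbarStencil lam)
      = 1 / (2 * (lam : ℂ)) * (Complex.I * Real.sin a - Real.sin b) := by
  simp only [dzbarStencil, map_add, symbol_single]
  simp [exp_I_eq, exp_neg_I_eq]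
  ring_nf
  simp
  ring

theorem symbol_linStencil (T s : ℕ) (μ : ℤ) (lam a b : ℝ) :
    symbol a b (linStencil T s μ lam)
      = ((1 / 2 + (Real.cos a + Real.cos b) / 4 : ℝ) : ℂ) ^ ChargeConvnet.numSmooth lam
        * diffCoeff (1 / (2 * (lam : ℂ)) * (Complex.I * Real.sin a + Real.sin b))
            (1 / (2 * (lam : ℂ)) * (Complex.I * Real.sin a - Real.sin b)) T s μ := by
  rw [linStencil, map_mul, map_pow, symbol_smoothStencil, ← symbol_dzStencil,
    ← symbol_dzbarStencil]
  congr 1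
  exact map_diffCoeff (symbol a b : Stencil →ₐ[ℂ] ℂ).toRingHom _ _ _ _ _

theorem continuous_symbol (p : Stencil) : Continuous fun z : ℝ × ℝ => symbol z.1 z.2 p := by
  simp only [symbol_apply, Finsupp.sum]
  fun_prop

theorem abs_smoothSymbol_le_one (a b : ℝ) : |1 / 2 + (Real.cos a + Real.cos b) / 4| ≤ 1 := by
  rw [abs_le]
  constructor <;> linarith [Real.cos_le_one a, Real.cos_le_one b, Real.neg_one_le_cos a,
    Real.neg_one_le_cos b]

theorem norm_dSymbol_le {lam : ℝ} (hl : 0 < lam) (a b : ℝ) :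
    ‖1 / (2 * (lam : ℂ)) * (Complex.I * Real.sin a + Real.sin b)‖ ≤ (|a| + |b|) / (2 * lam) ∧
    ‖1 / (2 * (lam : ℂ)) * (Complex.I * Real.sin a - Real.sin b)‖ ≤ (|a| + |b|) / (2 * lam) := by
  have h1 : ‖1 / (2 * (lam : ℂ))‖ = 1 / (2 * lam) := by
    rw [norm_div, norm_mul, Complex.norm_real, Real.norm_of_nonneg hl.le]; simp
  have h2 : ‖Complex.I * Real.sin a‖ ≤ |a| := by
    rw [norm_mul, Complex.norm_I, one_mul, Complex.norm_real]; exact Real.abs_sin_le_abs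
  have h3 : ‖(Real.sin b : ℂ)‖ ≤ |b| := by
    rw [Complex.norm_real]; exact Real.abs_sin_le_abs
  constructor <;> rw [norm_mul, h1, div_mul_eq_mul_div, one_mul] <;> gcongr
  · exact (norm_add_le _ _).trans (add_le_add h2 h3)
  · exact (norm_sub_le _ _).trans (add_le_add h2 h3)

theorem norm_symbol_linStencil_le {lam : ℝ} (hl : 0 < lam) (T s : ℕ) (μ : ℤ) (a b : ℝ) :
    ‖symbol a b (linStencil T s μ lam)‖
      ≤ |1 / 2 + (Real.cos a + Real.cos b) / 4| ^ ChargeConvnet.numSmooth lam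
        * (1 + (|a| + |b|) / lam) ^ T := by
  rw [symbol_linStencil, norm_mul, norm_pow, Complex.norm_real, Real.norm_eq_abs]
  gcongr
  refine (norm_diffCoeff_le _ _ _ _ _).trans ?_
  obtain ⟨h1, h2⟩ := norm_dSymbol_le hl a b
  have h3 : (|a| + |b|) / lam = (|a| + |b|) / (2 * lam) + (|a| + |b|) / (2 * lam) := by
    field_simp; ring
  refine pow_le_pow_left₀ (by positivity) ?_ _
  rw [h3]
  linarith

/-! ### Parseval's identity for stencils -/

theorem integral_exp_int (n : ℤ) :
    ∫ a in (-Real.pi)..Real.pi, Complex.exp (Complex.I * (n * (a : ℂ)))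
      = if n = 0 then 2 * (Real.pi : ℂ) else 0 := by
  split_ifs with h
  · subst h
    simp
    ring
  · have hc : Complex.I * (n : ℂ) ≠ 0 := mul_ne_zero Complex.I_ne_zero (by exact_mod_cast h)
    simp only [← mul_assoc]
    rw [integral_exp_mul_complex hc]
    have : Complex.exp (Complex.I * n * (Real.pi : ℝ))
        = Complex.exp (Complex.I * n * ((-Real.pi : ℝ) : ℂ)) := by
      rw [Complex.exp_eq_exp_iff_exists_int]
      exact ⟨n, by push_cast; ring⟩
    rw [this, sub_self, zero_div]

theorem parseval_stencil (p : Stencil) :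
    ∫ a in (-Real.pi)..Real.pi, ∫ b in (-Real.pi)..Real.pi, ‖symbol a b p‖ ^ 2
      = (2 * Real.pi) ^ 2 * ∑ j ∈ p.coeff.support, ‖p.coeff j‖ ^ 2 := by
  have key : ∀ a b : ℝ, ((‖symbol a b p‖ ^ 2 : ℝ) : ℂ)
      = ∑ j ∈ p.coeff.support, ∑ l ∈ p.coeff.support,
          (p.coeff j * (starRingEnd ℂ) (p.coeff l))
          * Complex.exp (Complex.I * (((j.1 - l.1 : ℤ) : ℂ) * a))
          * Complex.exp (Complex.I * (((j.2 - l.2 : ℤ) : ℂ) * b)) := by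
    intro a b
    rw [Complex.ofReal_pow, ← Complex.mul_conj', symbol_apply, Finsupp.sum, map_sum,
      Finset.sum_mul_sum]
    refine Finset.sum_congr rfl fun j _ => Finset.sum_congr rfl fun l _ => ?_
    rw [map_mul, ← Complex.exp_conj, mul_mul_mul_comm, ← Complex.exp_add,
      mul_assoc (_ * _) (Complex.exp _), ← Complex.exp_add]
    congr 2
    simp
    ring
  have hreal : ((∫ a in (-Real.pi)..Real.pi, ∫ b in (-Real.pi)..Real.pi,
      ‖symbol a b p‖ ^ 2 : ℝ) : ℂ)
      = (((2 * Real.pi) ^ 2 * ∑ j ∈ p.coeff.support, ‖p.coeff j‖ ^ 2 : ℝ) : ℂ) := by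
    rw [← intervalIntegral.integral_ofReal]
    simp only [← intervalIntegral.integral_ofReal, key]
    have inner : ∀ a : ℝ, (∫ b in (-Real.pi)..Real.pi,
        ∑ j ∈ p.coeff.support, ∑ l ∈ p.coeff.support,
          (p.coeff j * (starRingEnd ℂ) (p.coeff l))
          * Complex.exp (Complex.I * (((j.1 - l.1 : ℤ) : ℂ) * a))
          * Complex.exp (Complex.I * (((j.2 - l.2 : ℤ) : ℂ) * b)))
        = ∑ j ∈ p.coeff.support, ∑ l ∈ p.coeff.support,
          (p.coeff j * (starRingEnd ℂ) (p.coeff l))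
          * (if j.2 - l.2 = 0 then 2 * (Real.pi : ℂ) else 0)
          * Complex.exp (Complex.I * (((j.1 - l.1 : ℤ) : ℂ) * a)) := by
      intro a
      rw [intervalIntegral.integral_finsetSum
        fun j _ => Continuous.intervalIntegrable (by fun_prop) _ _]
      refine Finset.sum_congr rfl fun j _ => ?_
      rw [intervalIntegral.integral_finsetSum
        fun l _ => Continuous.intervalIntegrable (by fun_prop) _ _]
      refine Finset.sum_congr rfl fun l _ => ?_
      rw [intervalIntegral.integral_const_mul, integral_exp_int]
      ring
    simp only [inner]
    rw [intervalIntegral.integral_finsetSum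
        fun j _ => Continuous.intervalIntegrable (by fun_prop) _ _]
    rw [Complex.ofReal_mul, Complex.ofReal_sum, Finset.mul_sum]
    refine Finset.sum_congr rfl fun j hj => ?_
    rw [intervalIntegral.integral_finsetSum
        fun l _ => Continuous.intervalIntegrable (by fun_prop) _ _]
    simp only [intervalIntegral.integral_const_mul, integral_exp_int]
    rw [Finset.sum_eq_single_of_mem j hj]
    · rw [sub_self, sub_self, if_pos rfl, Complex.ofReal_pow ‖p.coeff j‖,
        ← Complex.mul_conj']
      push_cast
      ring
    · intro l _ hlj
      by_cases h1 : j.1 - l.1 = 0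
      · by_cases h2 : j.2 - l.2 = 0
        · exact absurd (Prod.ext (by omega) (by omega)) hlj
        · rw [if_neg h2]; ring
      · rw [if_neg h1]; ring
  exact_mod_cast hreal

/-! ### A bound for the discrete functionals, uniform in the grid spacing -/

/-- The normalized indicator functions of the cells are orthonormal, so that Bessel's inequality
bounds the cell averages. -/
theorem orthonormal_cell {lam : ℝ} (hl : 0 < lam) :
    Orthonormal ℂ fun k : Grid => (1 / (lam : ℂ)) •
      (indicatorConstLp 2 (measurableSet_cell lam k) (volume_cell_ne_top lam k) (1 : ℂ)) := by
  have hlc : (lam : ℂ) ≠ 0 := by exact_mod_cast hl.ne'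
  constructor
  · intro k
    rw [norm_smul, norm_indicatorConstLp (by norm_num) (by norm_num), Measure.real, volume_cell hl,
      ENNReal.toReal_ofReal (by positivity)]
    have : (lam ^ 2 : ℝ) ^ (1 / (2 : ENNReal).toReal) = lam := by
      rw [ENNReal.toReal_ofNat, ← Real.sqrt_eq_rpow, Real.sqrt_sq hl.le]
    rw [this, norm_div, Complex.norm_real, Real.norm_of_nonneg hl.le]
    simp
    field_simp
  · intro j k hjk
    rw [inner_smul_left, inner_smul_right, L2.inner_indicatorConstLp_one]
    have : ∫ x in cell lam j,
        (indicatorConstLp 2 (measurableSet_cell lam k) (volume_cell_ne_top lam k) (1 : ℂ) :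
          CSignal) x = 0 := by
      rw [setIntegral_congr_ae (g := fun _ => (0 : ℂ)) (measurableSet_cell lam j)]
      · simp
      filter_upwards [indicatorConstLp_coeFn (p := 2) (hs := measurableSet_cell lam k)
        (hμs := volume_cell_ne_top lam k) (c := (1 : ℂ))] with x hx hxj
      rw [hx, Set.indicator_of_notMem]
      exact Set.disjoint_left.1 (disjoint_cell hl hjk) hxj
    rw [this]
    simp

theorem norm_discFun_apply_le {lam : ℝ} (hl : 0 < lam) (p : Stencil) (h : CSignal) :
    ‖discFun lam p h‖ ≤ lam⁻¹ * √(∑ j ∈ p.coeff.support, ‖p.coeff j‖ ^ 2) * ‖h‖ := by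
  set e := fun k : Grid => (1 / (lam : ℂ)) •
      (indicatorConstLp 2 (measurableSet_cell lam k) (volume_cell_ne_top lam k) (1 : ℂ)) with he
  have hlc : (lam : ℂ) ≠ 0 := by exact_mod_cast hl.ne'
  have havg : ∀ k, cellAvg lam k h = (1 / (lam : ℂ)) * inner ℂ (e k) h := by
    intro k
    rw [he, cellAvg, _root_.smul_apply, innerSL_apply_apply, inner_smul_left]
    simp only [smul_eq_mul, map_div₀, map_one, Complex.conj_ofReal]
    field_simp
  have hb : ∑ k ∈ p.coeff.support, ‖inner ℂ (e k) h‖ ^ 2 ≤ ‖h‖ ^ 2 :=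
    (orthonormal_cell hl).sum_inner_products_le h
  rw [discFun_apply, Finsupp.sum]
  calc ‖∑ j ∈ p.coeff.support, p.coeff j * cellAvg lam j h‖
      ≤ ∑ j ∈ p.coeff.support, ‖p.coeff j * cellAvg lam j h‖ := norm_sum_le _ _
    _ = lam⁻¹ * ∑ j ∈ p.coeff.support, ‖p.coeff j‖ * ‖inner ℂ (e j) h‖ := by
      rw [Finset.mul_sum]
      refine Finset.sum_congr rfl fun j _ => ?_
      rw [havg, norm_mul, norm_mul, norm_div, Complex.norm_real, Real.norm_of_nonneg hl.le]
      simp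
      ring
    _ ≤ lam⁻¹ * (√(∑ j ∈ p.coeff.support, ‖p.coeff j‖ ^ 2)
          * √(∑ j ∈ p.coeff.support, ‖inner ℂ (e j) h‖ ^ 2)) := by
      gcongr
      exact Real.sum_mul_le_sqrt_mul_sqrt _ _ _
    _ ≤ lam⁻¹ * (√(∑ j ∈ p.coeff.support, ‖p.coeff j‖ ^ 2) * ‖h‖) := by
      gcongr
      exact Real.sqrt_le_iff.2 ⟨norm_nonneg _, hb⟩
    _ = _ := by ring

/-- The function such that `gaussMajorant T (a / lam) * gaussMajorant T (b / lam)` dominates the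
squared symbol of `linStencil T s μ lam` at the frequency `(a, b)`. -/
def gaussMajorant (T : ℕ) (t : ℝ) : ℝ :=
  Real.exp (-(4 / Real.pi ^ 2) * t ^ 2) * (1 + |t|) ^ (2 * T)

theorem continuous_gaussMajorant (T : ℕ) : Continuous (gaussMajorant T) := by
  unfold gaussMajorant
  fun_prop

theorem gaussMajorant_nonneg (T : ℕ) (t : ℝ) : 0 ≤ gaussMajorant T t := by
  unfold gaussMajorant
  positivity

theorem integrable_gaussMajorant (T : ℕ) : Integrable (gaussMajorant T) := by
  have hg : Integrable fun t : ℝ =>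
      ((2 * T).factorial * Real.exp 3 : ℝ) * Real.exp (-(1 / 4) * t ^ 2) :=
    (integrable_exp_neg_mul_sq (by norm_num)).const_mul _
  refine hg.mono' (continuous_gaussMajorant T).aestronglyMeasurable (ae_of_all _ fun t => ?_)
  rw [Real.norm_of_nonneg (gaussMajorant_nonneg T t), gaussMajorant]
  have h1 : (1 + |t|) ^ (2 * T) ≤ (2 * T).factorial * Real.exp (1 + |t|) := by
    have := Real.pow_div_factorial_le_exp (1 + |t|) (by positivity) (2 * T)
    rwa [div_le_iff₀ (by positivity), mul_comm (Real.exp _)] at this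
  have hpi : (2 / 5 : ℝ) ≤ 4 / Real.pi ^ 2 := by
    rw [div_le_div_iff₀ (by norm_num) (by positivity)]
    nlinarith [Real.pi_lt_d2, Real.pi_pos]
  calc _ ≤ Real.exp (-(4 / Real.pi ^ 2) * t ^ 2) * ((2 * T).factorial * Real.exp (1 + |t|)) := by
        gcongr
    _ = (2 * T).factorial * Real.exp (-(4 / Real.pi ^ 2) * t ^ 2 + (1 + |t|)) := by
        rw [Real.exp_add (_ * _)]; ring
    _ ≤ (2 * T).factorial * Real.exp (3 + -(1 / 4) * t ^ 2) := by
        refine mul_le_mul_of_nonneg_left (Real.exp_le_exp.2 ?_) (by positivity)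
        -- `|t| ≤ t² / 8 + 2` is absorbed by the Gaussian factor
        nlinarith [sq_nonneg (|t| - 4), sq_abs t, mul_le_mul_of_nonneg_right hpi (sq_nonneg t)]
    _ = _ := by rw [Real.exp_add]; ring

theorem norm_symbol_linStencil_sq_le {lam : ℝ} (hl : 0 < lam) (T s : ℕ) (μ : ℤ) {a b : ℝ}
    (ha : |a| ≤ Real.pi) (hb : |b| ≤ Real.pi) :
    ‖symbol a b (linStencil T s μ lam)‖ ^ 2
      ≤ gaussMajorant T (a / lam) * gaussMajorant T (b / lam) := by
  set S := ChargeConvnet.numSmooth lam with hS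
  have hS' : 4 / lam ^ 2 ≤ S := Nat.le_ceil _
  have h0 : 0 ≤ 1 / 2 + (Real.cos a + Real.cos b) / 4 := by
    linarith [Real.neg_one_le_cos a, Real.neg_one_le_cos b]
  -- from `cos t ≤ 1 - 2 t² / π²` on `[-π, π]` and `1 + u ≤ exp u`
  have hsm : 1 / 2 + (Real.cos a + Real.cos b) / 4
      ≤ Real.exp (-(a ^ 2 + b ^ 2) / (2 * Real.pi ^ 2)) := by
    refine le_trans ?_ (Real.add_one_le_exp _)
    have e1 := Real.cos_le_one_sub_mul_cos_sq ha
    have e2 := Real.cos_le_one_sub_mul_cos_sq hb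
    calc _ ≤ 1 / 2 + ((1 - 2 / Real.pi ^ 2 * a ^ 2) + (1 - 2 / Real.pi ^ 2 * b ^ 2)) / 4 := by
          gcongr
      _ = _ := by field_simp; ring
  have hpow : |1 / 2 + (Real.cos a + Real.cos b) / 4| ^ S
      ≤ Real.exp (-(2 / Real.pi ^ 2) * ((a / lam) ^ 2 + (b / lam) ^ 2)) := by
    rw [abs_of_nonneg h0]
    refine (pow_le_pow_left₀ h0 hsm S).trans ?_
    rw [← Real.exp_nat_mul, Real.exp_le_exp]
    have : (4 / lam ^ 2) * ((a ^ 2 + b ^ 2) / (2 * Real.pi ^ 2))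
        ≤ S * ((a ^ 2 + b ^ 2) / (2 * Real.pi ^ 2)) := by gcongr
    calc _ = -(S * ((a ^ 2 + b ^ 2) / (2 * Real.pi ^ 2))) := by ring
      _ ≤ -((4 / lam ^ 2) * ((a ^ 2 + b ^ 2) / (2 * Real.pi ^ 2))) := neg_le_neg this
      _ = _ := by field_simp; ring
  have hprod : 1 + (|a| + |b|) / lam ≤ (1 + |a / lam|) * (1 + |b / lam|) := by
    rw [abs_div, abs_div, abs_of_pos hl]
    have : 0 ≤ |a| / lam * (|b| / lam) := by positivity
    calc _ ≤ 1 + (|a| + |b|) / lam + |a| / lam * (|b| / lam) := by linarith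
      _ = _ := by ring
  calc _ ≤ (Real.exp (-(2 / Real.pi ^ 2) * ((a / lam) ^ 2 + (b / lam) ^ 2))
        * ((1 + |a / lam|) * (1 + |b / lam|)) ^ T) ^ 2 := by
        refine pow_le_pow_left₀ (norm_nonneg _) ?_ 2
        refine (norm_symbol_linStencil_le hl T s μ a b).trans ?_
        gcongr
    _ = _ := by
        rw [gaussMajorant, gaussMajorant, mul_pow, ← Real.exp_nat_mul, ← pow_mul, mul_pow,
          mul_comm T 2, mul_mul_mul_comm, ← Real.exp_add]
        congr 2
        push_cast
        ring

/-- By Parseval's identity the square sum of the coefficients is an integral of the squared symbol,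
which is concentrated at frequencies of order `lam`. -/
theorem sum_norm_sq_linStencil_le {lam : ℝ} (hl : 0 < lam) (T s : ℕ) (μ : ℤ) :
    ∑ j ∈ (linStencil T s μ lam).coeff.support, ‖(linStencil T s μ lam).coeff j‖ ^ 2
      ≤ (lam * ∫ t, gaussMajorant T t) ^ 2 := by
  have hpi : -Real.pi ≤ Real.pi := by linarith [Real.pi_pos]
  set p := linStencil T s μ lam with hp
  have hcont : Continuous fun z : ℝ × ℝ => ‖symbol z.1 z.2 p‖ ^ 2 :=
    (continuous_symbol p).norm.pow 2
  have hF : Continuous fun t => gaussMajorant T (t / lam) :=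
    (continuous_gaussMajorant T).comp (continuous_id.div_const _)
  have h1 : ∫ b in (-Real.pi)..Real.pi, gaussMajorant T (b / lam)
      ≤ lam * ∫ t, gaussMajorant T t := by
    rw [intervalIntegral.integral_comp_div _ hl.ne', smul_eq_mul]
    gcongr
    rw [intervalIntegral.integral_of_le (by gcongr)]
    exact setIntegral_le_integral (integrable_gaussMajorant T)
      (ae_of_all _ (gaussMajorant_nonneg T))
  have h0 : 0 ≤ ∫ b in (-Real.pi)..Real.pi, gaussMajorant T (b / lam) :=
    intervalIntegral.integral_nonneg hpi fun t _ => gaussMajorant_nonneg T _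
  have h2 : ∫ a in (-Real.pi)..Real.pi, ∫ b in (-Real.pi)..Real.pi, ‖symbol a b p‖ ^ 2
      ≤ ∫ a in (-Real.pi)..Real.pi, ∫ b in (-Real.pi)..Real.pi,
        gaussMajorant T (a / lam) * gaussMajorant T (b / lam) := by
    refine intervalIntegral.integral_mono_on hpi
      (intervalIntegral.continuous_parametric_intervalIntegral_of_continuous'
        hcont _ _ |>.intervalIntegrable _ _)
      (Continuous.intervalIntegrable ?_ _ _) fun a ha => ?_
    · simp only [intervalIntegral.integral_const_mul]
      exact hF.mul continuous_const
    · refine intervalIntegral.integral_mono_on hpi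
        ((hcont.comp (by fun_prop : Continuous fun b : ℝ => (a, b))).intervalIntegrable _ _)
        ((continuous_const.mul hF).intervalIntegrable _ _) fun b hb => ?_
      exact norm_symbol_linStencil_sq_le hl T s μ (abs_le.2 ha) (abs_le.2 hb)
  rw [parseval_stencil] at h2
  simp only [intervalIntegral.integral_const_mul, intervalIntegral.integral_mul_const] at h2
  have h3 : (1 : ℝ) ≤ (2 * Real.pi) ^ 2 := by nlinarith [Real.pi_gt_three]
  calc _ ≤ (2 * Real.pi) ^ 2 * ∑ j ∈ p.coeff.support, ‖p.coeff j‖ ^ 2 :=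
        le_mul_of_one_le_left (Finset.sum_nonneg fun _ _ => by positivity) h3
    _ ≤ _ := h2
    _ = (∫ b in (-Real.pi)..Real.pi, gaussMajorant T (b / lam)) ^ 2 := by ring
    _ ≤ _ := pow_le_pow_left₀ h0 h1 2

/-- The discrete functionals of a convnet are bounded on `L²` uniformly in the grid spacing. -/
theorem norm_discFun_linStencil_le {lam : ℝ} (hl : 0 < lam) (T s : ℕ) (μ : ℤ) (h : CSignal) :
    ‖discFun lam (linStencil T s μ lam) h‖ ≤ (∫ t, gaussMajorant T t) * ‖h‖ := by
  have hI : 0 ≤ ∫ t, gaussMajorant T t := integral_nonneg (gaussMajorant_nonneg T)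
  refine (norm_discFun_apply_le hl _ h).trans ?_
  gcongr
  calc _ ≤ lam⁻¹ * (lam * ∫ t, gaussMajorant T t) := by
        gcongr
        exact Real.sqrt_le_iff.2 ⟨by positivity, sum_norm_sq_linStencil_le hl T s μ⟩
    _ = _ := by field_simp

open scoped FourierTransform SchwartzMap

/-! ### Gaussian-weighted functionals of the Fourier transform -/

/-- The limit of the symbol of `∂_z` at the frequency `ξ`. -/
def dzSymbol (ξ : Plane) : ℂ := Real.pi * (Complex.I * (ξ 0 : ℝ) + (ξ 1 : ℝ))

/-- The limit of the symbol of `∂_z̄` at the frequency `ξ`. -/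
def dzbarSymbol (ξ : Plane) : ℂ := Real.pi * (Complex.I * (ξ 0 : ℝ) - (ξ 1 : ℝ))

/-- The Fourier transform of the standard Gaussian density. -/
def gaussSymbol (ξ : Plane) : ℂ := (Real.exp (-(2 * Real.pi ^ 2) * ‖ξ‖ ^ 2) : ℝ)

theorem continuous_dzSymbol : Continuous dzSymbol := by unfold dzSymbol; fun_prop

theorem continuous_dzbarSymbol : Continuous dzbarSymbol := by unfold dzbarSymbol; fun_prop

theorem continuous_gaussSymbol : Continuous gaussSymbol := by unfold gaussSymbol; fun_prop

theorem norm_gaussSymbol (ξ : Plane) :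
    ‖gaussSymbol ξ‖ = Real.exp (-(2 * Real.pi ^ 2) * ‖ξ‖ ^ 2) := by
  rw [gaussSymbol, Complex.norm_real, Real.norm_of_nonneg (Real.exp_nonneg _)]

theorem norm_sq_plane (ξ : Plane) : ‖ξ‖ ^ 2 = ξ 0 ^ 2 + ξ 1 ^ 2 := by
  rw [EuclideanSpace.real_norm_sq_eq, Fin.sum_univ_two]

theorem norm_dzSymbol (ξ : Plane) : ‖dzSymbol ξ‖ = Real.pi * ‖ξ‖ := by
  rw [dzSymbol, norm_mul, Complex.norm_real, Real.norm_of_nonneg Real.pi_pos.le]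
  congr 1
  rw [← sq_eq_sq₀ (norm_nonneg _) (norm_nonneg _), norm_sq_plane, Complex.sq_norm,
    Complex.normSq_apply]
  simp
  ring

theorem norm_dzbarSymbol (ξ : Plane) : ‖dzbarSymbol ξ‖ = Real.pi * ‖ξ‖ := by
  rw [dzbarSymbol, norm_mul, Complex.norm_real, Real.norm_of_nonneg Real.pi_pos.le]
  congr 1
  rw [← sq_eq_sq₀ (norm_nonneg _) (norm_nonneg _), norm_sq_plane, Complex.sq_norm,
    Complex.normSq_apply]
  simp
  ring

/-- The Gaussian absorbs every factor of exponential growth. -/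
theorem memLp_gaussSymbol_mul {q : Plane → ℂ} (hq : Continuous q) {C c : ℝ}
    (hb : ∀ ξ, ‖q ξ‖ ≤ C * Real.exp (c * ‖ξ‖)) :
    MemLp (fun ξ => gaussSymbol ξ * q ξ) 2 volume := by
  have hg : MemLp (fun ξ : Plane => Complex.exp (-1 * (‖ξ‖ : ℂ) ^ 2)) 2 volume := by
    rw [memLp_two_iff_integrable_sq_norm (by fun_prop)]
    have := (GaussianFourier.integrable_cexp_neg_mul_sq_norm_add (V := Plane) (b := 2)
      (by norm_num) 0 0).norm
    refine this.congr (ae_of_all _ fun ξ => ?_)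
    simp only [zero_mul, add_zero, Complex.norm_exp, ← Real.exp_nat_mul]
    congr 1
    simp [← Complex.ofReal_pow]
  refine hg.of_le_mul (c := C * Real.exp (c ^ 2 / 4))
    (continuous_gaussSymbol.mul hq).aestronglyMeasurable (ae_of_all _ fun ξ => ?_)
  have hC : 0 ≤ C := by
    have := (norm_nonneg _).trans (hb ξ)
    exact nonneg_of_mul_nonneg_left this (Real.exp_pos _)
  rw [norm_mul, norm_gaussSymbol, Complex.norm_exp]
  have : (-1 * (‖ξ‖ : ℂ) ^ 2).re = -‖ξ‖ ^ 2 := by simp [← Complex.ofReal_pow]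
  rw [this]
  calc _ ≤ Real.exp (-(2 * Real.pi ^ 2) * ‖ξ‖ ^ 2) * (C * Real.exp (c * ‖ξ‖)) := by
        gcongr; exact hb ξ
    _ = C * Real.exp (-(2 * Real.pi ^ 2) * ‖ξ‖ ^ 2 + c * ‖ξ‖) := by rw [Real.exp_add]; ring
    _ ≤ C * Real.exp (c ^ 2 / 4 + -‖ξ‖ ^ 2) := by
        refine mul_le_mul_of_nonneg_left (Real.exp_le_exp.2 ?_) hC
        have : (1 : ℝ) ≤ Real.pi ^ 2 := by nlinarith [Real.pi_gt_three]
        nlinarith [sq_nonneg (c / 2 - ‖ξ‖), mul_le_mul_of_nonneg_right this (sq_nonneg ‖ξ‖)]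
    _ = _ := by rw [Real.exp_add]; ring

theorem one_add_pow_le_exp {t : ℝ} (ht : 0 ≤ t) (n : ℕ) :
    (1 + t) ^ n ≤ (n.factorial * Real.exp 1) * Real.exp t := by
  have := Real.pow_div_factorial_le_exp (1 + t) (by positivity) n
  rw [div_le_iff₀ (by positivity), Real.exp_add] at this
  linarith

theorem memLp_gaussSymbol_mul_diffCoeff (T s : ℕ) (μ : ℤ) :
    MemLp (fun ξ => gaussSymbol ξ * diffCoeff (dzSymbol ξ) (dzbarSymbol ξ) T s μ) 2 volume := by
  refine memLp_gaussSymbol_mul (C := T.factorial * Real.exp 1) (c := 2 * Real.pi)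
    (continuous_diffCoeff continuous_dzSymbol continuous_dzbarSymbol _ _ _) fun ξ => ?_
  refine (norm_diffCoeff_le _ _ _ _ _).trans ?_
  rw [norm_dzSymbol, norm_dzbarSymbol, add_assoc,
    show Real.pi * ‖ξ‖ + Real.pi * ‖ξ‖ = 2 * Real.pi * ‖ξ‖ by ring]
  exact one_add_pow_le_exp (by positivity) T

theorem memLp_gaussSymbol_mul_pow (a b : ℕ) :
    MemLp (fun ξ => gaussSymbol ξ * (dzSymbol ξ ^ a * dzbarSymbol ξ ^ b)) 2 volume := by
  refine memLp_gaussSymbol_mul (C := (a + b).factorial * Real.exp 1) (c := Real.pi)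
    ((continuous_dzSymbol.pow a).mul (continuous_dzbarSymbol.pow b)) fun ξ => ?_
  rw [norm_mul, norm_pow, norm_pow, norm_dzSymbol, norm_dzbarSymbol, ← pow_add]
  refine le_trans ?_ (one_add_pow_le_exp (by positivity) _)
  gcongr
  linarith

/-- The functional `h ↦ ∫ m ĥ` on scalar signals, for a square integrable function `m` of the
frequency. -/
def fourierPairing {m : Plane → ℂ} (hm : MemLp m 2 volume) : CSignal →L[ℂ] ℂ :=
  (innerSL ℂ hm.star.toLp).comp
    (Lp.fourierTransformₗᵢ Plane ℂ).toContinuousLinearEquiv.toContinuousLinearMap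

theorem fourierPairing_apply {m : Plane → ℂ} (hm : MemLp m 2 volume) (h : CSignal) :
    fourierPairing hm h = ∫ ξ, m ξ * (𝓕 h : CSignal) ξ := by
  have : fourierPairing hm h = inner ℂ hm.star.toLp (𝓕 h : CSignal) := rfl
  rw [this, L2.inner_def]
  refine integral_congr_ae ?_
  filter_upwards [hm.star.coeFn_toLp] with ξ hξ
  rw [hξ]
  simp [mul_comm]

/-- The limit of the discrete functionals of a convnet as the grid spacing tends to zero: up to a
constant factor (possibly zero) a derivative, at the origin, of the signal convolved with the
standard Gaussian density. -/
def limFun (T s : ℕ) (μ : ℤ) : CSignal →L[ℂ] ℂ :=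
  fourierPairing (memLp_gaussSymbol_mul_diffCoeff T s μ)

/-- The functional `h ↦ ∂_z ^ a ∂_z̄ ^ b (G * h) (0)`, with `G` the standard Gaussian density. -/
def gaussDeriv (a b : ℕ) : CSignal →L[ℂ] ℂ := fourierPairing (memLp_gaussSymbol_mul_pow a b)

/-- In the degrees and charges `(a + b, a - b)` the limit is a nonzero multiple of `gaussDeriv`. -/
theorem exists_limFun_eq (n a b : ℕ) (h : a + b ≤ n) :
    ∃ c : ℕ, 0 < c ∧ ∀ u, limFun n (a + b) ((a : ℤ) - b) u = c * gaussDeriv a b u := by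
  obtain ⟨c, hc, hc'⟩ := exists_diffCoeff_eq n a b h
  refine ⟨c, hc, fun u => ?_⟩
  rw [limFun, gaussDeriv, fourierPairing_apply, fourierPairing_apply, ← integral_const_mul]
  refine integral_congr_ae (ae_of_all _ fun ξ => ?_)
  simp only [hc']
  ring

/-! ### Convergence of the discrete functionals -/

/-- The average over the cell of the origin of the character of frequency `ξ`. -/
def cellChar (lam : ℝ) (ξ : Plane) : ℂ :=
  (1 / (lam : ℂ) ^ 2) * ∫ y in cell lam 0,
    Complex.exp (Complex.I * ((2 * Real.pi * (y 0 * ξ 0 + y 1 * ξ 1) : ℝ) : ℂ))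

theorem norm_cell_zero_le {lam : ℝ} (hl : 0 < lam) {y : Plane} (hy : y ∈ cell lam 0) :
    ‖y‖ ≤ lam := by
  obtain ⟨⟨h1, h2⟩, h3, h4⟩ := hy
  simp only [Prod.fst_zero, Prod.snd_zero, Int.cast_zero] at h1 h2 h3 h4
  rw [← sq_le_sq₀ (norm_nonneg _) hl.le, norm_sq_plane]
  nlinarith

theorem cellIntegral_const {lam : ℝ} (hl : 0 < lam) (k : Grid) :
    (1 / (lam : ℂ) ^ 2) * ∫ _ in cell lam k, (1 : ℂ) = 1 := by
  have hlc : (lam : ℂ) ≠ 0 := by exact_mod_cast hl.ne'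
  rw [setIntegral_const, Measure.real, volume_cell hl, ENNReal.toReal_ofReal (by positivity)]
  simp
  field_simp

theorem norm_cellIntegral_le {lam : ℝ} (hl : 0 < lam) (k : Grid) {F : Plane → ℂ} {C : ℝ}
    (hF : ∀ y ∈ cell lam k, ‖F y‖ ≤ C) :
    ‖(1 / (lam : ℂ) ^ 2) * ∫ y in cell lam k, F y‖ ≤ C := by
  rw [norm_mul]
  have h1 := norm_setIntegral_le_of_norm_le_const
    ((volume_cell_ne_top lam k).lt_top) hF
  rw [Measure.real, volume_cell hl, ENNReal.toReal_ofReal (by positivity)] at h1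
  have h2 : ‖1 / (lam : ℂ) ^ 2‖ = 1 / lam ^ 2 := by
    rw [norm_div, norm_pow, Complex.norm_real, Real.norm_of_nonneg hl.le]; simp
  rw [h2]
  calc _ ≤ 1 / lam ^ 2 * (C * lam ^ 2) := by gcongr
    _ = C := by field_simp

theorem norm_exp_I_real (t : ℝ) : ‖Complex.exp (Complex.I * (t : ℂ))‖ = 1 := by
  rw [mul_comm, Complex.norm_exp_ofReal_mul_I]

theorem norm_cellChar_le {lam : ℝ} (hl : 0 < lam) (ξ : Plane) : ‖cellChar lam ξ‖ ≤ 1 :=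
  norm_cellIntegral_le hl 0 fun _ _ => (norm_exp_I_real _).le

theorem integrableOn_cell_of_continuous {lam : ℝ} (k : Grid) {F : Plane → ℂ} (hF : Continuous F)
    {C : ℝ} (hC : ∀ y, ‖F y‖ ≤ C) : IntegrableOn F (cell lam k) volume :=
  IntegrableOn.of_bound (volume_cell_ne_top lam k).lt_top hF.aestronglyMeasurable C
    (ae_of_all _ hC)

theorem abs_dot_le (y ξ : Plane) : |y 0 * ξ 0 + y 1 * ξ 1| ≤ ‖y‖ * ‖ξ‖ := by
  rw [← abs_of_nonneg (mul_nonneg (norm_nonneg y) (norm_nonneg ξ)), ← sq_le_sq, mul_pow,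
    norm_sq_plane, norm_sq_plane]
  nlinarith [sq_nonneg (y 0 * ξ 1 - y 1 * ξ 0)]

theorem tendsto_cellChar (ξ : Plane) : Tendsto (fun lam => cellChar lam ξ) (𝓝[>] 0) (𝓝 1) := by
  rw [tendsto_iff_norm_sub_tendsto_zero]
  have hlim : Tendsto (fun lam : ℝ => 2 * Real.pi * (lam * ‖ξ‖)) (𝓝[>] 0) (𝓝 0) := by
    have : Continuous fun lam : ℝ => 2 * Real.pi * (lam * ‖ξ‖) := by fun_prop
    have h := (this.tendsto 0).mono_left (nhdsWithin_le_nhds (s := Set.Ioi 0))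
    simpa using h
  refine squeeze_zero' (Eventually.of_forall fun _ => norm_nonneg _) ?_ hlim
  filter_upwards [self_mem_nhdsWithin] with lam hl
  have hl : 0 < lam := hl
  conv_lhs => rw [← cellIntegral_const hl 0, cellChar]
  rw [← mul_sub, ← integral_sub]
  · refine norm_cellIntegral_le hl 0 fun y hy => ?_
    refine Real.norm_exp_I_mul_ofReal_sub_one_le.trans ?_
    rw [Real.norm_eq_abs, abs_mul, abs_of_nonneg (by positivity : 0 ≤ 2 * Real.pi)]
    gcongr
    refine (abs_dot_le y ξ).trans ?_
    gcongr
    exact norm_cell_zero_le hl hy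
  · exact integrableOn_cell_of_continuous 0 (by fun_prop) fun y => (norm_exp_I_real _).le
  · exact integrableOn_cell_of_continuous (C := 1) 0 (by fun_prop) fun y => by simp

theorem continuous_cellChar (lam : ℝ) : Continuous (cellChar lam) := by
  refine continuous_const.mul ?_
  have : IsFiniteMeasure (volume.restrict (cell lam 0)) :=
    isFiniteMeasure_restrict.2 (volume_cell_ne_top lam 0)
  refine continuous_of_dominated (bound := fun _ => 1)
    (fun ξ => Continuous.aestronglyMeasurable (by fun_prop))
    (fun ξ => ae_of_all _ fun y => (norm_exp_I_real _).le) (integrable_const _)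
    (ae_of_all _ fun y => by fun_prop)

/-- The average of a character over a cell. -/
theorem cellAvg_char (lam : ℝ) (j : Grid) (ξ : Plane) :
    (1 / (lam : ℂ) ^ 2) * ∫ y in cell lam j,
        Complex.exp (Complex.I * ((2 * Real.pi * (y 0 * ξ 0 + y 1 * ξ 1) : ℝ) : ℂ))
      = Complex.exp (Complex.I * (j.1 * ((2 * Real.pi * lam * ξ 0 : ℝ) : ℂ)
          + j.2 * ((2 * Real.pi * lam * ξ 1 : ℝ) : ℂ))) * cellChar lam ξ := by
  have hmp : MeasurePreserving (fun x : Plane => gridPoint lam j + x) volume volume :=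
    measurePreserving_add_left volume _
  have hpre : (fun x : Plane => gridPoint lam j + x) ⁻¹' cell lam j = cell lam 0 := by
    ext x
    have := add_gridPoint_mem_cell (lam := lam) j 0 x
    rwa [zero_add] at this
  rw [← hmp.setIntegral_preimage_emb
    (MeasurableEquiv.addLeft (gridPoint lam j)).measurableEmbedding _ (cell lam j), hpre, cellChar,
    mul_left_comm]
  congr 1
  rw [← integral_const_mul]
  congr 1
  funext y
  rw [← Complex.exp_add]
  congr 1
  simp only [PiLp.add_apply, gridPoint_apply_zero, gridPoint_apply_one]
  push_cast
  ring

theorem schwartz_eq_integral (f : 𝓢(Plane, ℂ)) (y : Plane) :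
    f y = ∫ ξ, Complex.exp (Complex.I * ((2 * Real.pi * (y 0 * ξ 0 + y 1 * ξ 1) : ℝ) : ℂ))
      * (𝓕 f : 𝓢(Plane, ℂ)) ξ := by
  have h1 : f = 𝓕⁻ (𝓕 f : 𝓢(Plane, ℂ)) := (FourierTransform.fourierInv_fourier_eq f).symm
  conv_lhs => rw [h1, SchwartzMap.fourierInv_coe, Real.fourierInv_eq']
  refine integral_congr_ae (ae_of_all _ fun ξ => ?_)
  simp only [smul_eq_mul, PiLp.inner_apply, Fin.sum_univ_two]
  rw [mul_comm _ Complex.I]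
  simp

theorem cellAvg_schwartz (lam : ℝ) (j : Grid) (f : 𝓢(Plane, ℂ)) :
    cellAvg lam j (f.toLp 2) = ∫ ξ, (𝓕 f : 𝓢(Plane, ℂ)) ξ
      * (Complex.exp (Complex.I * (j.1 * ((2 * Real.pi * lam * ξ 0 : ℝ) : ℂ)
          + j.2 * ((2 * Real.pi * lam * ξ 1 : ℝ) : ℂ))) * cellChar lam ξ) := by
  have : IsFiniteMeasure (volume.restrict (cell lam j)) :=
    isFiniteMeasure_restrict.2 (volume_cell_ne_top lam j)
  rw [cellAvg_apply, setIntegral_congr_ae (g := f) (measurableSet_cell lam j)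
    ((f.coeFn_toLp 2 volume).mono fun x hx _ => hx)]
  simp only [schwartz_eq_integral f]
  rw [integral_integral_swap]
  · rw [← integral_const_mul]
    refine integral_congr_ae (ae_of_all _ fun ξ => ?_)
    simp only
    rw [integral_mul_const, ← cellAvg_char]
    ring
  · have h1 : Integrable (fun z : Plane × Plane => (1 : ℂ) * (𝓕 f : 𝓢(Plane, ℂ)) z.2)
        ((volume.restrict (cell lam j)).prod volume) :=
      (integrable_const (1 : ℂ)).mul_prod (𝓕 f : 𝓢(Plane, ℂ)).integrable
    refine h1.mono ?_ (ae_of_all _ fun z => ?_)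
    · refine Continuous.aestronglyMeasurable ?_
      have := (𝓕 f : 𝓢(Plane, ℂ)).continuous
      simp only [Function.uncurry_def]
      fun_prop
    · simp only [Function.uncurry_def, norm_mul, norm_exp_I_real, norm_one]
      rfl

/-- On Schwartz functions the discrete functionals are integrals of the Fourier transform against
the symbol of the stencil. -/
theorem discFun_schwartz {lam : ℝ} (hl : 0 < lam) (p : Stencil) (f : 𝓢(Plane, ℂ)) :
    discFun lam p (f.toLp 2) = ∫ ξ, (𝓕 f : 𝓢(Plane, ℂ)) ξ
      * (symbol (2 * Real.pi * lam * ξ 0) (2 * Real.pi * lam * ξ 1) p * cellChar lam ξ) := by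
  simp only [discFun_apply, symbol_apply, Finsupp.sum, cellAvg_schwartz, Finset.sum_mul,
    Finset.mul_sum]
  rw [integral_finsetSum]
  · refine Finset.sum_congr rfl fun j _ => ?_
    rw [← integral_const_mul]
    refine integral_congr_ae (ae_of_all _ fun ξ => ?_)
    simp only
    ring
  · intro j _
    refine (𝓕 f : 𝓢(Plane, ℂ)).integrable.mul_bdd (c := ‖p.coeff j‖) ?_ (ae_of_all _ fun ξ => ?_)
    · refine Continuous.aestronglyMeasurable ?_
      have := continuous_cellChar lam
      fun_prop
    · rw [norm_mul, norm_mul]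
      have : ‖Complex.exp (Complex.I * (j.1 * ((2 * Real.pi * lam * ξ 0 : ℝ) : ℂ)
          + j.2 * ((2 * Real.pi * lam * ξ 1 : ℝ) : ℂ)))‖ = 1 := by
        have := norm_exp_I_real (j.1 * (2 * Real.pi * lam * ξ 0) + j.2 * (2 * Real.pi * lam * ξ 1))
        push_cast at this ⊢
        exact this
      rw [this, mul_one]
      exact mul_le_of_le_one_right (norm_nonneg _) (norm_cellChar_le hl ξ)

theorem tendsto_sin_mul_div (a : ℝ) :
    Tendsto (fun lam : ℝ => Real.sin (a * lam) / lam) (𝓝[>] 0) (𝓝 a) := by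
  have h : HasDerivAt (fun lam : ℝ => Real.sin (a * lam)) a 0 := by
    have h1 : HasDerivAt (fun lam : ℝ => a * lam) a 0 := by
      simpa using (hasDerivAt_id (0 : ℝ)).const_mul a
    simpa using h1.sin
  refine h.tendsto_slope_zero_right.congr fun lam => ?_
  simp [div_eq_inv_mul]

theorem tendsto_one_sub_cos_div (a : ℝ) :
    Tendsto (fun lam : ℝ => (Real.cos (a * lam) - 1) / lam ^ 2) (𝓝[>] 0) (𝓝 (-(a ^ 2 / 2))) := by
  have h := ((tendsto_sin_mul_div (a / 2)).pow 2).const_mul (-2)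
  rw [show -2 * (a / 2) ^ 2 = -(a ^ 2 / 2) by ring] at h
  refine h.congr fun lam => ?_
  have e : Real.cos (a * lam) = 1 - 2 * Real.sin (a / 2 * lam) ^ 2 := by
    rw [show a * lam = 2 * (a / 2 * lam) by ring, Real.cos_two_mul, Real.sin_sq]
    ring
  rw [e, div_pow]
  ring

theorem tendsto_numSmooth_mul_sq :
    Tendsto (fun lam : ℝ => (ChargeConvnet.numSmooth lam : ℝ) * lam ^ 2) (𝓝[>] 0) (𝓝 4) := by
  have h2 : Tendsto (fun lam : ℝ => 4 + lam ^ 2) (𝓝[>] 0) (𝓝 4) := by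
    have : Continuous fun lam : ℝ => 4 + lam ^ 2 := by fun_prop
    have h := (this.tendsto 0).mono_left (nhdsWithin_le_nhds (s := Set.Ioi 0))
    simpa using h
  refine tendsto_of_tendsto_of_tendsto_of_le_of_le' tendsto_const_nhds h2 ?_ ?_
  · filter_upwards [self_mem_nhdsWithin] with lam hl
    have hl : 0 < lam := hl
    exact (div_le_iff₀ (by positivity)).1 (Nat.le_ceil (4 / lam ^ 2))
  · filter_upwards [self_mem_nhdsWithin] with lam hl
    have hl : 0 < lam := hl
    have h := (Nat.ceil_lt_add_one (by positivity : 0 ≤ 4 / lam ^ 2)).le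
    calc (ChargeConvnet.numSmooth lam : ℝ) * lam ^ 2 ≤ (4 / lam ^ 2 + 1) * lam ^ 2 := by
          gcongr; exact h
      _ = 4 + lam ^ 2 := by field_simp

/-- The smoothing layers converge, on the Fourier side, to the Gaussian of variance one. -/
theorem tendsto_smoothSymbol_pow (a b : ℝ) :
    Tendsto (fun lam : ℝ => (1 / 2 + (Real.cos (a * lam) + Real.cos (b * lam)) / 4)
      ^ ChargeConvnet.numSmooth lam) (𝓝[>] 0) (𝓝 (Real.exp (-((a ^ 2 + b ^ 2) / 2)))) := by
  set g : ℝ → ℝ := fun lam => 1 / 2 + (Real.cos (a * lam) + Real.cos (b * lam)) / 4 with hg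
  have hgc : Continuous g := by rw [hg]; fun_prop
  have hg1 : Tendsto g (𝓝[>] 0) (𝓝 1) := by
    have h := (hgc.tendsto 0).mono_left (nhdsWithin_le_nhds (s := Set.Ioi 0))
    have : g 0 = 1 := by simp [hg]; norm_num
    rwa [this] at h
  have hpos : ∀ᶠ lam in 𝓝[>] 0, 0 < g lam := hg1.eventually (lt_mem_nhds zero_lt_one)
  have hquot : Tendsto (fun lam => (g lam - 1) / lam ^ 2) (𝓝[>] 0)
      (𝓝 (-((a ^ 2 + b ^ 2) / 8))) := by
    have h := ((tendsto_one_sub_cos_div a).add (tendsto_one_sub_cos_div b)).div_const 4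
    rw [show (-(a ^ 2 / 2) + -(b ^ 2 / 2)) / 4 = -((a ^ 2 + b ^ 2) / 8) by ring] at h
    refine h.congr fun lam => ?_
    simp only [hg]
    ring
  have hquot' : Tendsto (fun lam => (g lam)⁻¹ * ((g lam - 1) / lam ^ 2)) (𝓝[>] 0)
      (𝓝 (-((a ^ 2 + b ^ 2) / 8))) := by
    have h := (hg1.inv₀ one_ne_zero).mul hquot
    rwa [inv_one, one_mul] at h
  have hlog : Tendsto (fun lam => Real.log (g lam) / lam ^ 2) (𝓝[>] 0)
      (𝓝 (-((a ^ 2 + b ^ 2) / 8))) := by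
    refine tendsto_of_tendsto_of_tendsto_of_le_of_le' hquot' hquot ?_ ?_
    · filter_upwards [hpos] with lam h
      have := Real.one_sub_inv_le_log_of_pos h
      rw [← mul_div_assoc]
      gcongr
      calc (g lam)⁻¹ * (g lam - 1) = 1 - (g lam)⁻¹ := by field_simp
        _ ≤ _ := this
    · filter_upwards [hpos] with lam h
      gcongr
      exact Real.log_le_sub_one_of_pos h
  have hexp := (Real.continuous_exp.tendsto _).comp (tendsto_numSmooth_mul_sq.mul hlog)
  rw [show 4 * -((a ^ 2 + b ^ 2) / 8) = -((a ^ 2 + b ^ 2) / 2) by ring] at hexp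
  refine hexp.congr' ?_
  filter_upwards [hpos, self_mem_nhdsWithin] with lam h hl
  have hl : lam ≠ 0 := (show 0 < lam from hl).ne'
  rw [Function.comp_apply,
    show (ChargeConvnet.numSmooth lam : ℝ) * lam ^ 2 * (Real.log (g lam) / lam ^ 2)
      = ChargeConvnet.numSmooth lam * Real.log (g lam) by field_simp,
    Real.exp_nat_mul, Real.exp_log h]

theorem tendsto_symbol_linStencil (T s : ℕ) (μ : ℤ) (ξ : Plane) :
    Tendsto (fun lam : ℝ => symbol (2 * Real.pi * lam * ξ 0) (2 * Real.pi * lam * ξ 1)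
      (linStencil T s μ lam)) (𝓝[>] 0)
      (𝓝 (gaussSymbol ξ * diffCoeff (dzSymbol ξ) (dzbarSymbol ξ) T s μ)) := by
  simp only [symbol_linStencil]
  have hs : ∀ i, Tendsto (fun lam : ℝ =>
      1 / (2 * (lam : ℂ)) * (Real.sin (2 * Real.pi * lam * ξ i) : ℝ)) (𝓝[>] 0)
      (𝓝 (Real.pi * (ξ i : ℝ))) := by
    intro i
    have h := (Complex.continuous_ofReal.tendsto _).comp
      ((tendsto_sin_mul_div (2 * Real.pi * ξ i)).div_const 2)
    rw [show 2 * Real.pi * ξ i / 2 = Real.pi * ξ i by ring] at h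
    refine (h.congr fun lam => ?_).trans_eq (by push_cast; rfl)
    rw [Function.comp_apply, show 2 * Real.pi * ξ i * lam = 2 * Real.pi * lam * ξ i by ring]
    push_cast
    rw [div_div, div_mul_eq_mul_div, one_mul, mul_comm (lam : ℂ) 2]
  refine Tendsto.mul ?_ ?_
  · have h := (Complex.continuous_ofReal.tendsto _).comp
      (tendsto_smoothSymbol_pow (2 * Real.pi * ξ 0) (2 * Real.pi * ξ 1))
    rw [show -(((2 * Real.pi * ξ 0) ^ 2 + (2 * Real.pi * ξ 1) ^ 2) / 2)
      = -(2 * Real.pi ^ 2) * ‖ξ‖ ^ 2 by rw [norm_sq_plane]; ring] at h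
    refine h.congr fun lam => ?_
    rw [Function.comp_apply, Complex.ofReal_pow]
    ring_nf
  · have hx : Tendsto (fun lam : ℝ => 1 / (2 * (lam : ℂ)) * (Complex.I
        * Real.sin (2 * Real.pi * lam * ξ 0) + Real.sin (2 * Real.pi * lam * ξ 1))) (𝓝[>] 0)
        (𝓝 (dzSymbol ξ)) := by
      have h := ((hs 0).const_mul Complex.I).add (hs 1)
      rw [show Complex.I * (Real.pi * (ξ 0 : ℝ)) + Real.pi * (ξ 1 : ℝ) = dzSymbol ξ by
        rw [dzSymbol]; ring] at h
      refine h.congr fun lam => ?_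
      ring
    have hy : Tendsto (fun lam : ℝ => 1 / (2 * (lam : ℂ)) * (Complex.I
        * Real.sin (2 * Real.pi * lam * ξ 0) - Real.sin (2 * Real.pi * lam * ξ 1))) (𝓝[>] 0)
        (𝓝 (dzbarSymbol ξ)) := by
      have h := ((hs 0).const_mul Complex.I).sub (hs 1)
      rw [show Complex.I * (Real.pi * (ξ 0 : ℝ)) - Real.pi * (ξ 1 : ℝ) = dzbarSymbol ξ by
        rw [dzbarSymbol]; ring] at h
      refine h.congr fun lam => ?_
      ring
    have hc : Continuous fun z : ℂ × ℂ => diffCoeff z.1 z.2 T s μ :=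
      continuous_diffCoeff continuous_fst continuous_snd T s μ
    exact (hc.tendsto (dzSymbol ξ, dzbarSymbol ξ)).comp (hx.prodMk_nhds hy)

theorem abs_apply_le_norm (ξ : Plane) (i : Fin 2) : |ξ i| ≤ ‖ξ‖ := by
  have := PiLp.norm_apply_le ξ i
  rwa [Real.norm_eq_abs] at this

theorem continuous_symbol_plane (lam : ℝ) (p : Stencil) : Continuous fun ξ : Plane =>
    symbol (2 * Real.pi * lam * ξ 0) (2 * Real.pi * lam * ξ 1) p := by
  simp only [symbol_apply, Finsupp.sum]
  fun_prop

/-- A bound for the rescaled symbols that does not depend on the grid spacing. -/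
theorem norm_symbol_plane_le {lam : ℝ} (hl : 0 < lam) (T s : ℕ) (μ : ℤ) (ξ : Plane) :
    ‖symbol (2 * Real.pi * lam * ξ 0) (2 * Real.pi * lam * ξ 1) (linStencil T s μ lam)‖
      ≤ (1 + 4 * Real.pi) ^ T * (1 + ‖ξ‖ ^ T) := by
  refine (norm_symbol_linStencil_le hl T s μ _ _).trans ?_
  have h2 : 1 + (|2 * Real.pi * lam * ξ 0| + |2 * Real.pi * lam * ξ 1|) / lam
      ≤ (1 + 4 * Real.pi) * max 1 ‖ξ‖ := by
    have e : ∀ i, |2 * Real.pi * lam * ξ i| = 2 * Real.pi * lam * |ξ i| := fun i => by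
      rw [abs_mul, abs_of_nonneg (by positivity : 0 ≤ 2 * Real.pi * lam)]
    rw [e, e]
    have e2 : (2 * Real.pi * lam * |ξ 0| + 2 * Real.pi * lam * |ξ 1|) / lam
        = 2 * Real.pi * |ξ 0| + 2 * Real.pi * |ξ 1| := by field_simp
    have m1 : |ξ 0| ≤ max 1 ‖ξ‖ := (abs_apply_le_norm ξ 0).trans (le_max_right _ _)
    have m2 : |ξ 1| ≤ max 1 ‖ξ‖ := (abs_apply_le_norm ξ 1).trans (le_max_right _ _)
    have m3 : 1 ≤ max 1 ‖ξ‖ := le_max_left _ _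
    rw [e2]
    nlinarith [Real.pi_pos, mul_le_mul_of_nonneg_left m1 Real.pi_pos.le,
      mul_le_mul_of_nonneg_left m2 Real.pi_pos.le]
  calc _ ≤ 1 ^ _ * ((1 + 4 * Real.pi) * max 1 ‖ξ‖) ^ T := by
        gcongr
        exact abs_smoothSymbol_le_one _ _
    _ = (1 + 4 * Real.pi) ^ T * max 1 ‖ξ‖ ^ T := by rw [one_pow, one_mul, mul_pow]
    _ ≤ _ := by
        gcongr
        rcases max_choice 1 ‖ξ‖ with h | h <;> rw [h]
        · rw [one_pow]
          linarith [pow_nonneg (norm_nonneg ξ) T]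
        · linarith

theorem limFun_schwartz (T s : ℕ) (μ : ℤ) (f : 𝓢(Plane, ℂ)) :
    limFun T s μ (f.toLp 2) = ∫ ξ, (𝓕 f : 𝓢(Plane, ℂ)) ξ
      * (gaussSymbol ξ * diffCoeff (dzSymbol ξ) (dzbarSymbol ξ) T s μ * 1) := by
  rw [limFun, fourierPairing_apply, SchwartzMap.toLp_fourier_eq]
  refine integral_congr_ae ?_
  filter_upwards [(𝓕 f : 𝓢(Plane, ℂ)).coeFn_toLp 2 volume] with ξ hξ
  rw [hξ]
  ring

theorem tendsto_integral_symbol (T s : ℕ) (μ : ℤ) (φ : 𝓢(Plane, ℂ)) :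
    Tendsto (fun lam : ℝ => ∫ ξ : Plane, φ ξ * (symbol (2 * Real.pi * lam * ξ 0)
      (2 * Real.pi * lam * ξ 1) (linStencil T s μ lam) * cellChar lam ξ)) (𝓝[>] 0)
      (𝓝 (∫ ξ, φ ξ * (gaussSymbol ξ * diffCoeff (dzSymbol ξ) (dzbarSymbol ξ) T s μ * 1))) := by
  refine tendsto_integral_filter_of_dominated_convergence
    (fun ξ => (1 + 4 * Real.pi) ^ T * (‖φ ξ‖ + ‖ξ‖ ^ T * ‖φ ξ‖)) ?_ ?_ ?_ ?_
  · refine Eventually.of_forall fun lam => Continuous.aestronglyMeasurable ?_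
    exact φ.continuous.mul ((continuous_symbol_plane lam _).mul (continuous_cellChar lam))
  · filter_upwards [self_mem_nhdsWithin] with lam hl
    have hl : 0 < lam := hl
    refine ae_of_all _ fun ξ => ?_
    rw [norm_mul, norm_mul]
    calc _ ≤ ‖φ ξ‖ * ((1 + 4 * Real.pi) ^ T * (1 + ‖ξ‖ ^ T) * 1) := by
          gcongr
          · exact norm_symbol_plane_le hl T s μ ξ
          · exact norm_cellChar_le hl ξ
      _ = _ := by ring
  · exact (φ.integrable.norm.add (φ.integrable_pow_mul volume T)).const_mul _
  · exact ae_of_all _ fun ξ => ((tendsto_symbol_linStencil T s μ ξ).mul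
      (tendsto_cellChar ξ)).const_mul _

theorem tendsto_discFun_schwartz (T s : ℕ) (μ : ℤ) (f : 𝓢(Plane, ℂ)) :
    Tendsto (fun lam => discFun lam (linStencil T s μ lam) (f.toLp 2)) (𝓝[>] 0)
      (𝓝 (limFun T s μ (f.toLp 2))) := by
  rw [limFun_schwartz]
  refine Tendsto.congr' ?_ (tendsto_integral_symbol T s μ _)
  filter_upwards [self_mem_nhdsWithin] with lam hl
  exact (discFun_schwartz hl _ f).symm

/-- Pointwise convergence on a dense set extends to joint convergence, for a family of linear
functionals with a uniform bound. -/
theorem tendsto_prod_of_dense {E : Type*} [NormedAddCommGroup E] [NormedSpace ℂ E]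
    {F : ℝ → E →L[ℂ] ℂ} {G : E →L[ℂ] ℂ} {M : ℝ} (hM : 0 ≤ M)
    (hF : ∀ lam, 0 < lam → ∀ h, ‖F lam h‖ ≤ M * ‖h‖) {ι : Type*} {D : ι → E} (hD : DenseRange D)
    (hlim : ∀ i, Tendsto (fun lam => F lam (D i)) (𝓝[>] 0) (𝓝 (G (D i)))) (h₀ : E) :
    Tendsto (fun z : ℝ × E => F z.1 z.2) (𝓝[>] 0 ×ˢ 𝓝 h₀) (𝓝 (G h₀)) := by
  rw [Metric.tendsto_nhds]
  intro ε hε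
  set N := ‖G‖ with hN
  have hN0 : 0 ≤ N := norm_nonneg _
  obtain ⟨δ, hδ, hδ'⟩ : ∃ δ > 0, (2 * M + N) * δ < ε / 2 := by
    refine ⟨ε / (2 * (2 * M + N + 1)), by positivity, ?_⟩
    rw [mul_div_assoc', div_lt_div_iff₀ (by positivity) (by positivity)]
    nlinarith
  obtain ⟨i, hi⟩ := hD.exists_dist_lt h₀ hδ
  have e1 : ∀ᶠ z : ℝ × E in 𝓝[>] 0 ×ˢ 𝓝 h₀, 0 < z.1 ∧
      dist (F z.1 (D i)) (G (D i)) < ε / 2 :=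
    (((eventually_mem_nhdsWithin : ∀ᶠ lam in 𝓝[>] (0 : ℝ), lam ∈ Set.Ioi 0).and
      (Metric.tendsto_nhds.1 (hlim i) _ (half_pos hε))).prod_inl _)
  have e2 : ∀ᶠ z : ℝ × E in 𝓝[>] 0 ×ˢ 𝓝 h₀, dist z.2 h₀ < δ :=
    Eventually.prod_inr (Metric.ball_mem_nhds h₀ hδ : ∀ᶠ y in 𝓝 h₀, dist y h₀ < δ) _
  filter_upwards [e1, e2] with z ⟨hz0, hz1⟩ hz2
  have hz3 : ‖z.2 - D i‖ ≤ 2 * δ := by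
    rw [← dist_eq_norm]
    linarith [dist_triangle z.2 h₀ (D i)]
  have b1 : dist (F z.1 z.2) (F z.1 (D i)) ≤ M * (2 * δ) := by
    rw [dist_eq_norm, ← map_sub]
    refine (hF _ hz0 _).trans ?_
    gcongr
  have b2 : dist (G (D i)) (G h₀) ≤ N * δ := by
    rw [dist_eq_norm, ← map_sub]
    refine (G.le_opNorm _).trans ?_
    gcongr
    rw [← dist_eq_norm, dist_comm]
    exact hi.le
  calc _ ≤ dist (F z.1 z.2) (F z.1 (D i)) + dist (F z.1 (D i)) (G (D i))
      + dist (G (D i)) (G h₀) := dist_triangle4 _ _ _ _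
    _ < ε := by linarith

/-- As the grid spacing tends to zero, the discrete functionals converge, jointly in the grid
spacing and the signal they are applied to. -/
theorem tendsto_discFun (T s : ℕ) (μ : ℤ) (h₀ : CSignal) :
    Tendsto (fun z : ℝ × CSignal => discFun z.1 (linStencil T s μ z.1) z.2) (𝓝[>] 0 ×ˢ 𝓝 h₀)
      (𝓝 (limFun T s μ h₀)) :=
  tendsto_prod_of_dense (F := fun lam => discFun lam (linStencil T s μ lam))
    (integral_nonneg (gaussMajorant_nonneg T))
    (fun _ hl h => norm_discFun_linStencil_le hl T s μ h)
    (SchwartzMap.denseRange_toLpCLM (F := ℂ) (E := Plane) (p := 2) (μ := volume)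
      ENNReal.ofNat_ne_top) (tendsto_discFun_schwartz T s μ) h₀

/-! ### Behaviour of the Gaussian derivatives under rotations -/

/-- A rotation of the plane as a linear isometry. -/
def rotateIsometry (θ : SO2) : Plane ≃ₗᵢ[ℝ] Plane :=
  Unitary.linearIsometryEquiv ⟨rotate θ, rotate_mem_unitary θ⟩

theorem rotateIsometry_apply (θ : SO2) (x : Plane) : rotateIsometry θ x = rotate θ x := rfl

theorem coeFn_crep_rotation (θ : SO2) (h : CSignal) :
    crep (SE2.rotation θ) h =ᵐ[volume] fun x => h (rotateIsometry θ⁻¹ x) := by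
  refine (coeFn_crep _ h).trans (ae_of_all _ fun x => ?_)
  simp only [SE2.rotation_inv, SE2.rotation_smul, rotateIsometry_apply]

theorem measurePreserving_rotateIsometry (θ : SO2) :
    MeasurePreserving (rotateIsometry θ) (volume : Measure Plane) volume :=
  (rotateIsometry θ).measurePreserving

theorem continuous_crep (g : SE2) : Continuous (crep g) :=
  (Lp.isometry_compMeasurePreserving (SE2.measurePreserving_smul g⁻¹)).continuous

/-- The Fourier transform of square integrable functions commutes with rotations. -/
theorem fourier_crep_rotation (θ : SO2) (h : CSignal) :
    (𝓕 (crep (SE2.rotation θ) h) : CSignal) = crep (SE2.rotation θ) (𝓕 h : CSignal) := by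
  have hd : DenseRange fun f : 𝓢(Plane, ℂ) => (f.toLp 2 volume : CSignal) :=
    SchwartzMap.denseRange_toLpCLM (F := ℂ) (E := Plane) (p := 2) (μ := volume)
      ENNReal.ofNat_ne_top
  have hF : Continuous fun h : CSignal => (𝓕 h : CSignal) :=
    (Lp.fourierTransformₗᵢ Plane ℂ).continuous
  have rot : ∀ f : 𝓢(Plane, ℂ), crep (SE2.rotation θ) (f.toLp 2 volume)
      = (SchwartzMap.compCLMOfContinuousLinearEquiv ℂ
          (rotateIsometry θ⁻¹).toContinuousLinearEquiv f).toLp 2 volume := by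
    intro f
    refine Lp.ext ?_
    filter_upwards [coeFn_crep_rotation θ (f.toLp 2 volume),
      (measurePreserving_rotateIsometry θ⁻¹).quasiMeasurePreserving.ae (f.coeFn_toLp 2 volume),
      (SchwartzMap.compCLMOfContinuousLinearEquiv ℂ
        (rotateIsometry θ⁻¹).toContinuousLinearEquiv f).coeFn_toLp 2 volume] with x h1 h2 h3
    rw [h1, h2, h3]
    rfl
  refine congrFun (hd.equalizer (hF.comp (continuous_crep _)) ((continuous_crep _).comp hF)
    (funext fun f => ?_)) h
  simp only [Function.comp_apply]
  rw [rot, SchwartzMap.toLp_fourier_eq, SchwartzMap.toLp_fourier_eq, rot]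
  congr 1
  ext ξ
  rw [SchwartzMap.fourier_coe]
  exact Real.fourier_comp_linearIsometry (rotateIsometry θ⁻¹) f ξ

/-- The phase by which a rotation multiplies the symbol of `∂_z`. -/
def phase (θ : SO2) : ℂ :=
  (((θ : Matrix (Fin 2) (Fin 2) ℝ) 0 0 : ℝ) : ℂ)
    - Complex.I * (((θ : Matrix (Fin 2) (Fin 2) ℝ) 1 0 : ℝ) : ℂ)

theorem SO2.entries (θ : SO2) :
    (θ : Matrix (Fin 2) (Fin 2) ℝ) 0 1 = -(θ : Matrix (Fin 2) (Fin 2) ℝ) 1 0 ∧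
    (θ : Matrix (Fin 2) (Fin 2) ℝ) 1 1 = (θ : Matrix (Fin 2) (Fin 2) ℝ) 0 0 ∧
    (θ : Matrix (Fin 2) (Fin 2) ℝ) 0 0 ^ 2 + (θ : Matrix (Fin 2) (Fin 2) ℝ) 1 0 ^ 2 = 1 := by
  obtain ⟨ho, hd⟩ := Matrix.mem_specialOrthogonalGroup_iff.1 θ.2
  have hm := (Matrix.mem_orthogonalGroup_iff' (Fin 2) ℝ).1 ho
  rw [Matrix.det_fin_two] at hd
  have h00 := congrFun (congrFun hm 0) 0
  have h01 := congrFun (congrFun hm 0) 1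
  have h11 := congrFun (congrFun hm 1) 1
  simp [Matrix.mul_apply, Fin.sum_univ_two] at h00 h01 h11
  set a := (θ : Matrix (Fin 2) (Fin 2) ℝ) 0 0
  set b := (θ : Matrix (Fin 2) (Fin 2) ℝ) 0 1
  set c := (θ : Matrix (Fin 2) (Fin 2) ℝ) 1 0
  set d := (θ : Matrix (Fin 2) (Fin 2) ℝ) 1 1
  refine ⟨?_, ?_, by nlinarith⟩
  · linear_combination (-c) * hd - b * h00 + a * h01
  · linear_combination a * hd - d * h00 + c * h01

theorem phase_mul_conj (θ : SO2) :
    phase θ * ((((θ : Matrix (Fin 2) (Fin 2) ℝ) 0 0 : ℝ) : ℂ)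
      + Complex.I * (((θ : Matrix (Fin 2) (Fin 2) ℝ) 1 0 : ℝ) : ℂ)) = 1 := by
  obtain ⟨-, -, h⟩ := SO2.entries θ
  have h' : ((((θ : Matrix (Fin 2) (Fin 2) ℝ) 0 0 : ℝ) : ℂ)) ^ 2
      + (((θ : Matrix (Fin 2) (Fin 2) ℝ) 1 0 : ℝ) : ℂ) ^ 2 = 1 := by exact_mod_cast h
  rw [phase]
  linear_combination h' - (((θ : Matrix (Fin 2) (Fin 2) ℝ) 1 0 : ℝ) : ℂ) ^ 2 * Complex.I_sq

theorem phase_ne_zero (θ : SO2) : phase θ ≠ 0 := left_ne_zero_of_mul_eq_one (phase_mul_conj θ)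

theorem phase_inv (θ : SO2) :
    (phase θ)⁻¹ = (((θ : Matrix (Fin 2) (Fin 2) ℝ) 0 0 : ℝ) : ℂ)
      + Complex.I * (((θ : Matrix (Fin 2) (Fin 2) ℝ) 1 0 : ℝ) : ℂ) :=
  inv_eq_of_mul_eq_one_right (phase_mul_conj θ)

theorem rotate_apply_zero (θ : SO2) (ξ : Plane) :
    rotate θ ξ 0 = (θ : Matrix (Fin 2) (Fin 2) ℝ) 0 0 * ξ 0
      - (θ : Matrix (Fin 2) (Fin 2) ℝ) 1 0 * ξ 1 := by
  have : rotate θ ξ 0 = ((θ : Matrix (Fin 2) (Fin 2) ℝ).mulVec ξ) 0 := rfl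
  rw [this, Matrix.mulVec, dotProduct, Fin.sum_univ_two, (SO2.entries θ).1]
  ring

theorem rotate_apply_one (θ : SO2) (ξ : Plane) :
    rotate θ ξ 1 = (θ : Matrix (Fin 2) (Fin 2) ℝ) 1 0 * ξ 0
      + (θ : Matrix (Fin 2) (Fin 2) ℝ) 0 0 * ξ 1 := by
  have : rotate θ ξ 1 = ((θ : Matrix (Fin 2) (Fin 2) ℝ).mulVec ξ) 1 := rfl
  rw [this, Matrix.mulVec, dotProduct, Fin.sum_univ_two, (SO2.entries θ).2.1]

theorem dzSymbol_rotate (θ : SO2) (ξ : Plane) : dzSymbol (rotate θ ξ) = phase θ * dzSymbol ξ := by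
  rw [dzSymbol, dzSymbol, phase, rotate_apply_zero, rotate_apply_one]
  push_cast
  linear_combination (-(Real.pi : ℂ) * (((θ : Matrix (Fin 2) (Fin 2) ℝ) 1 0 : ℝ) : ℂ)
    * ((ξ 0 : ℝ) : ℂ)) * (-1 : ℂ) * Complex.I_sq

theorem dzbarSymbol_rotate (θ : SO2) (ξ : Plane) :
    dzbarSymbol (rotate θ ξ) = (phase θ)⁻¹ * dzbarSymbol ξ := by
  rw [dzbarSymbol, dzbarSymbol, phase_inv, rotate_apply_zero, rotate_apply_one]
  push_cast
  linear_combination (-(Real.pi : ℂ) * (((θ : Matrix (Fin 2) (Fin 2) ℝ) 1 0 : ℝ) : ℂ)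
    * ((ξ 0 : ℝ) : ℂ)) * Complex.I_sq

theorem gaussSymbol_rotate (θ : SO2) (ξ : Plane) : gaussSymbol (rotate θ ξ) = gaussSymbol ξ := by
  rw [gaussSymbol, gaussSymbol, ← rotateIsometry_apply, LinearIsometryEquiv.norm_map]

/-- A rotation of the signal multiplies the functional of charge `μ` by the `μ`-th power of a
phase. -/
theorem limFun_crep_rotation (T s : ℕ) (μ : ℤ) (θ : SO2) (h : CSignal) :
    limFun T s μ (crep (SE2.rotation θ) h) = phase θ ^ μ * limFun T s μ h := by
  rw [limFun, fourierPairing_apply, fourierPairing_apply, fourier_crep_rotation,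
    ← integral_const_mul, ← (measurePreserving_rotateIsometry θ).integral_comp
      (rotateIsometry θ).toHomeomorph.measurableEmbedding]
  refine integral_congr_ae ?_
  filter_upwards [(measurePreserving_rotateIsometry θ).quasiMeasurePreserving.ae
    (coeFn_crep_rotation θ (𝓕 h : CSignal))] with ξ hξ
  rw [hξ]
  simp only [rotateIsometry_apply]
  have : rotate θ⁻¹ (rotate θ ξ) = ξ := by
    rw [← mul_apply_eq_comp, ← rotate_mul, inv_mul_cancel, rotate_one]
    rfl
  rw [this, gaussSymbol_rotate, dzSymbol_rotate, dzbarSymbol_rotate,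
    diffCoeff_phase (phase_ne_zero θ)]
  ring

theorem gaussDeriv_crep_rotation (a b : ℕ) (θ : SO2) (h : CSignal) :
    gaussDeriv a b (crep (SE2.rotation θ) h) = phase θ ^ ((a : ℤ) - b) * gaussDeriv a b h := by
  obtain ⟨c, hc, hc'⟩ := exists_limFun_eq (a + b) a b le_rfl
  have hc0 : (c : ℂ) ≠ 0 := by exact_mod_cast hc.ne'
  have := limFun_crep_rotation (a + b) (a + b) ((a : ℤ) - b) θ h
  rw [hc', hc'] at this
  refine mul_left_cancel₀ hc0 ?_
  rw [this]
  ring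

/-! ### Complex conjugation on real signals -/

theorem cellAvg_comp_conj {d : ℕ} (lam : ℝ) (k : Grid) (c : Fin d) (Φ : Signal d) :
    (starRingEnd ℂ) (cellAvg lam k (comp c Φ)) = cellAvg lam k (comp c Φ) := by
  rw [← congrFun (gridComp_average lam Φ c) k]
  exact Complex.conj_ofReal _

/-- Complex conjugation of the coefficients of a stencil. -/
def conjStencil : Stencil →+* Stencil := AddMonoidAlgebra.mapRingHom Grid (starRingEnd ℂ)

theorem conjStencil_single (j : Grid) (c : ℂ) :
    conjStencil (AddMonoidAlgebra.single j c)
      = AddMonoidAlgebra.single j ((starRingEnd ℂ) c) := by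
  simp [conjStencil]

theorem conjStencil_linStencil (T s : ℕ) (μ : ℤ) (lam : ℝ) :
    conjStencil (linStencil T s μ lam) = linStencil T s (-μ) lam := by
  have c2 : (starRingEnd ℂ) 2 = 2 := map_ofNat _ 2
  have c4 : (starRingEnd ℂ) 4 = 4 := map_ofNat _ 4
  have c8 : (starRingEnd ℂ) 8 = 8 := map_ofNat _ 8
  have h1 : conjStencil smoothStencil = smoothStencil := by
    simp [smoothStencil, conjStencil_single, c2, c8]
  have h2 : conjStencil (dzStencil lam) = dzbarStencil lam := by
    simp [dzStencil, dzbarStencil, conjStencil_single, neg_div, c4]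
  have h3 : conjStencil (dzbarStencil lam) = dzStencil lam := by
    simp [dzStencil, dzbarStencil, conjStencil_single, neg_div, c4]
  rw [linStencil, linStencil, map_mul, map_pow, h1, map_diffCoeff, h2, h3, diffCoeff_swap]

theorem discFun_add (lam : ℝ) (p q : Stencil) (h : CSignal) :
    discFun lam (p + q) h = discFun lam p h + discFun lam q h := by
  rw [discFun_apply, discFun_apply, discFun_apply, AddMonoidAlgebra.coeff_add]
  exact Finsupp.sum_add_index' (fun _ => zero_mul _) fun _ _ _ => add_mul _ _ _

theorem discFun_single (lam : ℝ) (j : Grid) (c : ℂ) (h : CSignal) :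
    discFun lam (AddMonoidAlgebra.single j c) h = c * cellAvg lam j h := by
  rw [discFun_apply]
  simp

theorem discFun_conjStencil {d : ℕ} (lam : ℝ) (p : Stencil) (c : Fin d) (Φ : Signal d) :
    discFun lam (conjStencil p) (comp c Φ)
      = (starRingEnd ℂ) (discFun lam p (comp c Φ)) := by
  induction p using AddMonoidAlgebra.induction_linear with
  | zero => simp [discFun_apply]
  | add p q hp hq => rw [map_add, discFun_add, discFun_add, map_add, hp, hq]
  | single j a => rw [conjStencil_single, discFun_single, discFun_single, map_mul,
      cellAvg_comp_conj]

theorem tendsto_discFun_const (T s : ℕ) (μ : ℤ) (h : CSignal) :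
    Tendsto (fun lam => discFun lam (linStencil T s μ lam) h) (𝓝[>] 0)
      (𝓝 (limFun T s μ h)) := by
  have h1 : Tendsto (fun lam : ℝ => (lam, h)) (𝓝[>] 0) (𝓝[>] 0 ×ˢ 𝓝 h) :=
    tendsto_id.prodMk tendsto_const_nhds
  have h2 := Tendsto.comp (tendsto_discFun T s μ h) h1
  exact h2

theorem limFun_conj {d : ℕ} (T s : ℕ) (μ : ℤ) (c : Fin d) (Φ : Signal d) :
    (starRingEnd ℂ) (limFun T s μ (comp c Φ)) = limFun T s (-μ) (comp c Φ) := by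
  refine tendsto_nhds_unique
    ((Complex.continuous_conj.tendsto _).comp (tendsto_discFun_const T s μ (comp c Φ))) ?_
  refine (tendsto_discFun_const T s (-μ) (comp c Φ)).congr fun lam => ?_
  rw [Function.comp_apply, ← discFun_conjStencil, conjStencil_linStencil]

/-- On real signals, conjugation exchanges `∂_z` and `∂_z̄`. The constant is in fact `1`; a proof
through the discrete functionals gives it as a quotient of two multiplicities. -/
theorem exists_gaussDeriv_conj (a b : ℕ) : ∃ r : ℂ, ∀ (d : ℕ) (c : Fin d) (Φ : Signal d),
    (starRingEnd ℂ) (gaussDeriv a b (comp c Φ)) = r * gaussDeriv b a (comp c Φ) := by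
  obtain ⟨m, hm, hm'⟩ := exists_limFun_eq (a + b) a b le_rfl
  obtain ⟨n, hn, hn'⟩ := exists_limFun_eq (a + b) b a (by omega)
  have hm0 : (m : ℂ) ≠ 0 := by exact_mod_cast hm.ne'
  refine ⟨n / m, fun d c Φ => ?_⟩
  have h := limFun_conj (a + b) (a + b) ((a : ℤ) - b) c Φ
  rw [hm', neg_sub] at h
  nth_rw 2 [add_comm a b] at h
  rw [hn', map_mul, map_natCast] at h
  rw [div_mul_eq_mul_div, ← h]
  field_simp

/-! ### The Gaussian derivatives separate signals -/

theorem integrable_mul_of_memLp {m : Plane → ℂ} (hm : MemLp m 2 volume) (h : CSignal) :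
    Integrable (fun ξ => m ξ * h ξ) volume :=
  hm.integrable_mul (Lp.memLp h)

/-- An integrable function whose Fourier transform vanishes is zero almost everywhere. -/
theorem ae_eq_zero_of_fourier_eq_zero {ψ : Plane → ℂ} (hψ : Integrable ψ volume)
    (h0 : ∀ v : Plane, 𝓕 ψ v = 0) : ∀ᵐ ξ, ψ ξ = 0 := by
  have key : ∀ k : 𝓢(Plane, ℂ), ∫ ξ, k ξ * ψ ξ = 0 := by
    intro k
    have h1 : k = 𝓕 (𝓕⁻ k : 𝓢(Plane, ℂ)) := (FourierTransform.fourier_fourierInv_eq k).symm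
    rw [h1, SchwartzMap.fourier_coe]
    have h2 := VectorFourier.integral_fourierIntegral_smul_eq_flip (L := innerₗ Plane)
      (μ := volume) (ν := volume) Real.continuous_fourierChar
      (by exact continuous_inner) ((𝓕⁻ k : 𝓢(Plane, ℂ)).integrable) hψ
    have h3 : ∀ v, VectorFourier.fourierIntegral Real.fourierChar volume (innerₗ Plane).flip ψ v
        = 0 := by
      intro v
      rw [flip_innerₗ]
      exact h0 v
    simp only [h3, smul_eq_mul, mul_zero, integral_zero] at h2
    exact h2
  refine ae_eq_zero_of_integral_contDiff_smul_eq_zero hψ.locallyIntegrable fun g hg hgs => ?_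
  have hgs' : HasCompactSupport fun x => (g x : ℂ) := hgs.comp_left (g := fun t : ℝ => (t : ℂ)) rfl
  have hg' : ContDiff ℝ ((⊤ : ℕ∞) : WithTop ℕ∞) fun x => (g x : ℂ) :=
    Complex.ofRealCLM.contDiff.comp hg
  have := key (hgs'.toSchwartzMap hg')
  simpa [Complex.real_smul] using this

/-- The exponent of a character, as a combination of the symbols of `∂_z` and `∂_z̄`. -/
theorem char_exponent_eq (v ξ : Plane) :
    (((-2 * Real.pi * inner ℝ ξ v : ℝ)) : ℂ) * Complex.I
      = -((v 0 : ℝ) + Complex.I * (v 1 : ℝ)) * dzSymbol ξ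
        + -((v 0 : ℝ) - Complex.I * (v 1 : ℝ)) * dzbarSymbol ξ := by
  rw [dzSymbol, dzbarSymbol]
  simp only [PiLp.inner_apply, Fin.sum_univ_two]
  simp
  ring

/-- Polynomials times the Gaussian are total in `L²`: a signal all of whose Gaussian derivatives
at the origin vanish is zero. -/
theorem eq_zero_of_gaussDeriv_eq_zero (h : CSignal) (h0 : ∀ a b, gaussDeriv a b h = 0) :
    h = 0 := by
  set ψ : CSignal := 𝓕 h with hψ
  have hq : ∀ a b : ℕ,
      Integrable (fun ξ => gaussSymbol ξ * (dzSymbol ξ ^ a * dzbarSymbol ξ ^ b) * ψ ξ) volume :=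
    fun a b => integrable_mul_of_memLp (memLp_gaussSymbol_mul_pow a b) ψ
  have hq0 : ∀ a b : ℕ,
      ∫ ξ, gaussSymbol ξ * (dzSymbol ξ ^ a * dzbarSymbol ξ ^ b) * ψ ξ = 0 := by
    intro a b
    rw [← h0 a b, gaussDeriv, fourierPairing_apply]
  have hint : Integrable (fun ξ => gaussSymbol ξ * ψ ξ) volume := by
    simpa using hq 0 0
  -- powers of a linear combination of the two symbols are handled by the binomial theorem
  have hpow : ∀ (α β : ℂ) (n : ℕ),
      ∫ ξ, gaussSymbol ξ * (α * dzSymbol ξ + β * dzbarSymbol ξ) ^ n * ψ ξ = 0 := by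
    intro α β n
    have e : ∀ ξ, gaussSymbol ξ * (α * dzSymbol ξ + β * dzbarSymbol ξ) ^ n * ψ ξ
        = ∑ m ∈ Finset.range (n + 1), (α ^ m * β ^ (n - m) * (n.choose m : ℂ))
          * (gaussSymbol ξ * (dzSymbol ξ ^ m * dzbarSymbol ξ ^ (n - m)) * ψ ξ) := by
      intro ξ
      rw [add_pow, Finset.mul_sum, Finset.sum_mul]
      refine Finset.sum_congr rfl fun m _ => ?_
      rw [mul_pow, mul_pow]
      ring
    simp only [e]
    rw [integral_finsetSum _ fun m _ => (hq m (n - m)).const_mul _]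
    refine Finset.sum_eq_zero fun m _ => ?_
    rw [integral_const_mul, hq0, mul_zero]
  have hzero : ∀ᵐ ξ, gaussSymbol ξ * ψ ξ = 0 := by
    refine ae_eq_zero_of_fourier_eq_zero hint fun v => ?_
    -- expand the character into its exponential series and integrate term by term; the exponential
    -- majorant is absorbed by the Gaussian
    set α : ℂ := -((v 0 : ℝ) + Complex.I * (v 1 : ℝ)) with hα
    set β : ℂ := -((v 0 : ℝ) - Complex.I * (v 1 : ℝ)) with hβ
    set c : ℝ := (‖α‖ + ‖β‖) * Real.pi with hc
    have hlin : ∀ ξ, ‖α * dzSymbol ξ + β * dzbarSymbol ξ‖ ≤ c * ‖ξ‖ := by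
      intro ξ
      refine (norm_add_le _ _).trans_eq ?_
      rw [norm_mul, norm_mul, norm_dzSymbol, norm_dzbarSymbol, hc]
      ring
    rw [Real.fourier_eq']
    have hs := hasSum_integral_of_dominated_convergence (μ := (volume : Measure Plane))
      (F := fun (n : ℕ) ξ => ((n.factorial : ℂ)⁻¹)
        * (gaussSymbol ξ * (α * dzSymbol ξ + β * dzbarSymbol ξ) ^ n * ψ ξ))
      (f := fun ξ => Complex.exp (α * dzSymbol ξ + β * dzbarSymbol ξ) * (gaussSymbol ξ * ψ ξ))
      (fun n ξ => ((c * ‖ξ‖) ^ n / n.factorial) * ‖gaussSymbol ξ * ψ ξ‖)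
      (fun n => ?_) (fun n => ae_of_all _ fun ξ => ?_) (ae_of_all _ fun ξ => ?_) ?_
      (ae_of_all _ fun ξ => ?_)
    · simp only [integral_const_mul, hpow, mul_zero] at hs
      have := hs.unique hasSum_zero
      rw [← this]
      refine integral_congr_ae (ae_of_all _ fun ξ => ?_)
      simp only [smul_eq_mul]
      rw [char_exponent_eq]
    · refine ((continuous_gaussSymbol.mul (((continuous_const.mul continuous_dzSymbol).add
        (continuous_const.mul continuous_dzbarSymbol)).pow n)).aestronglyMeasurable.mul
        (Lp.aestronglyMeasurable ψ)).const_mul _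
    · rw [norm_mul, norm_mul, norm_mul, norm_mul, norm_pow, norm_inv, Complex.norm_natCast,
        div_eq_inv_mul]
      calc _ = (n.factorial : ℝ)⁻¹ * ‖α * dzSymbol ξ + β * dzbarSymbol ξ‖ ^ n
            * (‖gaussSymbol ξ‖ * ‖ψ ξ‖) := by ring
        _ ≤ _ := by
            gcongr
            exact hlin ξ
    · exact (Real.summable_pow_div_factorial _).mul_right _
    · have e : ∀ ξ : Plane, ∑' n : ℕ, ((c * ‖ξ‖) ^ n / n.factorial) * ‖gaussSymbol ξ * ψ ξ‖
          = ‖gaussSymbol ξ * (Real.exp (c * ‖ξ‖) : ℝ) * ψ ξ‖ := by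
        intro ξ
        rw [tsum_mul_right, (NormedSpace.expSeries_div_hasSum_exp (c * ‖ξ‖)).tsum_eq,
          ← Real.exp_eq_exp_ℝ, norm_mul, norm_mul, norm_mul, Complex.norm_real,
          Real.norm_of_nonneg (Real.exp_nonneg _)]
        ring
      simp only [e]
      refine (integrable_mul_of_memLp (memLp_gaussSymbol_mul (C := 1) (c := c) (by fun_prop)
        fun ξ => ?_) ψ).norm
      rw [Complex.norm_real, Real.norm_of_nonneg (Real.exp_nonneg _), one_mul]
    · have h1 := NormedSpace.expSeries_div_hasSum_exp (α * dzSymbol ξ + β * dzbarSymbol ξ)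
      rw [← Complex.exp_eq_exp_ℂ] at h1
      refine (h1.mul_right (gaussSymbol ξ * ψ ξ)).congr_fun fun n => ?_
      ring
  have hψ0 : ψ = 0 := by
    refine Lp.ext ?_
    filter_upwards [hzero, Lp.coeFn_zero ℂ 2 (volume : Measure Plane)] with ξ h1 h2
    rw [h2]
    refine (mul_eq_zero.1 h1).resolve_left ?_
    exact norm_ne_zero_iff.1 (norm_gaussSymbol ξ ▸ (Real.exp_pos _).ne')
  have : ‖h‖ = 0 := by rw [← Lp.norm_fourier_eq, ← hψ, hψ0, norm_zero]
  exact norm_eq_zero.1 this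

/-! ### The action of rigid motions on signals -/

theorem rep_mul {d : ℕ} (g₁ g₂ : SE2) (Φ : Signal d) : rep (g₁ * g₂) Φ = rep g₁ (rep g₂ Φ) := by
  refine Lp.ext ?_
  filter_upwards [coeFn_rep (g₁ * g₂) Φ, coeFn_rep g₁ (rep g₂ Φ),
    (SE2.measurePreserving_smul g₁⁻¹).quasiMeasurePreserving.ae (coeFn_rep g₂ Φ)] with x h1 h2 h3
  rw [h1, h2, h3, mul_inv_rev, mul_smul]

theorem norm_rep {d : ℕ} (g : SE2) (Φ : Signal d) : ‖rep g Φ‖ = ‖Φ‖ :=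
  Lp.norm_compMeasurePreserving _ _

theorem rep_sub {d : ℕ} (g : SE2) (Φ Ψ : Signal d) : rep g (Φ - Ψ) = rep g Φ - rep g Ψ :=
  map_sub (Lp.compMeasurePreserving (fun x : Plane => g⁻¹ • x)
    (SE2.measurePreserving_smul g⁻¹)) Φ Ψ

/-- The representation of rigid motions on signals is strongly continuous. -/
theorem continuous_rep_of_continuous {d : ℕ} {Z : Type*} [TopologicalSpace Z] {γ : Z → SE2}
    (hγ : Continuous fun p : Z × Plane => (γ p.1)⁻¹ • p.2) {Φ : Z → Signal d} (hΦ : Continuous Φ) :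
    Continuous fun z => rep (γ z) (Φ z) := by
  have hg : ∀ z, Continuous fun x : Plane => (γ z)⁻¹ • x := by
    intro z
    have h1 : Continuous fun x : Plane => (z, x) := Continuous.prodMk_right z
    have h2 := Continuous.comp hγ h1
    exact h2
  let gC : Z → C(Plane, Plane) := fun z => ⟨fun x => (γ z)⁻¹ • x, hg z⟩
  have hgC : Continuous gC := by
    refine ContinuousMap.continuous_of_continuous_uncurry gC ?_
    exact hγ
  have hmp : ∀ z, MeasurePreserving (gC z) (volume : Measure Plane) volume :=
    fun z => SE2.measurePreserving_smul (γ z)⁻¹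
  exact Continuous.compMeasurePreservingLp hΦ hgC hmp (by norm_num)

/-- The signal translated so that the point `x` is moved to the origin. -/
def recenter {d : ℕ} (x : Plane) (Φ : Signal d) : Signal d := rep (SE2.translation x)⁻¹ Φ

theorem coeFn_recenter {d : ℕ} (x : Plane) (Φ : Signal d) :
    recenter x Φ =ᵐ[volume] fun y => Φ (x + y) := by
  refine (coeFn_rep _ Φ).trans (ae_of_all _ fun y => ?_)
  simp only [inv_inv, SE2.translation_smul]

theorem continuous_recenter {d : ℕ} {Z : Type*} [TopologicalSpace Z] {x : Z → Plane}
    (hx : Continuous x) {Φ : Z → Signal d} (hΦ : Continuous Φ) :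
    Continuous fun z => recenter (x z) (Φ z) := by
  refine continuous_rep_of_continuous ?_ hΦ
  simp only [inv_inv, SE2.translation_smul]
  fun_prop

/-- Recentering a moved signal is, up to a rotation, recentering the signal at the preimage. -/
theorem recenter_rep {d : ℕ} (g : SE2) (x : Plane) (Φ : Signal d) :
    recenter x (rep g Φ) = rep (SE2.rotation g.rot) (recenter (g⁻¹ • x) Φ) := by
  rw [recenter, recenter, ← rep_mul, ← rep_mul]
  congr 1
  rw [inv_mul_eq_iff_eq_mul, ← mul_assoc, eq_mul_inv_iff_mul_eq]
  ext1
  · have h1 : (g * SE2.translation (g⁻¹ • x)).trans = g • (g⁻¹ • x) := by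
      rw [SE2.mul_trans, SE2.smul_def]
      rfl
    rw [h1, smul_inv_smul, SE2.mul_trans]
    simp [SE2.translation, SE2.rotation]
  · simp [SE2.mul_rot, SE2.translation, SE2.rotation]

/-! ### The multiplication layers -/

/-- Charge conservation: if the input of charge `μ` is multiplied by `c ^ μ`, so is the output. -/
theorem multStep_phase {T : ℕ} {ι κ : Type} [Fintype ι] (w : MultWeights T ι κ) {c : ℂ}
    (hc : c ≠ 0) {Φ Ψ : Charge T → ι → ℂ} (h : ∀ μ n, Ψ μ n = c ^ (μ : ℤ) * Φ μ n)
    (μ : Charge T) (n : κ) : multStep w Ψ μ n = c ^ (μ : ℤ) * multStep w Φ μ n := by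
  simp only [multStep, h, mul_add, Finset.mul_sum]
  congr 1
  · congr 1
    · split_ifs with h0
      · simp [h0]
      · simp
    · refine Finset.sum_congr rfl fun n₁ _ => ?_
      ring
  · refine Finset.sum_congr rfl fun p hp => Finset.sum_congr rfl fun n₁ _ =>
      Finset.sum_congr rfl fun n₂ _ => ?_
    rw [← (Finset.mem_filter.1 hp).2, zpow_add₀ hc]
    ring

theorem continuous_multStep {T : ℕ} {ι κ : Type} [Fintype ι] (w : MultWeights T ι κ) :
    Continuous fun Φ : Charge T → ι → ℂ => multStep w Φ := by
  refine continuous_pi fun μ => continuous_pi fun n => ?_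
  simp only [multStep]
  fun_prop

namespace ChargeConvnet

variable {dV dU : ℕ} (N : ChargeConvnet dV dU)

theorem hiddenOutput_phase {c : ℂ} (hc : c ≠ 0)
    {Φ Ψ : Charge N.Tdiff → Fin (N.Tdiff + 1) × Fin dV → ℂ}
    (h : ∀ μ n, Ψ μ n = c ^ (μ : ℤ) * Φ μ n) (t : ℕ) (μ : Charge N.Tdiff)
    (n : Feature dV N.Tdiff N.dMult t) :
    N.hiddenOutput Ψ t μ n = c ^ (μ : ℤ) * N.hiddenOutput Φ t μ n := by
  induction t generalizing μ with
  | zero => exact h μ n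
  | succ t ih => exact multStep_phase _ hc ih μ n

theorem multPart_phase {c : ℂ} (hc : c ≠ 0)
    {Φ Ψ : Charge N.Tdiff → Fin (N.Tdiff + 1) × Fin dV → ℂ}
    (h : ∀ μ n, Ψ μ n = c ^ (μ : ℤ) * Φ μ n) : N.multPart Ψ = N.multPart Φ := by
  rw [multPart, multPart]
  congr 1
  funext n
  rw [multStep_phase N.final hc (N.hiddenOutput_phase hc h _)]
  simp [Charge.zero]

theorem continuous_hiddenOutput (t : ℕ) : Continuous fun Φ => N.hiddenOutput Φ t := by
  induction t with
  | zero => exact continuous_id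
  | succ t ih => exact (continuous_multStep (N.hidden t)).comp ih

theorem continuous_multPart : Continuous N.multPart := by
  refine (PiLp.continuous_toLp 2 _).comp (continuous_pi fun n => Complex.continuous_re.comp ?_)
  have h := (continuous_multStep N.final).comp (N.continuous_hiddenOutput (N.Tmult - 1))
  exact (continuous_apply n).comp ((continuous_apply (Charge.zero N.Tdiff)).comp h)

/-! ### The continuum limit of a convnet -/

/-- The value at the origin of the output of a convnet with grid spacing `lam`. -/
def discValue (lam : ℝ) (Φ : Signal dV) : EuclideanSpace ℝ (Fin dU) :=
  N.multPart fun μ sn => discFun lam (linStencil N.Tdiff sn.1 μ lam) (comp sn.2 Φ)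

/-- The value at the origin of the output of a convnet in the limit of vanishing grid spacing. -/
def limValue (Φ : Signal dV) : EuclideanSpace ℝ (Fin dU) :=
  N.multPart fun μ sn => limFun N.Tdiff sn.1 μ (comp sn.2 Φ)

/-- The outputs have charge zero, hence they do not change under rotations about the origin. -/
theorem limValue_rotation (θ : SO2) (Φ : Signal dV) :
    N.limValue (rep (SE2.rotation θ) Φ) = N.limValue Φ := by
  refine N.multPart_phase (phase_ne_zero θ) fun μ n => ?_
  rw [comp_rep, limFun_crep_rotation]

theorem limValue_recenter_rep (g : SE2) (x : Plane) (Φ : Signal dV) :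
    N.limValue (recenter x (rep g Φ)) = N.limValue (recenter (g⁻¹ • x) Φ) := by
  rw [recenter_rep, limValue_rotation]

theorem continuous_limValue : Continuous N.limValue := by
  refine N.continuous_multPart.comp (continuous_pi fun μ => continuous_pi fun sn => ?_)
  exact (limFun N.Tdiff sn.1 μ).continuous.comp (comp sn.2).continuous

/-- The convergence of the outputs at the origin, jointly in the grid spacing and the signal. -/
theorem tendsto_discValue (Φ₀ : Signal dV) :
    Tendsto (fun z : ℝ × Signal dV => N.discValue z.1 z.2) (𝓝[>] 0 ×ˢ 𝓝 Φ₀)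
      (𝓝 (N.limValue Φ₀)) := by
  refine (N.continuous_multPart.tendsto _).comp
    (tendsto_pi_nhds.2 fun μ => tendsto_pi_nhds.2 fun sn => ?_)
  have h1 : Tendsto (fun z : ℝ × Signal dV => (z.1, comp sn.2 z.2)) (𝓝[>] 0 ×ˢ 𝓝 Φ₀)
      (𝓝[>] 0 ×ˢ 𝓝 (comp sn.2 Φ₀)) :=
    tendsto_fst.prodMk (((comp sn.2).continuous.tendsto Φ₀).comp tendsto_snd)
  have h2 := Tendsto.comp (tendsto_discFun N.Tdiff sn.1 μ (comp sn.2 Φ₀)) h1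
  exact h2

end ChargeConvnet

/-! ### The output of a convnet as a function on the plane -/

theorem coeFn_toSignal {d : ℕ} {lam : ℝ} (hl : 0 < lam) (L : ℕ)
    (Ψ : Grid → EuclideanSpace ℝ (Fin d)) :
    toSignal lam L Ψ =ᵐ[volume] fun x => cutoff L Ψ (cellIndex lam x) := by
  have h1 : ∀ s : Finset Grid, (∑ k ∈ s, indicatorConstLp 2 (measurableSet_cell lam k)
      (volume_cell_ne_top lam k) (Ψ k) : Signal d) =ᵐ[volume]
      fun x => if cellIndex lam x ∈ s then Ψ (cellIndex lam x) else 0 := by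
    intro s
    induction s using Finset.induction_on with
    | empty =>
      simp only [Finset.sum_empty, Finset.notMem_empty, if_false]
      exact Lp.coeFn_zero _ _ _
    | insert k s hk ih =>
      rw [Finset.sum_insert hk]
      refine (Lp.coeFn_add _ _).trans ?_
      filter_upwards [ih, indicatorConstLp_coeFn (p := 2) (hs := measurableSet_cell lam k)
        (hμs := volume_cell_ne_top lam k) (c := Ψ k)] with x hx1 hx2
      rw [Pi.add_apply, hx1, hx2]
      by_cases hxk : cellIndex lam x = k
      · rw [Set.indicator_of_mem ((mem_cell_iff hl k x).2 hxk), hxk, if_neg hk,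
          if_pos (Finset.mem_insert_self k s), add_zero]
      · rw [Set.indicator_of_notMem (fun h => hxk ((mem_cell_iff hl k x).1 h)), zero_add]
        simp [Finset.mem_insert, hxk]
  exact h1 (box L)

theorem ChargeConvnet.coeFn_toMap {dV dU : ℕ} (N : ChargeConvnet dV dU) {lam : ℝ} (hl : 0 < lam)
    (Φ : Signal dV) : N.toMap lam Φ =ᵐ[volume] fun x =>
      if cellIndex lam x ∈ box (N.radius lam) then
        N.discValue lam (recenter (gridPoint lam (cellIndex lam x)) Φ) else 0 := by
  refine (coeFn_toSignal hl _ _).trans (ae_of_all _ fun x => ?_)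
  simp only [cutoff]
  split_ifs with h
  · rw [discValue]
    congr 1
    funext μ sn
    rw [N.linearPart_eq_discFun hl Φ _ _ _ h]
    rfl
  · rfl

theorem norm_sub_gridPoint_cellIndex_le {lam : ℝ} (hl : 0 < lam) (x : Plane) :
    ‖gridPoint lam (cellIndex lam x) - x‖ ≤ lam := by
  rw [norm_sub_rev]
  refine norm_cell_zero_le hl ?_
  rw [← add_gridPoint_mem_cell (cellIndex lam x) 0, zero_add, add_sub_cancel, mem_cell_iff hl]

theorem norm_le_of_cellIndex_mem {lam Lam : ℝ} (hl : 0 < lam) (hL : 0 ≤ Lam) {x : Plane}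
    (hx : cellIndex lam x ∈ box ⌊Lam / lam⌋₊) : ‖x‖ ≤ 2 * Lam + lam := by
  set k := cellIndex lam x with hk
  have hfl : (⌊Lam / lam⌋₊ : ℝ) ≤ Lam / lam := Nat.floor_le (by positivity)
  have bound : ∀ n : ℤ, -(⌊Lam / lam⌋₊ : ℤ) ≤ n → n ≤ (⌊Lam / lam⌋₊ : ℤ) →
      (lam * n) ^ 2 ≤ Lam ^ 2 := by
    intro n h1 h2
    have h1' : -(⌊Lam / lam⌋₊ : ℝ) ≤ n := by exact_mod_cast h1
    have h2' : (n : ℝ) ≤ ⌊Lam / lam⌋₊ := by exact_mod_cast h2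
    have h3 : |(n : ℝ)| ≤ Lam / lam := abs_le.2 ⟨by linarith, by linarith⟩
    rw [le_div_iff₀ hl] at h3
    rw [sq_le_sq, abs_mul, abs_of_pos hl, abs_of_nonneg hL]
    linarith
  obtain ⟨⟨h1, h2⟩, h3, h4⟩ := mem_box.1 hx
  have hg : ‖gridPoint lam k‖ ≤ 2 * Lam := by
    rw [← sq_le_sq₀ (norm_nonneg _) (by positivity), norm_sq_plane, gridPoint_apply_zero,
      gridPoint_apply_one]
    nlinarith [bound k.1 h1 h2, bound k.2 h3 h4]
  have := norm_sub_gridPoint_cellIndex_le hl x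
  have h5 : ‖x‖ ≤ ‖gridPoint lam k‖ + ‖gridPoint lam k - x‖ := by
    calc ‖x‖ = ‖gridPoint lam k - (gridPoint lam k - x)‖ := by rw [sub_sub_cancel]
      _ ≤ _ := norm_sub_le _ _
  linarith

theorem le_norm_of_cellIndex_notMem {lam Lam : ℝ} (hl : 0 < lam) {x : Plane}
    (hx : cellIndex lam x ∉ box ⌊Lam / lam⌋₊) : Lam - lam ≤ ‖x‖ := by
  set k := cellIndex lam x with hk
  have hfl : Lam / lam < (⌊Lam / lam⌋₊ : ℝ) + 1 := Nat.lt_floor_add_one _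
  have bound : ∀ n : ℤ, ¬ (-(⌊Lam / lam⌋₊ : ℤ) ≤ n ∧ n ≤ (⌊Lam / lam⌋₊ : ℤ)) →
      Lam ≤ |lam * n| := by
    intro n h
    have h1 : (⌊Lam / lam⌋₊ : ℤ) + 1 ≤ |n| := by
      rcases not_and_or.1 h with h | h
      · exact le_trans (by omega) (neg_le_abs n)
      · exact le_trans (by omega) (le_abs_self n)
    have h2 : (⌊Lam / lam⌋₊ : ℝ) + 1 ≤ |(n : ℝ)| := by exact_mod_cast h1
    have h3 : Lam / lam ≤ |(n : ℝ)| := by linarith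
    rw [div_le_iff₀ hl] at h3
    rw [abs_mul, abs_of_pos hl]
    linarith
  have hg : Lam ≤ ‖gridPoint lam k‖ := by
    rw [mem_box, not_and_or] at hx
    rcases hx with h | h
    · exact (bound k.1 h).trans (abs_apply_le_norm (gridPoint lam k) 0)
    · exact (bound k.2 h).trans (abs_apply_le_norm (gridPoint lam k) 1)
  have := norm_sub_gridPoint_cellIndex_le hl x
  have h5 : ‖gridPoint lam k‖ ≤ ‖x‖ + ‖gridPoint lam k - x‖ := by
    calc ‖gridPoint lam k‖ = ‖x + (gridPoint lam k - x)‖ := by rw [add_sub_cancel]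
      _ ≤ _ := norm_add_le _ _
  linarith

/-! ### Convergence of the outputs -/

/-- Joint convergence in the grid spacing, the point and the signal, when the point is moved by an
offset proportional to the grid spacing; the offset `z.2.1` will be that of the nearest grid
point. -/
theorem ChargeConvnet.tendsto_discValue_recenter {dV dU : ℕ} (N : ChargeConvnet dV dU)
    (q₀ : Plane × Plane × Signal dV) :
    Tendsto (fun z : ℝ × (Plane × Plane × Signal dV) =>
      dist (N.discValue z.1 (recenter (z.2.2.1 + z.1 • z.2.1) z.2.2.2))
        (N.limValue (recenter z.2.2.1 z.2.2.2))) (𝓝[>] 0 ×ˢ 𝓝 q₀) (𝓝 0) := by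
  have hc1 : Continuous fun z : ℝ × (Plane × Plane × Signal dV) =>
      recenter (z.2.2.1 + z.1 • z.2.1) z.2.2.2 := continuous_recenter (by fun_prop) (by fun_prop)
  have hc2 : Continuous fun q : Plane × Plane × Signal dV => recenter q.2.1 q.2.2 :=
    continuous_recenter (by fun_prop) (by fun_prop)
  have hle : 𝓝[>] (0 : ℝ) ×ˢ 𝓝 q₀ ≤ 𝓝 ((0 : ℝ), q₀) := by
    rw [nhds_prod_eq (x := (0 : ℝ)) (y := q₀)]
    exact Filter.prod_mono (nhdsWithin_le_nhds (s := Set.Ioi (0 : ℝ))) le_rfl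
  have t1 : Tendsto (fun z : ℝ × (Plane × Plane × Signal dV) =>
      recenter (z.2.2.1 + z.1 • z.2.1) z.2.2.2) (𝓝[>] 0 ×ˢ 𝓝 q₀) (𝓝 (recenter q₀.2.1 q₀.2.2)) := by
    have h := (hc1.tendsto ((0 : ℝ), q₀)).mono_left hle
    simpa only [zero_smul, add_zero] using h
  have t2 : Tendsto (fun z : ℝ × (Plane × Plane × Signal dV) =>
      N.discValue z.1 (recenter (z.2.2.1 + z.1 • z.2.1) z.2.2.2)) (𝓝[>] 0 ×ˢ 𝓝 q₀)
      (𝓝 (N.limValue (recenter q₀.2.1 q₀.2.2))) := by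
    have h1 : Tendsto (fun z : ℝ × (Plane × Plane × Signal dV) =>
        (z.1, recenter (z.2.2.1 + z.1 • z.2.1) z.2.2.2)) (𝓝[>] 0 ×ˢ 𝓝 q₀)
        (𝓝[>] 0 ×ˢ 𝓝 (recenter q₀.2.1 q₀.2.2)) := tendsto_fst.prodMk t1
    have h2 := Tendsto.comp (N.tendsto_discValue (recenter q₀.2.1 q₀.2.2)) h1
    exact h2
  have t3 : Tendsto (fun z : ℝ × (Plane × Plane × Signal dV) =>
      N.limValue (recenter z.2.2.1 z.2.2.2)) (𝓝[>] 0 ×ˢ 𝓝 q₀)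
      (𝓝 (N.limValue (recenter q₀.2.1 q₀.2.2))) := by
    have h1 := (N.continuous_limValue.comp hc2).tendsto q₀
    have h2 : Tendsto Prod.snd (𝓝[>] (0 : ℝ) ×ˢ 𝓝 q₀) (𝓝 q₀) := tendsto_snd
    have h3 := Tendsto.comp h1 h2
    exact h3
  have h := t2.dist t3
  rwa [dist_self] at h

/-- For small grid spacings the output of a convnet is, on its output range and uniformly on
compact sets of signals, close to the translation equivariant map defined by `limValue`. -/
theorem ChargeConvnet.exists_toMap_close {dV dU : ℕ} (N : ChargeConvnet dV dU)
    {K : Set (Signal dV)} (hK : IsCompact K) {δ : ℝ} (hδ : 0 < δ) :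
    ∃ lam₀ : ℝ, 0 < lam₀ ∧ ∀ lam : ℝ, 0 < lam → lam ≤ lam₀ → ∀ Φ ∈ K, ∀ᵐ x,
      (cellIndex lam x ∈ box (N.radius lam) →
        ‖N.toMap lam Φ x - N.limValue (recenter x Φ)‖ ≤ δ) ∧
      (cellIndex lam x ∉ box (N.radius lam) → N.toMap lam Φ x = 0) := by
  set R := 2 * N.Lam + 1 with hR
  have hcomp : IsCompact
      (Metric.closedBall (0 : Plane) 1 ×ˢ (Metric.closedBall (0 : Plane) R ×ˢ K)) :=
    (isCompact_closedBall _ _).prod ((isCompact_closedBall _ _).prod hK)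
  have hev := hcomp.eventually_forall_of_forall_eventually (x₀ := (0 : ℝ))
    (P := fun lam q => 0 < lam → dist (N.discValue lam (recenter (q.2.1 + lam • q.1) q.2.2))
        (N.limValue (recenter q.2.1 q.2.2)) < δ) (fun q₀ _ => ?_)
  · obtain ⟨r, hr, hr'⟩ := Metric.eventually_nhds_iff.1 hev
    refine ⟨min 1 (r / 2), by positivity, fun lam hl hlr Φ hΦ => ?_⟩
    have hl1 : lam ≤ 1 := hlr.trans (min_le_left _ _)
    have hlr' : dist lam 0 < r := by
      rw [Real.dist_eq, sub_zero, abs_of_pos hl]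
      linarith [hlr.trans (min_le_right _ _)]
    filter_upwards [N.coeFn_toMap hl Φ] with x hx
    refine ⟨fun hmem => ?_, fun hmem => by rw [hx, if_neg hmem]⟩
    rw [hx, if_pos hmem, ← dist_eq_norm]
    -- the offset of the grid point in units of `lam`, which stays in the compact unit ball
    set w : Plane := lam⁻¹ • (gridPoint lam (cellIndex lam x) - x) with hw
    have hgp : gridPoint lam (cellIndex lam x) = x + lam • w := by
      rw [hw, smul_inv_smul₀ hl.ne', add_sub_cancel]
    have hwn : ‖w‖ ≤ 1 := by
      rw [hw, norm_smul, norm_inv, Real.norm_of_nonneg hl.le, inv_mul_le_iff₀ hl, mul_one]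
      exact norm_sub_gridPoint_cellIndex_le hl x
    have hxn : ‖x‖ ≤ R := by
      have := norm_le_of_cellIndex_mem hl N.Lam_nonneg hmem
      rw [hR]
      linarith
    have := hr' hlr' (w, x, Φ)
      ⟨by simpa using hwn, by simpa using hxn, hΦ⟩ hl
    rw [hgp]
    exact this.le
  · have h := (N.tendsto_discValue_recenter q₀).eventually (gt_mem_nhds hδ)
    have hfil : 𝓝[>] (0 : ℝ) ×ˢ 𝓝 q₀ = 𝓝[Set.Ioi (0 : ℝ) ×ˢ Set.univ] ((0 : ℝ), q₀) := by
      rw [nhdsWithin_prod_eq, nhdsWithin_univ]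
    rw [hfil, eventually_nhdsWithin_iff] at h
    filter_upwards [h] with z hz hz0
    exact hz ⟨hz0, Set.mem_univ _⟩

/-! ### Limit points are continuous and equivariant -/

theorem continuous_indicatorConstLp_const {d : ℕ} (lam : ℝ) (k : Grid) :
    Continuous fun c : EuclideanSpace ℝ (Fin d) =>
      (indicatorConstLp 2 (measurableSet_cell lam k) (volume_cell_ne_top lam k) c : Signal d) := by
  have h : LipschitzWith (volume.real (cell lam k) ^ (1 / (2 : ENNReal).toReal)).toNNReal
      fun c : EuclideanSpace ℝ (Fin d) =>
      (indicatorConstLp 2 (measurableSet_cell lam k) (volume_cell_ne_top lam k) c : Signal d) := by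
    refine LipschitzWith.of_dist_le_mul fun a b => ?_
    rw [dist_eq_norm, dist_eq_norm, indicatorConstLp_sub, norm_indicatorConstLp (by norm_num)
      (by norm_num), Real.coe_toNNReal _ (by positivity), mul_comm]
  exact h.continuous

theorem ChargeConvnet.continuous_toMap {dV dU : ℕ} (N : ChargeConvnet dV dU) {lam : ℝ}
    (hl : 0 < lam) : Continuous (N.toMap lam) := by
  refine continuous_finsetSum _ fun k hk => (continuous_indicatorConstLp_const lam k).comp
    (N.continuous_multPart.comp (continuous_pi fun μ => continuous_pi fun sn => ?_))
  simp only [N.linearPart_eq_discFun hl _ _ _ _ hk]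
  have h1 : Continuous fun Φ : Signal dV => rep (SE2.translation (gridPoint lam k))⁻¹ Φ :=
    continuous_recenter continuous_const continuous_id
  exact (discFun lam _).continuous.comp ((comp sn.2).continuous.comp h1)

section Forward

variable {dV dU : ℕ} {f : Signal dV → Signal dU}

/-- Uniform approximation by continuous maps on compact sets gives continuity on convergent
sequences together with their limits. -/
theorem IsLimitPoint.continuous (hf : IsLimitPoint f) : Continuous f := by
  have hK : ∀ K : Set (Signal dV), IsCompact K → ContinuousOn f K := by
    intro K hK
    refine continuousOn_of_uniform_approx_of_continuousOn fun u hu => ?_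
    obtain ⟨ε, hε, hεu⟩ := Metric.mem_uniformity_dist.1 hu
    obtain ⟨N, -, lam₀, hl₀, hN⟩ := hf K hK (ε / 2) (half_pos hε) 1 one_pos
    refine ⟨N.toMap lam₀, (N.continuous_toMap hl₀).continuousOn, fun Φ hΦ => hεu ?_⟩
    rw [dist_comm, dist_eq_norm]
    linarith [hN lam₀ hl₀ le_rfl Φ hΦ]
  rw [continuous_iff_seqContinuous]
  intro u Φ hu
  have hcomp := hu.isCompact_insert_range
  have h1 := (hK _ hcomp Φ (Set.mem_insert _ _)).tendsto
  have h2 : Tendsto u atTop (𝓝[insert Φ (Set.range u)] Φ) :=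
    tendsto_nhdsWithin_iff.2 ⟨hu, Eventually.of_forall fun n =>
      Set.mem_insert_of_mem _ (Set.mem_range_self n)⟩
  exact h1.comp h2

theorem cellIndex_mem_of_norm_lt {lam Lam : ℝ} (hl : 0 < lam) {x : Plane}
    (hx : ‖x‖ < Lam - lam) : cellIndex lam x ∈ box ⌊Lam / lam⌋₊ := by
  by_contra h
  exact absurd (le_norm_of_cellIndex_notMem hl h) (not_le.2 hx)

theorem eLpNorm_restrict_le_norm {d : ℕ} (Φ : Signal d) (S : Set Plane) :
    eLpNorm Φ 2 (volume.restrict S) ≤ ENNReal.ofReal ‖Φ‖ := by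
  rw [Lp.norm_def, ENNReal.ofReal_toReal (Lp.eLpNorm_ne_top Φ)]
  exact eLpNorm_mono_measure _ Measure.restrict_le_self

theorem norm_smul_inv_le (g : SE2) (x : Plane) : ‖g⁻¹ • x‖ ≤ ‖x‖ + ‖g⁻¹ • (0 : Plane)‖ := by
  have : g⁻¹ • x = g⁻¹ • (0 : Plane) + rotateIsometry g⁻¹.rot x := by
    simp [SE2.smul_def, rotateIsometry_apply]
  rw [this, add_comm ‖x‖]
  refine (norm_add_le _ _).trans ?_
  rw [LinearIsometryEquiv.norm_map]

/-- On a ball, the defect of equivariance of a limit point is arbitrarily small. -/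
theorem IsLimitPoint.eLpNorm_defect_le (hf : IsLimitPoint f) (g : SE2) (Φ : Signal dV) (r : ℝ)
    {ε : ℝ} (hε : 0 < ε) :
    eLpNorm (f (rep g Φ) - rep g (f Φ) : Signal dU) 2 (volume.restrict (Metric.ball 0 r))
      ≤ ENNReal.ofReal ε + (volume (Metric.ball (0 : Plane) r) ^ (2 : ENNReal).toReal⁻¹
        * ENNReal.ofReal ε + ENNReal.ofReal ε) := by
  -- the two signals are approximated by the same convnet, whose continuum limit is equivariant
  set K : Set (Signal dV) := {Φ, rep g Φ} with hKdef
  have hK : IsCompact K := (Set.toFinite K).isCompact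
  obtain ⟨N, hNL, lam₁, hl₁, hN⟩ := hf K hK ε hε (|r| + ‖g⁻¹ • (0 : Plane)‖ + 1) (by positivity)
  obtain ⟨lam₂, hl₂, hN'⟩ := N.exists_toMap_close hK (half_pos hε)
  set lam := min 1 (min lam₁ lam₂) with hlam
  have hl : 0 < lam := by positivity
  have hlam1 : lam ≤ 1 := min_le_left _ _
  have hlam2 : lam ≤ lam₁ := (min_le_right _ _).trans (min_le_left _ _)
  have hlam3 : lam ≤ lam₂ := (min_le_right _ _).trans (min_le_right _ _)
  set A := f (rep g Φ) - N.toMap lam (rep g Φ) with hA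
  set B := N.toMap lam (rep g Φ) - rep g (N.toMap lam Φ) with hB
  set D := rep g (N.toMap lam Φ - f Φ) with hD
  have hsum : f (rep g Φ) - rep g (f Φ) = A + (B + D) := by
    rw [hA, hB, hD, rep_sub]
    abel
  have hAn : ‖A‖ ≤ ε := by
    rw [hA, norm_sub_rev]
    exact hN lam hl hlam2 _ (Set.mem_insert_of_mem _ rfl)
  have hDn : ‖D‖ ≤ ε := by
    rw [hD, norm_rep]
    exact hN lam hl hlam2 _ (Set.mem_insert _ _)
  have hBae : ∀ᵐ x ∂(volume.restrict (Metric.ball (0 : Plane) r)), ‖B x‖ ≤ ε := by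
    rw [ae_restrict_iff' measurableSet_ball]
    filter_upwards [hN' lam hl hlam3 (rep g Φ) (Set.mem_insert_of_mem _ rfl),
      (SE2.measurePreserving_smul g⁻¹).quasiMeasurePreserving.ae
        (hN' lam hl hlam3 Φ (Set.mem_insert _ _)), coeFn_rep g (N.toMap lam Φ),
      Lp.coeFn_sub (N.toMap lam (rep g Φ)) (rep g (N.toMap lam Φ))] with x h1 h2 h3 h4 hx
    have hxr : ‖x‖ < r := by simpa using hx
    have hxr' : ‖x‖ < |r| := hxr.trans_le (le_abs_self r)
    have m1 : cellIndex lam x ∈ box (N.radius lam) :=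
      cellIndex_mem_of_norm_lt hl (by linarith [norm_nonneg (g⁻¹ • (0 : Plane))])
    have m2 : cellIndex lam (g⁻¹ • x) ∈ box (N.radius lam) :=
      cellIndex_mem_of_norm_lt hl (by linarith [norm_smul_inv_le g x])
    have e1 := h1.1 m1
    have e2 := h2.1 m2
    rw [N.limValue_recenter_rep] at e1
    rw [h4, Pi.sub_apply, h3]
    calc _ ≤ ‖N.toMap lam (rep g Φ) x - N.limValue (recenter (g⁻¹ • x) Φ)‖
          + ‖N.limValue (recenter (g⁻¹ • x) Φ) - N.toMap lam Φ (g⁻¹ • x)‖ :=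
          norm_sub_le_norm_sub_add_norm_sub _ _ _
      _ ≤ ε / 2 + ε / 2 := add_le_add e1 (by rw [norm_sub_rev]; exact e2)
      _ = ε := add_halves ε
  have hsm : ∀ Ψ : Signal dU,
      AEStronglyMeasurable Ψ (volume.restrict (Metric.ball (0 : Plane) r)) :=
    fun Ψ => (Lp.aestronglyMeasurable Ψ).restrict
  have hcoe : eLpNorm (f (rep g Φ) - rep g (f Φ) : Signal dU) 2
      (volume.restrict (Metric.ball 0 r))
      = eLpNorm (⇑A + (⇑B + ⇑D)) 2 (volume.restrict (Metric.ball 0 r)) := by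
    rw [hsum]
    refine eLpNorm_congr_ae (ae_restrict_of_ae ?_)
    filter_upwards [Lp.coeFn_add A (B + D), Lp.coeFn_add B D] with x h1 h2
    rw [h1, Pi.add_apply, h2]
    rfl
  rw [hcoe]
  refine (eLpNorm_add_le (hsm A) ((hsm B).add (hsm D)) (by norm_num)).trans ?_
  refine add_le_add ((eLpNorm_restrict_le_norm A _).trans (ENNReal.ofReal_le_ofReal hAn)) ?_
  refine (eLpNorm_add_le (hsm B) (hsm D) (by norm_num)).trans ?_
  refine add_le_add ?_ ((eLpNorm_restrict_le_norm D _).trans (ENNReal.ofReal_le_ofReal hDn))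
  have := eLpNorm_le_of_ae_bound (p := 2) hBae
  rwa [Measure.restrict_apply_univ] at this

/-- Letting the approximation error tend to zero, the defect of equivariance vanishes on every
ball. -/
theorem IsLimitPoint.equivariant (hf : IsLimitPoint f) : SE2Equivariant f := by
  intro g Φ
  rw [← sub_eq_zero]
  set Ψ : Signal dU := f (rep g Φ) - rep g (f Φ) with hΨ
  have hball : ∀ r : ℝ, eLpNorm Ψ 2 (volume.restrict (Metric.ball 0 r)) = 0 := by
    intro r
    refine le_antisymm (ge_of_tendsto (f := fun ε : ℝ => ENNReal.ofReal ε
      + (volume (Metric.ball (0 : Plane) r) ^ (2 : ENNReal).toReal⁻¹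
        * ENNReal.ofReal ε + ENNReal.ofReal ε)) (x := 𝓝[>] 0) ?_ ?_) bot_le
    · have t0 : Tendsto (fun ε : ℝ => ENNReal.ofReal ε) (𝓝[>] 0) (𝓝 0) := by
        have h := (ENNReal.continuous_ofReal.tendsto 0).mono_left
          (nhdsWithin_le_nhds (s := Set.Ioi (0 : ℝ)))
        simpa using h
      have hv : volume (Metric.ball (0 : Plane) r) ^ (2 : ENNReal).toReal⁻¹ ≠ ⊤ :=
        ENNReal.rpow_ne_top_of_nonneg (by positivity) measure_ball_lt_top.ne
      have h := t0.add ((ENNReal.Tendsto.const_mul t0 (Or.inr hv)).add t0)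
      simpa using h
    · filter_upwards [self_mem_nhdsWithin] with ε hε
      exact hf.eLpNorm_defect_le g Φ r hε
  have hae : ∀ n : ℕ, ∀ᵐ x, x ∈ Metric.ball (0 : Plane) n → Ψ x = 0 := by
    intro n
    have h := (eLpNorm_eq_zero_iff (Lp.aestronglyMeasurable Ψ).restrict (by norm_num)).1 (hball n)
    exact (ae_restrict_iff' measurableSet_ball).1 h
  refine Lp.ext ?_
  filter_upwards [ae_all_iff.2 hae, Lp.coeFn_zero (EuclideanSpace ℝ (Fin dU)) 2
    (volume : Measure Plane)] with x hx h0
  obtain ⟨n, hn⟩ := exists_nat_gt ‖x‖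
  rw [h0, hx n (by simpa using hn)]
  rfl

end Forward

/-! ### Averages over small balls -/

/-- The uniform probability measure on the disc of radius `ρ` centred at the origin. -/
def ballMeasure (ρ : ℝ) : Measure Plane := ProbabilityTheory.cond volume (Metric.ball 0 ρ)

/-- The mean value of a signal over the disc of radius `ρ` centred at the origin. -/
def ballMean {d : ℕ} (ρ : ℝ) (F : Signal d) : EuclideanSpace ℝ (Fin d) := ∫ y, F y ∂ballMeasure ρ

theorem isProbabilityMeasure_ballMeasure {ρ : ℝ} (hρ : 0 < ρ) :
    IsProbabilityMeasure (ballMeasure ρ) :=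
  ProbabilityTheory.cond_isProbabilityMeasure_of_finite (Metric.measure_ball_pos volume 0 hρ).ne'
    measure_ball_lt_top.ne

theorem ballMeasure_le (ρ : ℝ) :
    ballMeasure ρ ≤ (volume (Metric.ball (0 : Plane) ρ))⁻¹ • volume := by
  rw [ballMeasure, ProbabilityTheory.cond]
  gcongr
  exact Measure.restrict_le_self

theorem ballMeasure_absolutelyContinuous (ρ : ℝ) : ballMeasure ρ ≪ volume :=
  ProbabilityTheory.cond_absolutelyContinuous

theorem inv_volume_ball_ne_top {ρ : ℝ} (hρ : 0 < ρ) :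
    (volume (Metric.ball (0 : Plane) ρ))⁻¹ ≠ ⊤ :=
  ENNReal.inv_ne_top.2 (Metric.measure_ball_pos volume 0 hρ).ne'

theorem integrable_ballMeasure {d : ℕ} {ρ : ℝ} (hρ : 0 < ρ) (F : Signal d) :
    Integrable F (ballMeasure ρ) := by
  have := isProbabilityMeasure_ballMeasure hρ
  exact ((Lp.memLp F).of_measure_le_smul (inv_volume_ball_ne_top hρ)
    (ballMeasure_le ρ)).integrable one_le_two

theorem enorm_integral_le_eLpNorm_two {E : Type*} [NormedAddCommGroup E] [NormedSpace ℝ E]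
    {X : Type*} [MeasurableSpace X] {ν : Measure X} [IsProbabilityMeasure ν] {u : X → E}
    (hu : AEStronglyMeasurable u ν) : ‖∫ y, u y ∂ν‖ₑ ≤ eLpNorm u 2 ν := by
  refine (enorm_integral_le_lintegral_enorm u).trans ?_
  rw [← eLpNorm_one_eq_lintegral_enorm]
  exact eLpNorm_le_eLpNorm_of_exponent_le one_le_two hu

theorem continuous_ballMean {d : ℕ} {ρ : ℝ} (hρ : 0 < ρ) :
    Continuous (ballMean ρ : Signal d → EuclideanSpace ℝ (Fin d)) := by
  have := isProbabilityMeasure_ballMeasure hρ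
  set C : ENNReal := (volume (Metric.ball (0 : Plane) ρ))⁻¹ ^ (1 / (2 : ENNReal)).toReal with hC
  have hCt : C ≠ ⊤ := ENNReal.rpow_ne_top_of_nonneg (by positivity) (inv_volume_ball_ne_top hρ)
  refine LipschitzWith.continuous (K := C.toNNReal) fun F G => ?_
  rw [ENNReal.coe_toNNReal hCt, edist_eq_enorm_sub, edist_eq_enorm_sub, ballMean, ballMean,
    ← integral_sub (integrable_ballMeasure hρ F) (integrable_ballMeasure hρ G)]
  have h1 : (fun y => F y - G y) =ᵐ[ballMeasure ρ] (F - G : Signal d) :=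
    (ballMeasure_absolutelyContinuous ρ).ae_le (Lp.coeFn_sub F G).symm
  rw [integral_congr_ae h1]
  refine (enorm_integral_le_eLpNorm_two
    (integrable_ballMeasure hρ (F - G)).aestronglyMeasurable).trans ?_
  refine (eLpNorm_mono_measure _ (ballMeasure_le ρ)).trans ?_
  rw [eLpNorm_smul_measure_of_ne_top (by norm_num), smul_eq_mul, Lp.enorm_def]

theorem ballMean_rotation {d : ℕ} (ρ : ℝ) (θ : SO2) (F : Signal d) :
    ballMean ρ (rep (SE2.rotation θ) F) = ballMean ρ F := by
  have h1 : rep (SE2.rotation θ) F =ᵐ[ballMeasure ρ] fun y => F (rotateIsometry θ⁻¹ y) := by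
    refine (ballMeasure_absolutelyContinuous ρ).ae_le ?_
    refine (coeFn_rep _ F).trans (ae_of_all _ fun y => ?_)
    simp only [SE2.rotation_inv, SE2.rotation_smul, rotateIsometry_apply]
  rw [ballMean, integral_congr_ae h1, ballMean, ballMeasure, ProbabilityTheory.cond,
    integral_smul_measure, integral_smul_measure]
  congr 1
  have h2 := (measurePreserving_rotateIsometry θ⁻¹).setIntegral_preimage_emb
    (rotateIsometry θ⁻¹).toHomeomorph.measurableEmbedding F (Metric.ball 0 ρ)
  rw [← h2]
  congr 2
  ext y
  simp

theorem eLpNorm_two_sq {E : Type*} [NormedAddCommGroup E] {X : Type*} [MeasurableSpace X]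
    (ν : Measure X) (u : X → E) : eLpNorm u 2 ν ^ 2 = ∫⁻ y, ‖u y‖ₑ ^ 2 ∂ν := by
  have h := eLpNorm_nnreal_pow_eq_lintegral (f := u) (μ := ν) (p := 2) two_ne_zero
  simpa using h

/-- Jensen's inequality: averaging over a small disc moves a signal by at most its modulus of
continuity under translations. -/
theorem eLpNorm_ballMean_recenter_sub_le {d : ℕ} {ρ : ℝ} (hρ : 0 < ρ) (F : Signal d) {η : ℝ}
    (hF : ∀ y : Plane, ‖y‖ < ρ → ‖recenter y F - F‖ ≤ η) :
    eLpNorm (fun x => ballMean ρ (recenter x F) - F x) 2 volume ≤ ENNReal.ofReal η := by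
  have := isProbabilityMeasure_ballMeasure hρ
  have hm : StronglyMeasurable F := Lp.stronglyMeasurable F
  have hm2 : StronglyMeasurable fun p : Plane × Plane => F (p.1 + p.2) - F p.1 :=
    (hm.comp_measurable measurable_add).sub (hm.comp_measurable measurable_fst)
  have hpt : ∀ x : Plane, ‖ballMean ρ (recenter x F) - F x‖ₑ ^ 2
      ≤ ∫⁻ y, ‖F (x + y) - F x‖ₑ ^ 2 ∂ballMeasure ρ := by
    intro x
    have h1 : recenter x F =ᵐ[ballMeasure ρ] fun y => F (x + y) :=
      (ballMeasure_absolutelyContinuous ρ).ae_le (coeFn_recenter x F)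
    have hi : Integrable (fun y => F (x + y)) (ballMeasure ρ) :=
      (integrable_ballMeasure hρ (recenter x F)).congr h1
    have h2 : ballMean ρ (recenter x F) - F x = ∫ y, (F (x + y) - F x) ∂ballMeasure ρ := by
      rw [ballMean, integral_congr_ae h1, integral_sub hi (integrable_const _)]
      simp
    rw [h2, ← eLpNorm_two_sq]
    gcongr
    exact enorm_integral_le_eLpNorm_two (hi.sub (integrable_const _)).aestronglyMeasurable
  have hsq : eLpNorm (fun x => ballMean ρ (recenter x F) - F x) 2 volume ^ 2
      ≤ ENNReal.ofReal η ^ 2 := by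
    rw [eLpNorm_two_sq]
    refine (lintegral_mono hpt).trans ?_
    rw [lintegral_lintegral_swap (hm2.enorm.pow_const 2).aemeasurable]
    have hball : ∀ᵐ y ∂ballMeasure ρ, y ∈ Metric.ball (0 : Plane) ρ :=
      ProbabilityTheory.ae_cond_mem measurableSet_ball
    refine (lintegral_mono_ae (g := fun _ => ENNReal.ofReal η ^ 2) ?_).trans (by simp)
    filter_upwards [hball] with y hy
    have hy' : ‖y‖ < ρ := by simpa using hy
    rw [← eLpNorm_two_sq]
    gcongr
    have h3 : (fun x => F (x + y) - F x) =ᵐ[volume] (recenter y F - F : Signal d) := by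
      filter_upwards [Lp.coeFn_sub (recenter y F) F, coeFn_recenter y F] with x h4 h5
      rw [h4, Pi.sub_apply, h5, add_comm]
    rw [eLpNorm_congr_ae h3, ← Lp.enorm_def, ← ofReal_norm]
    exact ENNReal.ofReal_le_ofReal (hF y hy')
  exact (ENNReal.pow_le_pow_left_iff two_ne_zero).1 hsq

/-- Translations are uniformly continuous on compact sets of signals. -/
theorem exists_norm_recenter_sub_le {d : ℕ} {K : Set (Signal d)} (hK : IsCompact K) {η : ℝ}
    (hη : 0 < η) : ∃ ρ : ℝ, 0 < ρ ∧ ∀ F ∈ K, ∀ y : Plane, ‖y‖ < ρ → ‖recenter y F - F‖ ≤ η := by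
  have hc : Continuous fun q : Plane × Signal d => recenter q.1 q.2 - q.2 :=
    (continuous_recenter continuous_fst continuous_snd).sub continuous_snd
  have hev := hK.eventually_forall_of_forall_eventually (x₀ := (0 : Plane))
    (P := fun y F => ‖recenter y F - F‖ < η) (fun F _ => ?_)
  · obtain ⟨ρ, hρ, h⟩ := Metric.eventually_nhds_iff.1 hev
    exact ⟨ρ, hρ, fun F hF y hy => (h (by simpa using hy) F hF).le⟩
  · refine hc.norm.continuousAt.eventually_lt continuousAt_const ?_
    have h0 : recenter (0 : Plane) F = F := by
      refine Lp.ext ((coeFn_recenter 0 F).trans (ae_of_all _ fun y => ?_))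
      simp only [zero_add]
    simpa [h0] using hη

/-- The tails of the signals in a compact set are uniformly small. -/
theorem exists_eLpNorm_tail_le {d : ℕ} {K : Set (Signal d)} (hK : IsCompact K) {η : ℝ}
    (hη : 0 < η) : ∃ R : ℝ, ∀ F ∈ K,
      eLpNorm F 2 (volume.restrict (Metric.ball (0 : Plane) R)ᶜ) ≤ ENNReal.ofReal η := by
  refine hK.induction_on (p := fun s => ∃ R : ℝ, ∀ F ∈ s,
      eLpNorm F 2 (volume.restrict (Metric.ball (0 : Plane) R)ᶜ) ≤ ENNReal.ofReal η)
    ⟨0, by simp⟩ ?_ ?_ ?_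
  · rintro s t hst ⟨R, hR⟩
    exact ⟨R, fun F hF => hR F (hst hF)⟩
  · rintro s t ⟨R, hR⟩ ⟨R', hR'⟩
    refine ⟨max R R', fun F hF => ?_⟩
    rcases hF with hF | hF
    · refine (eLpNorm_mono_measure _ (Measure.restrict_mono ?_ le_rfl)).trans (hR F hF)
      exact Set.compl_subset_compl.2 (Metric.ball_subset_ball (le_max_left _ _))
    · refine (eLpNorm_mono_measure _ (Measure.restrict_mono ?_ le_rfl)).trans (hR' F hF)
      exact Set.compl_subset_compl.2 (Metric.ball_subset_ball (le_max_right _ _))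
  · intro F _
    obtain ⟨u, hu, hFu, -, hum⟩ := (Lp.memLp F).exists_hasCompactSupport_eLpNorm_sub_le
      (by norm_num) (ε := ENNReal.ofReal (η / 2)) (by simpa using hη)
    obtain ⟨R, hR⟩ := hu.isCompact.isBounded.subset_ball (0 : Plane)
    refine ⟨Metric.ball F (η / 2),
      mem_nhdsWithin_of_mem_nhds (Metric.ball_mem_nhds F (half_pos hη)),
      R, fun G hG => ?_⟩
    have h0 : (G : Plane → _) =ᵐ[volume.restrict (Metric.ball (0 : Plane) R)ᶜ]
        ⇑(G - F) + (⇑F - u) := by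
      refine (ae_restrict_iff' measurableSet_ball.compl).2 ?_
      filter_upwards [Lp.coeFn_sub G F] with x hx hxR
      have : u x = 0 := image_eq_zero_of_notMem_tsupport fun h => hxR (hR h)
      rw [Pi.add_apply, Pi.sub_apply, hx, Pi.sub_apply, this, sub_zero, sub_add_cancel]
    rw [eLpNorm_congr_ae h0]
    have hFm : AEStronglyMeasurable (⇑F - u) (volume : Measure Plane) :=
      (Lp.aestronglyMeasurable F).sub hum.aestronglyMeasurable
    refine (eLpNorm_add_le (Lp.aestronglyMeasurable (G - F)).restrict hFm.restrict
      (by norm_num)).trans ?_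
    have h1 : eLpNorm (⇑F - u) 2 (volume.restrict (Metric.ball (0 : Plane) R)ᶜ)
        ≤ ENNReal.ofReal (η / 2) :=
      (eLpNorm_mono_measure _ Measure.restrict_le_self).trans hFu
    have h2 : eLpNorm (G - F : Signal d) 2 (volume.restrict (Metric.ball (0 : Plane) R)ᶜ)
        ≤ ENNReal.ofReal (η / 2) := by
      refine (eLpNorm_restrict_le_norm (G - F) _).trans (ENNReal.ofReal_le_ofReal ?_)
      rw [← dist_eq_norm]
      exact (Metric.mem_ball.1 hG).le
    refine (add_le_add h2 h1).trans ?_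
    rw [← ENNReal.ofReal_add (by positivity) (by positivity), add_halves]

/-! ### Convnets computing charge-neutral polynomials -/

/-- The index `(a, b, c)` of the functional `gaussDeriv a b` of the component `c` of a signal. -/
abbrev Letter (d : ℕ) : Type := ℕ × ℕ × Fin d

/-- The charge `a - b` of the letter `(a, b, c)`. -/
def Letter.charge {d : ℕ} (g : Letter d) : ℤ := (g.1 : ℤ) - g.2.1

/-- The degree `a + b` of the letter `(a, b, c)`. -/
def Letter.degree {d : ℕ} (g : Letter d) : ℕ := g.1 + g.2.1

/-- The charge of a word of letters. -/
def wordCharge {d : ℕ} (w : List (Letter d)) : ℤ := (w.map Letter.charge).sum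

/-- The degree of a word of letters. -/
def wordDegree {d : ℕ} (w : List (Letter d)) : ℕ := (w.map Letter.degree).sum

theorem abs_wordCharge_le {d : ℕ} (w : List (Letter d)) : |wordCharge w| ≤ wordDegree w := by
  induction w with
  | nil => simp [wordCharge, wordDegree]
  | cons g w ih =>
    simp only [wordCharge, wordDegree, List.map_cons, List.sum_cons] at ih ⊢
    refine (abs_add_le _ _).trans ?_
    rw [Nat.cast_add]
    refine add_le_add ?_ ih
    simp only [Letter.charge, Letter.degree, abs_le]
    omega

theorem wordDegree_append {d : ℕ} (v w : List (Letter d)) :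
    wordDegree (v ++ w) = wordDegree v + wordDegree w := by
  simp [wordDegree]

theorem wordCharge_append {d : ℕ} (v w : List (Letter d)) :
    wordCharge (v ++ w) = wordCharge v + wordCharge w := by
  simp [wordCharge]

section MultStep

variable {T : ℕ} {ι κ : Type} [Fintype ι] {w : MultWeights T ι κ} {n : κ}
  (Φ : Charge T → ι → ℂ) (μ : Charge T)

theorem multStep_eq_of_quadratic_eq_zero (h2 : ∀ μ₁ μ₂ i j, w.w2 μ₁ μ₂ n i j = 0) :
    multStep w Φ μ n = (if (μ : ℤ) = 0 then w.w0 n else 0) + ∑ i, w.w1 μ n i * Φ μ i := by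
  simp [multStep, h2]

theorem multStep_eq_of_copy {i₀ : ι} (h0 : w.w0 n = 0) (h1 : ∀ ν i, i ≠ i₀ → w.w1 ν n i = 0)
    (h1' : ∀ ν, w.w1 ν n i₀ = 1) (h2 : ∀ μ₁ μ₂ i j, w.w2 μ₁ μ₂ n i j = 0) :
    multStep w Φ μ n = Φ μ i₀ := by
  rw [multStep_eq_of_quadratic_eq_zero Φ μ h2, h0, ite_self, zero_add,
    Finset.sum_eq_single i₀ (fun i _ hi => by rw [h1 _ _ hi, zero_mul]) (by simp), h1', one_mul]

/-- A neuron multiplying the feature `i₁`, which has charge `q`, by the feature `i₂` of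
charge `ν`. -/
theorem multStep_eq_of_mul {i₁ i₂ : ι} {c v : ℂ} {q ν : Charge T} (h0 : w.w0 n = 0)
    (h1 : ∀ ν i, w.w1 ν n i = 0)
    (h2 : ∀ μ₁ μ₂ i j, ¬ ((i = i₁ ∧ j = i₂) ∧ μ₂ = ν) → w.w2 μ₁ μ₂ n i j = 0)
    (h2' : ∀ μ₁, w.w2 μ₁ ν n i₁ i₂ = c)
    (hΦ : ∀ μ' : Charge T, Φ μ' i₁ = if (μ' : ℤ) = q then v else 0) :
    multStep w Φ μ n = if (μ : ℤ) = q + ν then v * (c * Φ ν i₂) else 0 := by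
  have hin : ∀ p : Charge T × Charge T, (∑ i, ∑ j, w.w2 p.1 p.2 n i j * Φ p.1 i * Φ p.2 j)
      = w.w2 p.1 p.2 n i₁ i₂ * Φ p.1 i₁ * Φ p.2 i₂ := by
    intro p
    rw [Finset.sum_eq_single i₁, Finset.sum_eq_single i₂]
    · intro j _ hj
      rw [h2 _ _ _ _ (fun h => hj h.1.2), zero_mul, zero_mul]
    · simp
    · intro i _ hi
      exact Finset.sum_eq_zero fun j _ => by
        rw [h2 _ _ _ _ (fun h => hi h.1.1), zero_mul, zero_mul]
    · simp
  simp only [multStep, h0, h1, hin, ite_self, zero_mul, Finset.sum_const_zero, zero_add]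
  rw [Finset.sum_filter, Finset.sum_eq_single (q, ν)]
  · by_cases h : (μ : ℤ) = q + ν
    · rw [if_pos h.symm, if_pos h, h2', hΦ, if_pos rfl]
      ring
    · rw [if_neg (Ne.symm h), if_neg h]
  · rintro ⟨p, r⟩ - hpr
    by_cases hr : r = ν
    · have hp : (p : ℤ) ≠ q := fun h => hpr (by rw [hr, Subtype.ext h])
      simp [hΦ, hp]
    · simp [h2 _ _ _ _ (fun h => hr h.2)]
  · simp

end MultStep

section WordNet

variable {dV dU : ℕ} {J : Type} [Fintype J]

/-- The features of `wordNet`: copies of the inputs, and one register for each word. -/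
def wordEquiv (dV T : ℕ) (J : Type) [Fintype J] :
    Fin (Fintype.card ((Fin (T + 1) × Fin dV) ⊕ J)) ≃ (Fin (T + 1) × Fin dV) ⊕ J :=
  (Fintype.equivFin _).symm

/-- The degree and component of the input feature that holds the letter `g`. Meaningful only if
the degree of `g` is at most `T`; the degree is reduced modulo `T + 1` otherwise. -/
def Letter.feature (T : ℕ) (g : Letter dV) : Fin (T + 1) × Fin dV :=
  (Fin.ofNat (T + 1) g.degree, g.2.2)

open Classical in
/-- A convnet that computes linear combinations `∑ j, κ n j * ∏ g ∈ W j, g` of products of letters.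
The first hidden layer copies the inputs and sets the register of every word to `1`; the following
ones copy the inputs and multiply every register by the next letter of its word, divided by the
normalization `cst` of the corresponding input feature; the final layer takes linear combinations
of the registers. -/
def wordNet (Lam : ℝ) (hLam : 0 ≤ Lam) (T ℓ : ℕ) (cst : Letter dV → ℂ) (W : J → List (Letter dV))
    (κ : Fin dU → J → ℂ) : ChargeConvnet dV dU where
  Lam := Lam
  Lam_nonneg := hLam
  Tdiff := T
  Tmult := ℓ + 2
  Tmult_pos := by omega
  dMult := Fintype.card ((Fin (T + 1) × Fin dV) ⊕ J)
  hidden t := match t with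
    | 0 =>
      { w0 := fun k => Sum.elim (fun _ => 0) (fun _ => 1) (wordEquiv dV T J k)
        w1 := fun _ k i => if wordEquiv dV T J k = Sum.inl i then 1 else 0
        w2 := fun _ _ _ _ _ => 0 }
    | t + 1 =>
      { w0 := fun _ => 0
        w1 := fun _ k i => Sum.elim (fun _ => if i = k then 1 else 0)
          (fun j => if i = k ∧ (W j)[t]? = none then 1 else 0) (wordEquiv dV T J k)
        w2 := fun _ ν k i i' => Sum.elim (fun _ => 0)
          (fun j => ((W j)[t]?).elim 0 fun g =>
            if (i = k ∧ i' = (wordEquiv dV T J).symm (Sum.inl (g.feature T))) ∧ (ν : ℤ) = g.charge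
            then (cst g)⁻¹ else 0) (wordEquiv dV T J k) }
  final :=
    { w0 := fun _ => 0
      w1 := fun _ n i => Sum.elim (fun _ => 0) (fun j => κ n j) (wordEquiv dV T J i)
      w2 := fun _ _ _ _ _ => 0 }

/-- After `t + 1` hidden layers the register of a word holds the product of its first `t` letters,
in the component whose charge is the charge of this prefix. The bound on the degrees keeps the
charges of all prefixes within `-T, …, T`. -/
theorem wordNet_hiddenOutput {Lam : ℝ} {hLam : 0 ≤ Lam} {T ℓ : ℕ} {cst : Letter dV → ℂ}
    {W : J → List (Letter dV)} {κ : Fin dU → J → ℂ} (hT : ∀ j, wordDegree (W j) ≤ T)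
    {Φ : Charge T → Fin (T + 1) × Fin dV → ℂ} {v : Letter dV → ℂ}
    (hv : ∀ g : Letter dV, g.degree ≤ T → ∀ ν : Charge T, (ν : ℤ) = g.charge →
      (cst g)⁻¹ * Φ ν (g.feature T) = v g) (t : ℕ) :
    (∀ μ i, (wordNet Lam hLam T ℓ cst W κ).hiddenOutput Φ (t + 1) μ
      ((wordEquiv dV T J).symm (Sum.inl i)) = Φ μ i) ∧
    ∀ μ j, (wordNet Lam hLam T ℓ cst W κ).hiddenOutput Φ (t + 1) μ
      ((wordEquiv dV T J).symm (Sum.inr j)) =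
        if (μ : ℤ) = wordCharge ((W j).take t) then (((W j).take t).map v).prod else 0 := by
  induction t with
  | zero =>
    constructor
    · intro μ i
      refine multStep_eq_of_copy (i₀ := i) Φ μ ?_ ?_ ?_ ?_
      · simp [wordNet]
      · intro ν i' hi
        simp [wordNet]
        exact fun h => hi (Sum.inl.inj h).symm
      · simp [wordNet]
        exact fun _ _ _ => rfl
      · simp [wordNet]
    · intro μ j
      refine (multStep_eq_of_quadratic_eq_zero Φ μ ?_).trans ?_
      · simp [wordNet]
      · simp [wordNet, wordCharge]
  | succ t ih =>
    obtain ⟨ih1, ih2⟩ := ih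
    constructor
    · intro μ i
      rw [← ih1 μ i]
      refine multStep_eq_of_copy _ μ ?_ ?_ ?_ ?_
      · simp [wordNet]
      · intro ν i' hi
        simp [wordNet]
        exact hi
      · simp [wordNet]
        exact fun _ _ _ => rfl
      · simp [wordNet]
    · intro μ j
      rcases hg : (W j)[t]? with _ | g
      · have htake : (W j).take (t + 1) = (W j).take t := by
          rw [List.take_add_one, hg]
          simp
        rw [htake, ← ih2 μ j]
        refine multStep_eq_of_copy _ μ ?_ ?_ ?_ ?_
        · simp [wordNet]
        · intro ν i' hi
          simp [wordNet]
          exact fun h => absurd h hi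
        · simp [wordNet, hg]
          exact fun _ _ _ => rfl
        · simp [wordNet, hg]
      · have htake : (W j).take (t + 1) = (W j).take t ++ [g] := by
          rw [List.take_add_one, hg]
          simp
        have hdeg : wordDegree ((W j).take t) + g.degree ≤ T := by
          have h1 : wordDegree (W j) = wordDegree ((W j).take (t + 1))
              + wordDegree ((W j).drop (t + 1)) := by
            rw [← wordDegree_append, List.take_append_drop]
          rw [htake, wordDegree_append] at h1
          have h2 : wordDegree [g] = g.degree := by simp [wordDegree]
          have := hT j
          omega
        have hgc : |g.charge| ≤ T := by
          have h := abs_wordCharge_le [g]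
          simp only [wordCharge, wordDegree, List.map_cons, List.map_nil, List.sum_cons,
            List.sum_nil, add_zero] at h
          omega
        have hpc : |wordCharge ((W j).take t)| ≤ T := by
          have h := abs_wordCharge_le ((W j).take t)
          omega
        let ν : Charge T := ⟨g.charge, Finset.mem_Icc.2 (abs_le.1 hgc)⟩
        let q : Charge T := ⟨wordCharge ((W j).take t), Finset.mem_Icc.2 (abs_le.1 hpc)⟩
        have hmul := multStep_eq_of_mul
          (w := (wordNet Lam hLam T ℓ cst W κ).hidden (t + 1))
          (n := (wordEquiv dV T J).symm (Sum.inr j))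
          ((wordNet Lam hLam T ℓ cst W κ).hiddenOutput Φ (t + 1)) μ
          (i₁ := (wordEquiv dV T J).symm (Sum.inr j))
          (i₂ := (wordEquiv dV T J).symm (Sum.inl (g.feature T))) (c := (cst g)⁻¹) (q := q) (ν := ν)
          (by simp [wordNet]) (by intro ν i; simp [wordNet, hg])
          (by
            intro μ₁ μ₂ i i' h
            simp only [wordNet, Equiv.apply_symm_apply, Sum.elim_inr, hg, Option.elim_some]
            exact if_neg fun h' => h ⟨h'.1, Subtype.ext h'.2⟩)
          (by
            intro μ₁
            simp only [wordNet, Equiv.apply_symm_apply, Sum.elim_inr, hg, Option.elim_some]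
            exact if_pos ⟨⟨rfl, rfl⟩, rfl⟩) (fun μ' => ih2 μ' j)
        have hval := hv g (by omega) ν rfl
        rw [htake, wordCharge_append, List.map_append, List.prod_append]
        refine hmul.trans ?_
        rw [ih1 ν, hval]
        simp [wordCharge, q, ν]

theorem wordNet_multPart {Lam : ℝ} {hLam : 0 ≤ Lam} {T ℓ : ℕ} {cst : Letter dV → ℂ}
    {W : J → List (Letter dV)} {κ : Fin dU → J → ℂ} (hT : ∀ j, wordDegree (W j) ≤ T)
    (hℓ : ∀ j, (W j).length ≤ ℓ) (hW : ∀ j, wordCharge (W j) = 0)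
    {Φ : Charge T → Fin (T + 1) × Fin dV → ℂ} {v : Letter dV → ℂ}
    (hv : ∀ g : Letter dV, g.degree ≤ T → ∀ ν : Charge T, (ν : ℤ) = g.charge →
      (cst g)⁻¹ * Φ ν (g.feature T) = v g) (n : Fin dU) :
    (wordNet Lam hLam T ℓ cst W κ).multPart Φ n = (∑ j, κ n j * ((W j).map v).prod).re := by
  have h := (wordNet_hiddenOutput (Lam := Lam) (hLam := hLam) (ℓ := ℓ) (κ := κ) hT hv ℓ).2
  have h1 : multStep (wordNet Lam hLam T ℓ cst W κ).final
      ((wordNet Lam hLam T ℓ cst W κ).hiddenOutput Φ (ℓ + 1)) (Charge.zero T) n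
      = ∑ j, κ n j * ((W j).map v).prod := by
    refine (multStep_eq_of_quadratic_eq_zero _ _ ?_).trans ?_
    · simp [wordNet]
    · simp only [wordNet, ite_self, zero_add]
      refine ((wordEquiv dV T J).symm.sum_comp _).symm.trans ?_
      rw [Fintype.sum_sum_type]
      simp only [Equiv.apply_symm_apply, Sum.elim_inl, Sum.elim_inr, zero_mul,
        Finset.sum_const_zero, zero_add]
      refine Finset.sum_congr rfl fun j _ => ?_
      congr 1
      refine (h (Charge.zero T) j).trans ?_
      rw [List.take_of_length_le (hℓ j), hW j]
      simp [Charge.zero]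
  exact congrArg Complex.re h1

/-- The value of a letter on a signal. -/
def letterValue (Φ : Signal dV) (g : Letter dV) : ℂ := gaussDeriv g.1 g.2.1 (comp g.2.2 Φ)

/-- Every linear combination of charge-neutral products of the functionals `gaussDeriv` is the
continuum limit of a convnet. -/
theorem exists_limValue_eq (Lam : ℝ) (hLam : 0 ≤ Lam) (W : J → List (Letter dV))
    (hW : ∀ j, wordCharge (W j) = 0) (κ : Fin dU → J → ℂ) :
    ∃ N : ChargeConvnet dV dU, N.Lam = Lam ∧ ∀ Φ n,
      N.limValue Φ n = (∑ j, κ n j * ((W j).map (letterValue Φ)).prod).re := by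
  -- any `T` bounding the degrees of the words, and any `ℓ` bounding their lengths, would do
  set T := ∑ j, wordDegree (W j) with hTdef
  have hT : ∀ j, wordDegree (W j) ≤ T := fun j =>
    Finset.single_le_sum (f := fun j => wordDegree (W j)) (fun _ _ => Nat.zero_le _)
      (Finset.mem_univ j)
  set ℓ := ∑ j, (W j).length with hℓdef
  have hℓ : ∀ j, (W j).length ≤ ℓ := fun j =>
    Finset.single_le_sum (f := fun j => (W j).length) (fun _ _ => Nat.zero_le _)
      (Finset.mem_univ j)
  have hc : ∀ g : Letter dV, ∃ c : ℂ, g.degree ≤ T → c ≠ 0 ∧ ∀ u,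
      limFun T g.degree g.charge u = c * gaussDeriv g.1 g.2.1 u := by
    intro g
    by_cases hg : g.degree ≤ T
    · obtain ⟨c, hc, h⟩ := exists_limFun_eq T g.1 g.2.1 hg
      exact ⟨c, fun _ => ⟨by exact_mod_cast hc.ne', h⟩⟩
    · exact ⟨0, fun h => absurd h hg⟩
  choose cst hcst using hc
  refine ⟨wordNet Lam hLam T ℓ cst W κ, rfl, fun Φ n => ?_⟩
  refine wordNet_multPart hT hℓ hW (fun g hg ν hν => ?_) n
  obtain ⟨h0, h1⟩ := hcst g hg
  have hs : ((g.feature T).1 : ℕ) = g.degree := by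
    simp only [Letter.feature, Fin.ofNat]
    exact Nat.mod_eq_of_lt (by omega)
  have hval : (cst g)⁻¹ * limFun T g.degree g.charge (comp g.2.2 Φ) = letterValue Φ g := by
    rw [h1, inv_mul_cancel_left₀ h0]
    rfl
  rw [← hs, ← hν] at hval
  exact hval

end WordNet

/-! ### Density of polynomials in the Gaussian derivatives -/

section WordSum

variable {d : ℕ}

/-- A polynomial in the letters, given as a list of coefficients and words, evaluated at a
signal. -/
def wordSum (L : List (ℂ × List (Letter d))) (Φ : Signal d) : ℂ :=
  (L.map fun p => p.1 * (p.2.map (letterValue Φ)).prod).sum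

theorem wordSum_nil (Φ : Signal d) : wordSum [] Φ = 0 := rfl

theorem wordSum_cons (p : ℂ × List (Letter d)) (L : List (ℂ × List (Letter d))) (Φ : Signal d) :
    wordSum (p :: L) Φ = p.1 * (p.2.map (letterValue Φ)).prod + wordSum L Φ := by
  simp [wordSum]

theorem wordSum_append (L L' : List (ℂ × List (Letter d))) (Φ : Signal d) :
    wordSum (L ++ L') Φ = wordSum L Φ + wordSum L' Φ := by
  simp [wordSum]

theorem wordSum_map_mul (c : ℂ) (w : List (Letter d)) (L : List (ℂ × List (Letter d)))
    (Φ : Signal d) : wordSum (L.map fun p => (c * p.1, w ++ p.2)) Φ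
      = c * (w.map (letterValue Φ)).prod * wordSum L Φ := by
  induction L with
  | nil => simp [wordSum]
  | cons p L ih =>
    rw [List.map_cons, wordSum_cons, wordSum_cons, ih, List.map_append, List.prod_append]
    ring

theorem exists_wordSum_mul (L L' : List (ℂ × List (Letter d))) :
    ∃ L'' : List (ℂ × List (Letter d)), ∀ Φ, wordSum L'' Φ = wordSum L Φ * wordSum L' Φ := by
  induction L with
  | nil => exact ⟨[], fun Φ => by simp [wordSum_nil]⟩
  | cons p L ih =>
    obtain ⟨M, hM⟩ := ih
    refine ⟨(L'.map fun q => (p.1 * q.1, p.2 ++ q.2)) ++ M, fun Φ => ?_⟩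
    rw [wordSum_append, wordSum_map_mul, hM, wordSum_cons, add_mul]

theorem continuous_letterValue (g : Letter d) : Continuous fun Φ : Signal d => letterValue Φ g :=
  (gaussDeriv g.1 g.2.1).continuous.comp (comp g.2.2).continuous

theorem letterValue_rotation (θ : SO2) (Φ : Signal d) (g : Letter d) :
    letterValue (rep (SE2.rotation θ) Φ) g = phase θ ^ g.charge * letterValue Φ g := by
  rw [letterValue, comp_rep, gaussDeriv_crep_rotation]
  rfl

/-- The letters separate signals. -/
theorem eq_of_letterValue_eq {Φ Ψ : Signal d} (h : ∀ g, letterValue Φ g = letterValue Ψ g) :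
    Φ = Ψ := by
  have h0 : ∀ c : Fin d, comp c (Φ - Ψ) = 0 := by
    intro c
    refine eq_zero_of_gaussDeriv_eq_zero _ fun a b => ?_
    rw [map_sub, map_sub, sub_eq_zero]
    exact h (a, b, c)
  have h1 : ∀ c : Fin d, ∀ᵐ x, (Φ - Ψ : Signal d) x c = 0 := by
    intro c
    have h2 := coeFn_comp c (Φ - Ψ)
    rw [h0 c] at h2
    filter_upwards [h2, Lp.coeFn_zero ℂ 2 (volume : Measure Plane)] with x h3 h4
    rw [h4, Pi.zero_apply] at h3
    exact Complex.ofReal_eq_zero.1 h3.symm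
  rw [← sub_eq_zero]
  refine Lp.ext ?_
  filter_upwards [ae_all_iff.2 h1, Lp.coeFn_zero (EuclideanSpace ℝ (Fin d)) 2
    (volume : Measure Plane)] with x h3 h4
  rw [h4]
  ext c
  exact h3 c

/-- The letters as continuous functions on a set of signals. -/
def letterMap (K : Set (Signal d)) (g : Letter d) : C(K, ℂ) :=
  ⟨fun Φ => letterValue (Φ : Signal d) g, (continuous_letterValue g).comp continuous_subtype_val⟩

theorem star_letterMap_mem (K : Set (Signal d)) (g : Letter d) :
    star (letterMap K g) ∈ Algebra.adjoin ℂ (Set.range (letterMap K)) := by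
  obtain ⟨r, hr⟩ := exists_gaussDeriv_conj g.1 g.2.1
  have h : star (letterMap K g) = r • letterMap K (g.2.1, g.1, g.2.2) := by
    ext Φ
    exact hr d g.2.2 Φ
  rw [h]
  exact Subalgebra.smul_mem _ (Algebra.subset_adjoin (Set.mem_range_self _)) r

/-- The polynomials in the letters, which form a self-adjoint algebra of functions because the
signals are real-valued. -/
def letterAlgebra (K : Set (Signal d)) : StarSubalgebra ℂ C(K, ℂ) :=
  { Algebra.adjoin ℂ (Set.range (letterMap K)) with
    star_mem' := by
      intro u hu
      refine Algebra.adjoin_induction (p := fun u _ => star u ∈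
        Algebra.adjoin ℂ (Set.range (letterMap K))) ?_ ?_ ?_ ?_ hu
      · rintro _ ⟨g, rfl⟩
        exact star_letterMap_mem K g
      · intro r
        rw [← algebraMap_star_comm]
        exact Subalgebra.algebraMap_mem _ _
      · intro u v _ _ hu hv
        rw [star_add]
        exact add_mem hu hv
      · intro u v _ _ hu hv
        rw [star_mul]
        exact mul_mem hv hu }

theorem exists_wordSum_eq {K : Set (Signal d)} {u : C(K, ℂ)} (hu : u ∈ letterAlgebra K) :
    ∃ L : List (ℂ × List (Letter d)), ∀ Φ : K, u Φ = wordSum L Φ := by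
  refine Algebra.adjoin_induction (s := Set.range (letterMap K)) (p := fun u _ =>
    ∃ L : List (ℂ × List (Letter d)), ∀ Φ : K, u Φ = wordSum L Φ) ?_ ?_ ?_ ?_ hu
  · rintro _ ⟨g, rfl⟩
    exact ⟨[(1, [g])], fun Φ => by simp [wordSum, letterMap]⟩
  · intro r
    exact ⟨[(r, [])], fun Φ => by simp [wordSum]⟩
  · rintro u v _ _ ⟨L, hL⟩ ⟨L', hL'⟩
    exact ⟨L ++ L', fun Φ => by rw [wordSum_append, ← hL, ← hL']; rfl⟩
  · rintro u v _ _ ⟨L, hL⟩ ⟨L', hL'⟩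
    obtain ⟨M, hM⟩ := exists_wordSum_mul L L'
    exact ⟨M, fun Φ => by rw [hM, ← hL, ← hL']; rfl⟩

/-- The Stone–Weierstrass theorem for polynomials in the letters. -/
theorem exists_wordSum_close {K : Set (Signal d)} (hK : IsCompact K) {h : Signal d → ℝ}
    (hh : Continuous h) {δ : ℝ} (hδ : 0 < δ) :
    ∃ L : List (ℂ × List (Letter d)), ∀ Φ ∈ K, ‖wordSum L Φ - (h Φ : ℂ)‖ ≤ δ := by
  have : CompactSpace K := isCompact_iff_compactSpace.1 hK
  have hsep : (letterAlgebra K).SeparatesPoints := by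
    intro Φ Ψ hne
    by_contra hcon
    push Not at hcon
    refine hne (Subtype.ext (eq_of_letterValue_eq fun g => ?_))
    exact hcon _ ⟨letterMap K g, Algebra.subset_adjoin (Set.mem_range_self g), rfl⟩
  have htop := ContinuousMap.starSubalgebra_topologicalClosure_eq_top_of_separatesPoints
    (letterAlgebra K) hsep
  let H : C(K, ℂ) := ⟨fun Φ => (h Φ : ℂ),
    Complex.continuous_ofReal.comp (hh.comp continuous_subtype_val)⟩
  have hH : H ∈ (letterAlgebra K).topologicalClosure := htop ▸ StarSubalgebra.mem_top
  obtain ⟨u, hu, hd⟩ := Metric.mem_closure_iff.1 hH δ hδ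
  obtain ⟨L, hL⟩ := exists_wordSum_eq hu
  refine ⟨L, fun Φ hΦ => ?_⟩
  have h1 := ContinuousMap.dist_apply_le_dist (f := H) (g := u) ⟨Φ, hΦ⟩
  rw [hL, dist_comm, dist_eq_norm] at h1
  exact h1.trans hd.le

end WordSum

/-! ### Averaging over rotations -/

/-- The rotation by the angle `α`. -/
def rotAngle (α : ℝ) : SO2 :=
  ⟨!![Real.cos α, -Real.sin α; Real.sin α, Real.cos α], by
    rw [Matrix.mem_specialOrthogonalGroup_iff, Matrix.mem_orthogonalGroup_iff]
    constructor
    · ext i j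
      fin_cases i <;> fin_cases j <;>
        simp [Matrix.mul_apply, Fin.sum_univ_two, ← sq] <;> ring
    · rw [Matrix.det_fin_two_of]
      nlinarith [Real.sin_sq_add_cos_sq α]⟩

theorem phase_rotAngle (α : ℝ) : phase (rotAngle α) = Complex.exp (-(α * Complex.I)) := by
  rw [← neg_mul, Complex.exp_mul_I, Complex.cos_neg, Complex.sin_neg]
  simp [phase, rotAngle]
  ring

theorem rotAngle_inv (α : ℝ) : (rotAngle α)⁻¹ = rotAngle (-α) := by
  rw [inv_eq_iff_mul_eq_one]
  ext i j
  fin_cases i <;> fin_cases j <;>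
    simp [rotAngle, ← sq] <;> ring

theorem continuous_rep_rotAngle {d : ℕ} :
    Continuous fun p : ℝ × Signal d => rep (SE2.rotation (rotAngle p.1)) p.2 := by
  refine continuous_rep_of_continuous (γ := fun p : ℝ × Signal d => SE2.rotation (rotAngle p.1))
    ?_ continuous_snd
  have h : ∀ p : (ℝ × Signal d) × Plane, (SE2.rotation (rotAngle p.1.1))⁻¹ • p.2
      = !₂[Real.cos (-p.1.1) * p.2 0 - Real.sin (-p.1.1) * p.2 1,
        Real.sin (-p.1.1) * p.2 0 + Real.cos (-p.1.1) * p.2 1] := by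
    intro p
    rw [SE2.rotation_inv, SE2.rotation_smul, rotAngle_inv]
    ext i
    fin_cases i
    · exact rotate_apply_zero _ _
    · exact rotate_apply_one _ _
  simp only [h]
  refine (PiLp.continuous_toLp 2 _).comp (continuous_pi fun i => ?_)
  fin_cases i <;> simp <;> fun_prop

/-- The `q`-th powers of the phases of the `n` rotations by multiples of `2π / n` are the powers of
an `n`-th root of unity, which for `0 < |q| < n` is not `1`. -/
theorem sum_phase_zpow {n : ℕ} {q : ℤ} (hq : q.natAbs < n) :
    ∑ j ∈ Finset.range n, phase (rotAngle (2 * Real.pi * j / n)) ^ q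
      = if q = 0 then (n : ℂ) else 0 := by
  have hn : n ≠ 0 := by omega
  set ζ : ℂ := Complex.exp (2 * Real.pi * Complex.I / n) with hζ
  have hprim : IsPrimitiveRoot ζ n := Complex.isPrimitiveRoot_exp n hn
  have hterm : ∀ j : ℕ, phase (rotAngle (2 * Real.pi * j / n)) ^ q = (ζ ^ (-q)) ^ j := by
    intro j
    have h1 : phase (rotAngle (2 * Real.pi * j / n)) = (ζ ^ j)⁻¹ := by
      rw [phase_rotAngle, hζ, ← Complex.exp_nat_mul, ← Complex.exp_neg]
      congr 1
      push_cast
      ring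
    rw [h1, inv_zpow', ← zpow_natCast, ← zpow_natCast, ← zpow_mul, ← zpow_mul, mul_comm]
  simp only [hterm]
  split_ifs with h0
  · simp [h0]
  · have hne : ζ ^ (-q) ≠ 1 := by
      intro h
      rw [hprim.zpow_eq_one_iff_dvd, dvd_neg] at h
      exact h0 (Int.eq_zero_of_dvd_of_natAbs_lt_natAbs h (by simpa using hq))
    have hpow : (ζ ^ (-q)) ^ n = 1 := by
      rw [← zpow_natCast, ← zpow_mul, mul_comm, zpow_mul, zpow_natCast, hprim.pow_eq_one, one_zpow]
    have h := mul_geom_sum (ζ ^ (-q)) n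
    rw [hpow, sub_self] at h
    exact (mul_eq_zero.1 h).resolve_left (sub_ne_zero.2 hne)

theorem prod_letterValue_rotation {d : ℕ} (θ : SO2) (Φ : Signal d) (w : List (Letter d)) :
    (w.map (letterValue (rep (SE2.rotation θ) Φ))).prod
      = phase θ ^ wordCharge w * (w.map (letterValue Φ)).prod := by
  induction w with
  | nil => simp [wordCharge]
  | cons g w ih =>
    have hw : wordCharge (g :: w) = g.charge + wordCharge w := by simp [wordCharge]
    rw [List.map_cons, List.prod_cons, ih, letterValue_rotation, hw, zpow_add₀ (phase_ne_zero θ),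
      List.map_cons, List.prod_cons]
    ring

/-- Averaging over rotations removes the words that are not charge-neutral. -/
theorem sum_wordSum_rotation {d : ℕ} {n : ℕ} (L : List (ℂ × List (Letter d)))
    (hL : ∀ p ∈ L, (wordCharge p.2).natAbs < n) (Φ : Signal d) :
    ∑ j ∈ Finset.range n, wordSum L (rep (SE2.rotation (rotAngle (2 * Real.pi * j / n))) Φ)
      = n * wordSum (L.filter fun p => wordCharge p.2 = 0) Φ := by
  induction L with
  | nil => simp [wordSum_nil]
  | cons p L ih =>
    have ih' := ih fun q hq => hL q (List.mem_cons_of_mem _ hq)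
    have hp := sum_phase_zpow (hL p List.mem_cons_self)
    simp only [wordSum_cons, Finset.sum_add_distrib, ih', prod_letterValue_rotation,
      ← mul_assoc, ← Finset.mul_sum, ← Finset.sum_mul]
    rw [hp, List.filter_cons]
    by_cases h0 : wordCharge p.2 = 0
    · simp only [h0, if_true, decide_true, wordSum_cons]
      ring
    · simp [h0]

/-- Rotation invariant continuous functions of signals are approximated on compact sets by
charge-neutral polynomials. -/
theorem exists_neutral_wordSum_close {d : ℕ} {K : Set (Signal d)} (hK : IsCompact K)
    {h : Signal d → ℝ} (hh : Continuous h) (hrot : ∀ θ Φ, h (rep (SE2.rotation θ) Φ) = h Φ)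
    {δ : ℝ} (hδ : 0 < δ) :
    ∃ L : List (ℂ × List (Letter d)), (∀ p ∈ L, wordCharge p.2 = 0) ∧
      ∀ Φ ∈ K, ‖wordSum L Φ - (h Φ : ℂ)‖ ≤ δ := by
  -- the letters are not rotation invariant, so the approximation has to hold on all rotated signals
  have hK2 : IsCompact ((fun p : ℝ × Signal d => rep (SE2.rotation (rotAngle p.1)) p.2) ''
      (Set.Icc 0 (2 * Real.pi) ×ˢ K)) := (isCompact_Icc.prod hK).image continuous_rep_rotAngle
  obtain ⟨L, hL⟩ := exists_wordSum_close hK2 hh hδ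
  -- a number of rotations exceeding all charges that occur in `L`
  set n := (L.map fun p => (wordCharge p.2).natAbs).sum + 1 with hn
  have hLn : ∀ p ∈ L, (wordCharge p.2).natAbs < n := by
    intro p hp
    have := List.single_le_sum (l := L.map fun p => (wordCharge p.2).natAbs) (by simp) _
      (List.mem_map_of_mem hp)
    omega
  have hn0 : 0 < n := Nat.succ_pos _
  have hn0' : (0 : ℝ) < n := by exact_mod_cast hn0
  refine ⟨L.filter fun p => wordCharge p.2 = 0, fun p hp => by simpa using (List.mem_filter.1 hp).2,
    fun Φ hΦ => ?_⟩
  have hsum := sum_wordSum_rotation L hLn Φ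
  have h1 : (n : ℂ) * (wordSum (L.filter fun p => wordCharge p.2 = 0) Φ - (h Φ : ℂ))
      = ∑ j ∈ Finset.range n, (wordSum L (rep (SE2.rotation (rotAngle (2 * Real.pi * j / n))) Φ)
        - (h (rep (SE2.rotation (rotAngle (2 * Real.pi * j / n))) Φ) : ℂ)) := by
    simp only [hrot]
    rw [Finset.sum_sub_distrib, hsum, Finset.sum_const, Finset.card_range, nsmul_eq_mul, mul_sub]
  have h2 : ‖(n : ℂ) * (wordSum (L.filter fun p => wordCharge p.2 = 0) Φ - (h Φ : ℂ))‖ ≤ n * δ := by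
    rw [h1]
    refine (norm_sum_le_of_le (n := fun _ => δ) _ fun j hj => ?_).trans (by simp)
    refine hL _ ⟨(2 * Real.pi * j / n, Φ), ⟨⟨by positivity, ?_⟩, hΦ⟩, rfl⟩
    rw [div_le_iff₀ hn0']
    have hj' : (j : ℝ) ≤ n := by exact_mod_cast (Finset.mem_range.1 hj).le
    exact mul_le_mul_of_nonneg_left hj' (by positivity)
  rw [norm_mul, Complex.norm_natCast] at h2
  exact le_of_mul_le_mul_left h2 hn0'

/-- Rotation invariant continuous maps from signals to vectors are approximated on compact sets by
continuum limits of convnets. -/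
theorem exists_limValue_close {dV dU : ℕ} {K : Set (Signal dV)} (hK : IsCompact K)
    {h : Signal dV → EuclideanSpace ℝ (Fin dU)} (hh : Continuous h)
    (hrot : ∀ θ Φ, h (rep (SE2.rotation θ) Φ) = h Φ) {Lam : ℝ} (hLam : 0 ≤ Lam) {δ : ℝ}
    (hδ : 0 < δ) :
    ∃ N : ChargeConvnet dV dU, N.Lam = Lam ∧ ∀ Φ ∈ K, ‖N.limValue Φ - h Φ‖ ≤ δ := by
  have hδ' : 0 < δ / (dU + 1) := by positivity
  have hex := fun n : Fin dU => exists_neutral_wordSum_close hK (h := fun Φ => h Φ n)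
    (by fun_prop) (fun θ Φ => by rw [hrot]) hδ'
  choose L hL0 hL using hex
  obtain ⟨N, hN, hlim⟩ := exists_limValue_eq (J := Σ n : Fin dU, Fin (L n).length) (dU := dU) Lam
    hLam (fun j => (L j.1)[j.2].2) (fun j => hL0 _ _ (List.getElem_mem _))
    (fun n j => if j.1 = n then (L j.1)[j.2].1 else 0)
  refine ⟨N, hN, fun Φ hΦ => ?_⟩
  have hcomp : ∀ n, N.limValue Φ n = (wordSum (L n) Φ).re := by
    intro n
    rw [hlim, Fintype.sum_sigma, Finset.sum_eq_single n]
    · simp only [if_true]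
      rw [wordSum, ← Fin.sum_univ_fun_getElem]
      rfl
    · intro m _ hm
      simp [hm]
    · simp
  have hle : ∀ n, ‖(N.limValue Φ - h Φ) n‖ ≤ δ / (dU + 1) := by
    intro n
    refine le_trans ?_ (hL n Φ hΦ)
    rw [PiLp.sub_apply, hcomp]
    have : (wordSum (L n) Φ).re - h Φ n = (wordSum (L n) Φ - (h Φ n : ℂ)).re := by simp
    rw [this]
    exact Complex.abs_re_le_norm _
  rw [← sq_le_sq₀ (norm_nonneg _) hδ.le, EuclideanSpace.norm_sq_eq]
  calc ∑ n, ‖(N.limValue Φ - h Φ) n‖ ^ 2 ≤ ∑ _n : Fin dU, (δ / (dU + 1)) ^ 2 := by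
        gcongr with n
        exact hle n
    _ = dU * (δ / (dU + 1)) ^ 2 := by simp
    _ ≤ (dU + 1) ^ 2 * (δ / (dU + 1)) ^ 2 := by
        gcongr
        nlinarith [(Nat.cast_nonneg dU : (0 : ℝ) ≤ dU)]
    _ = δ ^ 2 := by
        field_simp

/-! ### Continuous equivariant maps are limit points -/

/-- A signal that is pointwise close to a mollification of `F` on a range containing the ball of
radius `R`, and vanishes outside this range, is close to `F` in norm. -/
theorem norm_sub_le_of_pointwise {d : ℕ} {F G : Signal d} {g : Plane → EuclideanSpace ℝ (Fin d)}
    (hg : Continuous g) {S : Set Plane} (hS : MeasurableSet S) {R δ η : ℝ}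
    (hη : 0 ≤ η) (hδ : 0 ≤ δ)
    (hSδ : ENNReal.ofReal δ * volume S ^ (1 / (2 : ENNReal).toReal) ≤ ENNReal.ofReal η)
    (hgF : eLpNorm (fun x => g x - F x) 2 volume ≤ ENNReal.ofReal η)
    (hFR : eLpNorm F 2 (volume.restrict (Metric.ball (0 : Plane) R)ᶜ) ≤ ENNReal.ofReal η)
    (hG : ∀ᵐ x, (x ∈ S ∧ ‖G x - g x‖ ≤ δ) ∨ (R ≤ ‖x‖ ∧ G x = 0)) :
    ‖G - F‖ ≤ 3 * η := by
  -- the error is bounded by `δ` on `S`, plus the mollification error, plus the tail of `F`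
  set A : Plane → ℝ := S.indicator fun _ => δ with hA
  set B : Plane → ℝ := fun x => ‖g x - F x‖ with hB
  set C : Plane → ℝ := fun x => ‖(Metric.ball (0 : Plane) R)ᶜ.indicator F x‖ with hC
  have hA0 : ∀ x, 0 ≤ A x := fun x => Set.indicator_nonneg (fun _ _ => hδ) x
  have hFm : AEStronglyMeasurable F (volume : Measure Plane) := Lp.aestronglyMeasurable F
  have hpt : ∀ᵐ x, ‖(G - F : Signal d) x‖ ≤ (A + (B + C)) x := by
    filter_upwards [hG, Lp.coeFn_sub G F] with x hx h1
    rw [h1, Pi.sub_apply, Pi.add_apply, Pi.add_apply]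
    rcases hx with ⟨hxS, hx⟩ | ⟨hxR, hx⟩
    · have hAx : A x = δ := Set.indicator_of_mem hxS _
      have h2 := norm_sub_le_norm_sub_add_norm_sub (G x) (g x) (F x)
      have h3 : 0 ≤ C x := norm_nonneg _
      have h4 : B x = ‖g x - F x‖ := rfl
      linarith
    · have hCx : C x = ‖F x‖ := by
        simp only [hC]
        rw [Set.indicator_of_mem (by simpa using hxR)]
      have h3 : 0 ≤ B x := norm_nonneg _
      rw [hx, zero_sub, norm_neg, ← hCx]
      linarith [hA0 x]
  have hAm : AEStronglyMeasurable A (volume : Measure Plane) :=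
    (aestronglyMeasurable_const).indicator hS
  have hBm : AEStronglyMeasurable B (volume : Measure Plane) :=
    (hg.aestronglyMeasurable.sub hFm).norm
  have hCm : AEStronglyMeasurable C (volume : Measure Plane) :=
    (hFm.indicator measurableSet_ball.compl).norm
  have eA : eLpNorm A 2 volume ≤ ENNReal.ofReal η := by
    rw [hA, eLpNorm_indicator_const hS (by norm_num) (by norm_num), Real.enorm_of_nonneg hδ]
    exact hSδ
  have eB : eLpNorm B 2 volume ≤ ENNReal.ofReal η := by
    rw [hB, eLpNorm_norm]
    exact hgF
  have eC : eLpNorm C 2 volume ≤ ENNReal.ofReal η := by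
    rw [hC, eLpNorm_norm, eLpNorm_indicator_eq_eLpNorm_restrict measurableSet_ball.compl]
    exact hFR
  have htot : eLpNorm (G - F : Signal d) 2 volume ≤ ENNReal.ofReal (3 * η) := by
    refine (eLpNorm_mono_ae_real hpt).trans ?_
    refine (eLpNorm_add_le hAm (hBm.add hCm) (by norm_num)).trans ?_
    refine (add_le_add eA ((eLpNorm_add_le hBm hCm (by norm_num)).trans
      (add_le_add eB eC))).trans ?_
    rw [← ENNReal.ofReal_add hη hη, ← ENNReal.ofReal_add hη (by positivity)]
    exact ENNReal.ofReal_le_ofReal (by linarith)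
  rw [Lp.norm_def]
  exact ENNReal.toReal_le_of_le_ofReal (by positivity) htot

/-- The constant is split as `δ + δ` to leave room for two errors of size `δ`. -/
theorem exists_pos_mul_le {v : ENNReal} (hv : v ≠ ⊤) {η : ℝ} (hη : 0 < η) :
    ∃ δ : ℝ, 0 < δ ∧ ENNReal.ofReal (δ + δ) * v ≤ ENNReal.ofReal η := by
  refine ⟨η / (2 * (v.toReal + 1)), by positivity, ?_⟩
  rw [← ENNReal.ofReal_toReal hv, ← ENNReal.ofReal_mul (by positivity)]
  refine ENNReal.ofReal_le_ofReal ?_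
  rw [ENNReal.toReal_ofReal ENNReal.toReal_nonneg]
  have : 0 ≤ v.toReal := ENNReal.toReal_nonneg
  rw [← add_div, div_mul_eq_mul_div, div_le_iff₀ (by positivity)]
  nlinarith

theorem isLimitPoint_of_continuous_of_equivariant {dV dU : ℕ} {f : Signal dV → Signal dU}
    (hf : Continuous f) (he : SE2Equivariant f) : IsLimitPoint f := by
  intro K hK ε hε Lam₀ hLam₀
  have hη : 0 < ε / 3 := by positivity
  have hK' : IsCompact (f '' K) := hK.image hf
  obtain ⟨ρ, hρ, hmod⟩ := exists_norm_recenter_sub_le hK' hη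
  obtain ⟨R, htail⟩ := exists_eLpNorm_tail_le hK' hη
  -- For grid spacings at most `1` the output range contains the ball of radius `Lam - 1 ≥ R` and
  -- lies in the ball `S` of radius `2 * Lam + 1`.
  set Lam := Lam₀ + |R| + 1 with hLam
  have hLam0 : 0 ≤ Lam := by positivity
  -- The value at the origin of the mollification of `f Φ`; the value at `x` is obtained by
  -- recentering.
  set h : Signal dV → EuclideanSpace ℝ (Fin dU) := fun Φ => ballMean ρ (f Φ) with hh
  have hhc : Continuous h := (continuous_ballMean hρ).comp hf
  have hhr : ∀ θ Φ, h (rep (SE2.rotation θ) Φ) = h Φ := by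
    intro θ Φ
    simp only [hh]
    rw [he, ballMean_rotation]
  have hhe : ∀ x Φ, h (recenter x Φ) = ballMean ρ (recenter x (f Φ)) := by
    intro x Φ
    simp only [hh, recenter]
    rw [he]
  set S := Metric.closedBall (0 : Plane) (2 * Lam + 1) with hS
  have hv : volume S ^ (1 / (2 : ENNReal).toReal) ≠ ⊤ :=
    ENNReal.rpow_ne_top_of_nonneg (by positivity) measure_closedBall_lt_top.ne
  obtain ⟨δ, hδ, hδS⟩ := exists_pos_mul_le hv hη
  have hK1 : IsCompact ((fun q : Plane × Signal dV => recenter q.1 q.2) '' (S ×ˢ K)) :=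
    ((isCompact_closedBall _ _).prod hK).image (continuous_recenter continuous_fst continuous_snd)
  obtain ⟨N, hNL, hN⟩ := exists_limValue_close hK1 hhc hhr hLam0 hδ
  obtain ⟨lam₁, hl₁, hclose⟩ := N.exists_toMap_close hK hδ
  refine ⟨N, by rw [hNL, hLam]; linarith [abs_nonneg R], min 1 lam₁, by positivity,
    fun lam hl hle Φ hΦ => ?_⟩
  have hl1 : lam ≤ 1 := hle.trans (min_le_left _ _)
  have hfin := norm_sub_le_of_pointwise (F := f Φ) (G := N.toMap lam Φ)
    (g := fun x => ballMean ρ (recenter x (f Φ))) (S := S) (R := R)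
    ((continuous_ballMean hρ).comp (continuous_recenter continuous_id continuous_const))
    measurableSet_closedBall hη.le (add_nonneg hδ.le hδ.le) hδS
    (eLpNorm_ballMean_recenter_sub_le hρ (f Φ) (hmod _ (Set.mem_image_of_mem f hΦ)))
    (htail _ (Set.mem_image_of_mem f hΦ)) ?_
  · linarith
  · filter_upwards [hclose lam hl (hle.trans (min_le_right _ _)) Φ hΦ] with x hx
    by_cases hmem : cellIndex lam x ∈ box (N.radius lam)
    · left
      have hxn := norm_le_of_cellIndex_mem hl N.Lam_nonneg hmem
      rw [hNL] at hxn
      have hxS : x ∈ S := by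
        rw [hS, mem_closedBall_zero_iff]
        linarith
      refine ⟨hxS, (norm_sub_le_norm_sub_add_norm_sub _ (N.limValue (recenter x Φ)) _).trans ?_⟩
      refine add_le_add (hx.1 hmem) ?_
      rw [← hhe]
      exact hN _ ⟨(x, Φ), ⟨hxS, hΦ⟩, rfl⟩
    · right
      refine ⟨?_, hx.2 hmem⟩
      have := le_norm_of_cellIndex_notMem hl hmem
      rw [hNL] at this
      linarith [le_abs_self R]

end CCNet

end

theorem mainTheorem1 (dV dU : ℕ) (f : CCNet.Signal dV → CCNet.Signal dU) :
    CCNet.IsLimitPoint f ↔ Continuous f ∧ CCNet.SE2Equivariant f :=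
  ⟨fun h => ⟨h.continuous, h.equivariant⟩,
    fun h => CCNet.isLimitPoint_of_continuous_of_equivariant h.1 h.2⟩
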